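/- **Conventions.** Fix $n\ge 0$. A multiindex is a 3-element subset of $\{1,\dots,n\}$. The group $G_n^3$ has generators $a_m$ ($m$ a multiindex) and relations $a_m^2=1$; $a_ma_{m'}=a_{m'}a_m$ if $|m\cap m'|<2$; and $a_{m^1}a_{m^2}a_{m^3}a_{m^4}=a_{m^4}a_{m^3}a_{m^2}a_{m^1}$ for each 4-tuple $(u_1,\dots,u_4)$ of distinct indices, where $m^j=\{u_1,\dots,u_4\}\setminus\{u_j\}$. A property of sets of particles is *3-good* if it passes to subsets, holds for all 2-element sets, and, for distinct indices $i_1,\dots,i_4$, holds for $\{i_1,\dots,i_4\}$ whenever it holds for $\{i_1,i_2,i_3\}$ and for $\{i_2,i_3,i_4\}$. For a motion of $n$ numbered, pairwise distinct points of $\mathbb R^2$, a moment is *critical* if some three of the points are collinear at that moment. The motion is *pleasant* if there are finitely many critical moments and at each of them exactly one triple is collinear; it is *stable* if at each critical moment the orientation of the collinear triple changes sign. The *type* of a pleasant motion $D$ is the sequence $m^1,\dots,m^N$ of its collinear triples in order of time, and $c(D)=a_{m^1}\cdots a_{m^N}\in G_n^3$. Let $C_n$ be the space of ordered $n$-tuples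 of distinct points of $\mathbb R^2$; a state $x\in C_n$ is *generic* if no three of its points are collinear. A *picture* consists of $n$ strands in the plane, the $i$-th joining $(i,0)$ to $(i,1)$ and being the graph $\{(f_i(t),t)\}$ of a continuous $f_i:[0,1]\to\mathbb R$, any two strands meeting finitely often, with finitely many crossings marked by solid dots; at each dot exactly three strands meet, transversally, and the dots have distinct heights in $(0,1)$. Its *word* is the sequence of triples of strands at its dots, from bottom to top. Pictures are *equivalent* if they are related by a sequence of changes not affecting the word and of local moves on the word: inserting or deleting $m\,m$; replacing $m\,m'$ by $m'\,m$ if $|m\cap m'|<2$; replacing $m^1m^2m^3m^4$ by $m^4m^3m^2m^1$ for $m^j$ as above. A *weaving* is a numbered collection of $n$ pairwise skew lines in $\mathbb R^3$. It is *upright* if no line is horizontal. Intersecting an upright weaving with the plane at height $t\in\mathbb R$ gives its *horizontal motion*, whose critical moments are the heights of its horizontal trisecants. A weaving has *generic directions* if no three of its lines are parallel to a common plane. Isotopies are continuous families of weavings. **Theorem.** 1. For every $z\in C_n$, collinearity is a 3-good property of subsets of the points of $z$. 2. Let $x,y\in C_n$ be generic. Every path in $C_n$ from $x$ to $y$ is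 homotopic rel endpoints to a pleasant stable one, and if $D,D'$ are pleasant stable paths from $x$ to $y$ that are homotopic rel endpoints, then $c(D)=c(D')$ in $G_n^3$. 3. For each generic $x$ there is a unique homomorphism $\varphi:PB_n=\pi_1(C_n,x)\to G_n^3$ (braids being multiplied by concatenation) with $\varphi([D])=c(D)$ for every pleasant stable loop $D$ at $x$. 4. Every finite sequence of multiindices is the word of a picture, and two pictures are equivalent if and only if their words represent the same element of $G_n^3$. For each generic $x$ there is a unique map $\psi$ from $PB_n=\pi_1(C_n,x)$ to the set of equivalence classes of pictures such that $\psi([D])$ is the class of $P$ whenever $D$ is a pleasant stable loop at $x$ and $P$ is a picture whose word is the type of $D$. 5. Each upright weaving has exactly one horizontal motion. Each upright weaving is isotopic, through upright weavings, to one with generic directions and with pleasant stable horizontal motion. There is a unique map from upright weavings to conjugacy classes of $G_n^3$ that is invariant under isotopy through upright weavings and that takes each upright weaving with generic directions and pleasant stable horizontal motion $D$ to the conjugacy class of $c(D)$. 6. Each upright weaving with generic directions is isotopic, through such weavings, to one whose horizontal motion is pleasant and stable. There is a unique map from upright weavings with generic directions to $G_n^3$ that is invariant under isotopy through upright weavings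 with generic directions and takes the value $c(D)$ on each such weaving with pleasant stable horizontal motion $D$. -/

import Mathlib

open Topology

/-! ## Multiindices, `k`-good properties, pleasant dynamical systems and their type -/

/-- A multiindex: an unordered `k`-tuple of pairwise distinct indices among `n`. -/
abbrev MultiIndex (n k : ℕ) : Type := {s : Finset (Fin n) // s.card = k}

/-- A property `P` of sets of particles (given by their indices) is `k`-good: it passes to subsets;
it holds for every set of `k - 1` particles; and if it holds for the particles `i 0, …, i (k-1)`
and for the particles `i 1, …, i k`, then it holds for all the `k + 1` particles `i 0, …, i k`. -/
structure IsGoodProperty {n : ℕ} (k : ℕ) (P : Finset (Fin n) → Prop) : Prop where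
  subset : ∀ s t : Finset (Fin n), t ⊆ s → P s → P t
  small : ∀ s : Finset (Fin n), s.card + 1 = k → P s
  glue : ∀ i : Fin (k + 1) ↪ Fin n,
    P (Finset.univ.image fun j : Fin k => i j.castSucc) →
    P (Finset.univ.image fun j : Fin k => i j.succ) →
    P (Finset.univ.image i)

section Dynamics

variable {T : Type*} [LinearOrder T] {n : ℕ}

/-- The critical moments of a time-dependent property `Q` of sets of particles. -/
def criticalMoments (k : ℕ) (Q : T → Finset (Fin n) → Prop) : Set T :=
  {t | ∃ m : MultiIndex n k, Q t m.1}

/-- Pleasant: finitely many critical moments, with exactly one multiindex at each of them. -/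
def IsPleasant (k : ℕ) (Q : T → Finset (Fin n) → Prop) : Prop :=
  (criticalMoments k Q).Finite ∧ ∀ t ∈ criticalMoments k Q, ∃! m : MultiIndex n k, Q t m.1

/-- The type of a pleasant system: its multiindices, listed as the time increases. -/
noncomputable def typeOf {k : ℕ} {Q : T → Finset (Fin n) → Prop} (h : IsPleasant k Q) :
    List (MultiIndex n k) :=
  h.1.toFinset.sort.attach.map fun t =>
    (h.2 t.1 (h.1.mem_toFinset.mp ((Finset.mem_sort (· ≤ ·)).mp t.2))).choose

end Dynamics

/-! ## The group `G_n^k` of free `k`-braids -/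

/-- For a `(k+1)`-tuple `u` of distinct indices, the multiindex obtained by removing `u j`. -/
def facet {n k : ℕ} (u : Fin (k + 1) ↪ Fin n) (j : Fin (k + 1)) : MultiIndex n k :=
  ⟨(Finset.univ.erase j).map u, by simp⟩

/-- The word `a_{m^1} … a_{m^{k+1}}` of the `(k+1)`-tuple `u`, where `m^j` is `u` without `u j`. -/
def tetraWord {n k : ℕ} (u : Fin (k + 1) ↪ Fin n) : List (MultiIndex n k) :=
  List.ofFn (facet u)

/-- A word in the generators as an element of the free group. -/
def freeWord {n k : ℕ} (w : List (MultiIndex n k)) : FreeGroup (MultiIndex n k) :=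
  (w.map FreeGroup.of).prod

/-- The relators: tetrahedron relations, far commutativity (`|m ∩ m'| < k - 1`), involutivity. -/
inductive FreeBraidRelator (n k : ℕ) : FreeGroup (MultiIndex n k) → Prop
  | tetrahedron (u : Fin (k + 1) ↪ Fin n) :
      FreeBraidRelator n k (freeWord (tetraWord u) * (freeWord (tetraWord u).reverse)⁻¹)
  | far (m m' : MultiIndex n k) (h : (m.1 ∩ m'.1).card + 1 < k) :
      FreeBraidRelator n k (freeWord [m, m'] * (freeWord [m', m])⁻¹)
  | square (m : MultiIndex n k) : FreeBraidRelator n k (freeWord [m, m])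

/-- The group `G_n^k` of free `k`-braids on `n` strands. -/
abbrev FreeBraidGroup (n k : ℕ) : Type := PresentedGroup {r | FreeBraidRelator n k r}

/-- The free `k`-braid `a_{m^1} ⋯ a_{m^N}` represented by the word `[m^1, …, m^N]`. -/
def freeBraid {n k : ℕ} (w : List (MultiIndex n k)) : FreeBraidGroup n k :=
  (w.map PresentedGroup.of).prod

/-! ## Pictures -/

/-- A picture of a free `k`-braid: `n` strands, the `i`-th of which is the graph
`{(strand i t, t) : 0 ≤ t ≤ 1}` and joins the `i`-th point of the line at height `0` to the `i`-th
point of the line at height `1`; pairwise the strands meet finitely often.  At each solid dot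
exactly the `k` strands of its multiindex meet, transversally; the dots are listed with their
heights, from the bottom to the top.  All other crossings are artifacts and carry no data. -/
structure FreeBraidPicture (n k : ℕ) where
  strand : Fin n → ℝ → ℝ
  continuousOn : ∀ i, ContinuousOn (strand i) (Set.Icc 0 1)
  bottom : ∀ i, strand i 0 = (i : ℝ) + 1
  top : ∀ i, strand i 1 = (i : ℝ) + 1
  finite_crossings : ∀ i j, i ≠ j → {t ∈ Set.Icc (0 : ℝ) 1 | strand i t = strand j t}.Finite
  dots : List (ℝ × MultiIndex n k)
  sorted : dots.Pairwise fun d d' => d.1 < d'.1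
  height_mem : ∀ d ∈ dots, d.1 ∈ Set.Ioo (0 : ℝ) 1
  meet : ∀ d ∈ dots, ∀ i ∈ d.2.1, ∀ j ∈ d.2.1, strand i d.1 = strand j d.1
  only : ∀ d ∈ dots, ∀ i ∈ d.2.1, ∀ l ∉ d.2.1, strand l d.1 ≠ strand i d.1
  differentiable : ∀ d ∈ dots, ∀ i ∈ d.2.1, DifferentiableAt ℝ (strand i) d.1
  transversal : ∀ d ∈ dots, ∀ i ∈ d.2.1, ∀ j ∈ d.2.1, i ≠ j →
    deriv (strand i) d.1 ≠ deriv (strand j) d.1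

namespace FreeBraidPicture

/-- The multiindices of the solid dots, read from the bottom to the top. -/
def word {n k : ℕ} (p : FreeBraidPicture n k) : List (MultiIndex n k) := p.dots.map Prod.snd

end FreeBraidPicture

/-- The local moves on sequences of solid dots: cancelling a bigon, interchanging two far dots,
and the tetrahedron move. -/
inductive DotMove (n k : ℕ) : List (MultiIndex n k) → List (MultiIndex n k) → Prop
  | bigon (v w : List (MultiIndex n k)) (m : MultiIndex n k) :
      DotMove n k (v ++ [m, m] ++ w) (v ++ w)
  | far (v w : List (MultiIndex n k)) (m m' : MultiIndex n k) (h : (m.1 ∩ m'.1).card + 1 < k) :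
      DotMove n k (v ++ [m, m'] ++ w) (v ++ [m', m] ++ w)
  | tetrahedron (v w : List (MultiIndex n k)) (u : Fin (k + 1) ↪ Fin n) :
      DotMove n k (v ++ tetraWord u ++ w) (v ++ (tetraWord u).reverse ++ w)

/-- Equivalence of pictures: generated by changes of the planar drawing that keep the sequence of
solid dots, and by the local moves. -/
def PictureEquiv {n k : ℕ} : FreeBraidPicture n k → FreeBraidPicture n k → Prop :=
  Relation.EqvGen fun p q => p.word = q.word ∨ DotMove n k p.word q.word

/-- Pictures of free `k`-braids up to equivalence. -/
def PictureClass (n k : ℕ) : Type := Quot (@PictureEquiv n k)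

/-! ## Points moving in the plane -/

/-- The Euclidean plane. -/
abbrev Plane : Type := EuclideanSpace ℝ (Fin 2)

/-- The property "the particles with indices in `s` lie on one line". -/
def CollinearOn {n : ℕ} (z : Fin n → Plane) (s : Finset (Fin n)) : Prop :=
  Collinear ℝ (z '' (s : Set (Fin n)))

/-- No three of the points are collinear. -/
def NoThreeCollinear {n : ℕ} (z : Fin n → Plane) : Prop :=
  ∀ m : MultiIndex n 3, ¬ CollinearOn z m.1

/-- Twice the signed area of the triangle `abc`. -/
def signedArea (a b c : Plane) : ℝ :=
  (b 0 - a 0) * (c 1 - a 1) - (b 1 - a 1) * (c 0 - a 0)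

section Motion

variable {T : Type*} [LinearOrder T] {n : ℕ}

/-- The time-dependent collinearity property of a motion of `n` points in the plane. -/
def trisecant (D : T → Fin n → Plane) : T → Finset (Fin n) → Prop := fun t => CollinearOn (D t)

/-- Stability: whenever three points become collinear, their orientation (the sign of the
area of the triangle that they span) changes at this moment. -/
def IsStable [TopologicalSpace T] (D : T → Fin n → Plane) : Prop :=
  ∀ t : T, ∀ m : MultiIndex n 3, trisecant D t m.1 → ∀ i j l : Fin n, m.1 = {i, j, l} →
    ((∀ᶠ s in 𝓝[<] t, signedArea (D s i) (D s j) (D s l) < 0) ∧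
      (∀ᶠ s in 𝓝[>] t, 0 < signedArea (D s i) (D s j) (D s l))) ∨
    ((∀ᶠ s in 𝓝[<] t, 0 < signedArea (D s i) (D s j) (D s l)) ∧
      (∀ᶠ s in 𝓝[>] t, signedArea (D s i) (D s j) (D s l) < 0))

end Motion

/-- The configuration space of `n` pairwise distinct numbered points in the plane. -/
abbrev Config (n : ℕ) : Type := {z : Fin n → Plane // Function.Injective z}

/-- The motion of points in the plane given by a path in the configuration space. -/
def motion {n : ℕ} {x y : Config n} (γ : Path x y) : unitInterval → Fin n → Plane :=
  fun t => (γ t).1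

/-- The classical pure braid group on `n` strands with initial configuration `x`; the product of
braids is the concatenation (Mathlib's fundamental group has the opposite multiplication). -/
abbrev PureBraidGroup (n : ℕ) (x : Config n) : Type := (FundamentalGroup (Config n) x)ᵐᵒᵖ

/-- The pure braid given by a closed motion of the configuration `x`. -/
def pureBraid {n : ℕ} {x : Config n} (γ : Path x x) : PureBraidGroup n x :=
  MulOpposite.op (FundamentalGroup.fromPath (Path.Homotopic.Quotient.mk γ))

/-! ## Weavings -/

/-- Euclidean 3-space; the planes on which the coordinate `2` is constant are horizontal. -/
abbrev Space : Type := EuclideanSpace ℝ (Fin 3)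

/-- A weaving: a numbered collection of `n` pairwise skew lines in 3-space. -/
structure Weaving (n : ℕ) where
  line : Fin n → AffineSubspace ℝ Space
  nonempty : ∀ i, (line i : Set Space).Nonempty
  finrank_direction : ∀ i, Module.finrank ℝ (line i).direction = 1
  skew : ∀ i j, i ≠ j →
    Disjoint (line i : Set Space) (line j : Set Space) ∧ ¬ (line i).Parallel (line j)

namespace Weaving

variable {n : ℕ}

/-- No line of the weaving is horizontal, i.e. each line is transverse to all horizontal planes. -/
def IsUpright (W : Weaving n) : Prop := ∀ i, ∃ d ∈ (W.line i).direction, d 2 ≠ 0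

/-- No three lines of the weaving are parallel to a common plane. -/
def NoThreeCoplanarDirections (W : Weaving n) : Prop :=
  ∀ i j l : Fin n, i ≠ j → i ≠ l → j ≠ l →
    (W.line i).direction ⊔ (W.line j).direction ⊔ (W.line l).direction = ⊤

/-- `W` and `W'` are joined by a continuous family of weavings with the property `A`. -/
def IsotopicThrough (A : Weaving n → Prop) (W W' : Weaving n) : Prop :=
  ∃ F : unitInterval → Weaving n, F 0 = W ∧ F 1 = W' ∧ (∀ s, A (F s)) ∧
    ∃ b d : unitInterval → Fin n → Space, Continuous b ∧ Continuous d ∧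
      ∀ s i, (F s).line i = AffineSubspace.mk' (b s i) (Submodule.span ℝ {d s i})

/-- `D` is the motion in the plane that the weaving sweeps out on the horizontal planes: at the
time `t`, the `i`-th point is the intersection of the `i`-th line with the plane of height `t`. -/
def IsHorizontalMotion (W : Weaving n) (D : ℝ → Fin n → Plane) : Prop :=
  ∀ t i, !₂[D t i 0, D t i 1, t] ∈ W.line i

end Weaving

/-!
The invariant of pure braids is constructed as the holonomy of a covering of the configuration
space `Config n` with fibre `G_n^3`; no general position of homotopies is used.

*Sweeping.* In a chart with abscissas `X i = z i 0 + c * z i 1` that are pairwise distinct, a triple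
is collinear exactly when the divided difference of the ordinates over it vanishes. Adding `s X²` to
the ordinates raises the divided differences of all triples by `s`, so that the triples of negative
divided difference become collinear one after the other, in the order of decreasing divided
differences; the corresponding word is the `sweepBraid` of the configuration. By the recursion for
divided differences, two triples with a common pair have the same divided difference only if the
third divided difference of their union vanishes, and if it changes its sign, the order of the four
triples of the quadruple is reversed, which is the tetrahedron relation. At other ties the triples
commute. Hence a sweep word is locally constant as an element of `G_n^3` where at most one quadruple
is degenerate (`exists_eventually_freeBraid_sweepWord_eq_of_unique`). Adding a multiple of `X³`
raises all third divided differences by the same amount, and this reduces the general case to the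
former (`exists_eventually_freeBraid_sweepWord_eq`). When a single triple becomes collinear and
changes its orientation, it enters or leaves the sweep word as its first letter
(`exists_eventually_sweepBraid_eq_of_unique`).

*The covering.* Consequently the quotient of the sweep braids of two charts does not change when a
wall is crossed at a point with one collinear triple, and since such crossings suffice to join
neighbouring configurations in general position, the quotient is locally constant. These quotients
are the transition functions of the covering `braidBundle`. The product of the sweep braid and of
the fibre coordinate does not depend on the chart, and along a lift of a pleasant stable motion it is
multiplied by the generators of the successive collinear triples
(`braidCoord_eq_freeBraid_mul`). Since lifts depend only on homotopy classes, so does the free braid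
of a pleasant stable motion (`holonomy_mk`), and concatenation becomes multiplication
(`holonomy_trans`).

*General position.* A polynomial motion `D` whose ends are in general position becomes pleasant and
stable when `t (1 - t) w` is added to it for a small generic displacement `w`
(`exists_isTransverse_perturb`), and every motion is close to a polynomial one.

*Pictures.* Words modulo the local moves form a group that satisfies the relations of `G_n^3`, so two
words represent the same element exactly when they are related by local moves. The strands of a
picture with a given word are obtained by Hermite interpolation.

*Weavings.* An upright weaving is given by the positions `p` and the velocities `v` of its horizontal
motion `p + t v`. Up to a change of time and a rescaling of the plane at each moment this is the
path `u (1 - u) p + (2 u - 1) v`, `0 ≤ u ≤ 1`, from `-v` to `v`, whose ends are in general position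
exactly when the directions are generic. An isotopy sweeps out a square of configurations, so the
holonomies at its two ends differ by those of the paths of `-v` and of `v`. These two are equal,
since the point reflection of the plane preserves orientations, which gives a conjugate element
(`conjClasses_mk_weavingHolonomy_eq`); if the directions remain generic, both are trivial
(`weavingHolonomy_eq_of_path`).
-/


/-! ### Words and the group of free braids -/

/-- Two arrangements of the same letters in which every pair of letters that is arranged
differently commutes have the same product. -/
theorem List.Perm.prod_map_eq_of_pairwise_commute {M G : Type*} [Monoid G] (a : M → G)
    {R R' : M → M → Prop} {L L' : List M} (hp : L.Perm L') (hR : L.Pairwise R)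
    (hR' : L'.Pairwise R')
    (hc : ∀ x ∈ L, ∀ y ∈ L, R x y → R' y x → Commute (a x) (a y)) :
    (L.map a).prod = (L'.map a).prod := by
  induction L generalizing L' with
  | nil => rw [List.nil_perm.mp hp]
  | cons x T ih =>
    obtain ⟨A, B, rfl⟩ := List.append_of_mem (hp.subset List.mem_cons_self)
    have hT : T.Perm (A ++ B) :=
      (List.perm_cons x).mp (hp.trans List.perm_middle)
    rw [List.pairwise_cons] at hR
    have hAB : (A ++ B).Pairwise R' :=
      hR'.sublist ((List.Sublist.refl A).append (List.sublist_cons_self x B))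
    have hxA : Commute (a x) (A.map a).prod := by
      refine Commute.list_prod_right _ _ ?_
      intro g hg
      obtain ⟨y, hy, rfl⟩ := List.mem_map.mp hg
      have hyT : y ∈ T := hT.symm.subset (List.mem_append_left B hy)
      exact hc x List.mem_cons_self y (List.mem_cons_of_mem x hyT) (hR.1 y hyT)
        ((List.pairwise_append.mp hR').2.2 y hy x List.mem_cons_self)
    have := ih hT hR.2 hAB fun y hy z hz =>
      hc y (List.mem_cons_of_mem x hy) z (List.mem_cons_of_mem x hz)
    simp only [List.map_cons, List.prod_cons, List.map_append, List.prod_append] at this ⊢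
    rw [this, ← mul_assoc, ← mul_assoc, hxA.eq]

section FreeBraid

variable {n k : ℕ}

theorem freeBraid_append (v w : List (MultiIndex n k)) :
    freeBraid (v ++ w) = freeBraid v * freeBraid w := by
  simp [freeBraid]

theorem freeBraid_cons (m : MultiIndex n k) (w : List (MultiIndex n k)) :
    freeBraid (m :: w) = freeBraid [m] * freeBraid w := by
  simp [freeBraid]

theorem freeBraid_eq_mk (w : List (MultiIndex n k)) :
    freeBraid w = PresentedGroup.mk {r | FreeBraidRelator n k r} (freeWord w) := by
  simp only [freeBraid, freeWord, map_list_prod, List.map_map]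
  rfl

theorem freeBraid_mul_self (m : MultiIndex n k) : freeBraid [m] * freeBraid [m] = 1 := by
  rw [← freeBraid_append, freeBraid_eq_mk]
  exact PresentedGroup.one_of_mem (FreeBraidRelator.square m)

theorem freeBraid_commute {m m' : MultiIndex n k} (h : (m.1 ∩ m'.1).card + 1 < k) :
    Commute (freeBraid [m]) (freeBraid [m']) := by
  have := PresentedGroup.one_of_mem (rels := {r | FreeBraidRelator n k r})
    (FreeBraidRelator.far m m' h)
  rw [map_mul, map_inv, mul_inv_eq_one, ← freeBraid_eq_mk, ← freeBraid_eq_mk] at this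
  rw [Commute, SemiconjBy, ← freeBraid_append, ← freeBraid_append]
  exact this

theorem freeBraid_tetraWord_reverse (u : Fin (k + 1) ↪ Fin n) :
    freeBraid (tetraWord u).reverse = freeBraid (tetraWord u) := by
  have := PresentedGroup.one_of_mem (rels := {r | FreeBraidRelator n k r})
    (FreeBraidRelator.tetrahedron u)
  rw [map_mul, map_inv, mul_inv_eq_one, ← freeBraid_eq_mk, ← freeBraid_eq_mk] at this
  exact this.symm

theorem freeBraid_eq_prod_map (w : List (MultiIndex n k)) :
    freeBraid w = (w.map fun m => freeBraid [m]).prod := by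
  simp [freeBraid]

theorem freeBraid_reverse (w : List (MultiIndex n k)) :
    freeBraid w.reverse = (freeBraid w)⁻¹ := by
  induction w with
  | nil => simp [freeBraid]
  | cons m w ih =>
    rw [List.reverse_cons, freeBraid_append, ih, freeBraid_cons m w, mul_inv_rev,
      inv_eq_of_mul_eq_one_left (freeBraid_mul_self m)]

theorem freeBraid_surjective : Function.Surjective (freeBraid (n := n) (k := k)) := by
  intro g
  have hg : g ∈ (⊤ : Subgroup (FreeBraidGroup n k)) := trivial
  rw [← PresentedGroup.closure_range_of] at hg
  induction hg using Subgroup.closure_induction with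
  | mem x hx =>
    obtain ⟨m, rfl⟩ := hx
    exact ⟨[m], by simp [freeBraid]⟩
  | one => exact ⟨[], rfl⟩
  | mul x y _ _ hx hy =>
    obtain ⟨v, rfl⟩ := hx
    obtain ⟨w, rfl⟩ := hy
    exact ⟨v ++ w, freeBraid_append v w⟩
  | inv x _ hx =>
    obtain ⟨v, rfl⟩ := hx
    exact ⟨v.reverse, freeBraid_reverse v⟩

end FreeBraid

/-! ### The type of a pleasant system -/

section TypeOf

variable {T : Type*} [LinearOrder T] {n k : ℕ} {Q : T → Finset (Fin n) → Prop}

theorem List.attach_map_eq_map_snd {α β : Type*} (L : List (α × β)) {l : List α}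
    (hl : l = L.map Prod.fst) (g : {x // x ∈ l} → β)
    (hg : ∀ e ∈ L, ∀ h : e.1 ∈ l, g ⟨e.1, h⟩ = e.2) : l.attach.map g = L.map Prod.snd := by
  subst hl
  refine List.ext_getElem (by simp) fun i h₁ h₂ => ?_
  simp only [List.getElem_map, List.getElem_attach]
  exact hg _ (List.getElem_mem _) _

/-- The type can be read off from any chronological list of the critical events. -/
theorem typeOf_eq (h : IsPleasant k Q) (L : List (T × MultiIndex n k))
    (hs : L.Pairwise fun e e' => e.1 < e'.1) (hL : ∀ t m, (t, m) ∈ L ↔ Q t m.1) :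
    typeOf h = L.map Prod.snd := by
  have hsort : h.1.toFinset.sort = L.map Prod.fst := by
    have hs' : (L.map Prod.fst).Pairwise (· < ·) := List.pairwise_map.mpr hs
    refine List.Perm.eq_of_pairwise' ?_ ?_ ((List.perm_ext_iff_of_nodup ?_ ?_).mpr ?_)
      (r := (· ≤ ·))
    · exact Finset.pairwise_sort _ _
    · exact hs'.imp le_of_lt
    · exact Finset.sort_nodup _ _
    · exact hs'.imp ne_of_lt
    · intro t
      simp [criticalMoments, hL]
  refine List.attach_map_eq_map_snd L hsort _ fun e he ht => ?_
  have hcrit : e.1 ∈ criticalMoments k Q := ⟨e.2, (hL e.1 e.2).mp he⟩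
  exact (h.2 e.1 hcrit).unique (h.2 e.1 hcrit).choose_spec.1 ((hL e.1 e.2).mp he)

theorem IsPleasant.exists_chronology (h : IsPleasant k Q) :
    ∃ L : List (T × MultiIndex n k), L.Pairwise (fun e e' => e.1 < e'.1) ∧
      (∀ t m, (t, m) ∈ L ↔ Q t m.1) ∧ typeOf h = L.map Prod.snd := by
  have hmem : ∀ t ∈ h.1.toFinset.sort, t ∈ criticalMoments k Q := fun t ht =>
    h.1.mem_toFinset.mp ((Finset.mem_sort (· ≤ ·)).mp ht)
  let L : List (T × MultiIndex n k) := h.1.toFinset.sort.attach.map fun t =>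
    (t.1, (h.2 t.1 (hmem t.1 t.2)).choose)
  have hfst : L.map Prod.fst = h.1.toFinset.sort := by
    simp only [L, List.map_map]
    exact List.attach_map_subtype_val _
  have hs : L.Pairwise fun e e' => e.1 < e'.1 := by
    have : (L.map Prod.fst).Pairwise (· < ·) := by
      rw [hfst]
      exact Finset.sortedLT_sort _ |>.pairwise
    exact List.pairwise_map.mp this
  have hL : ∀ t m, (t, m) ∈ L ↔ Q t m.1 := by
    intro t m
    simp only [L, List.mem_map, List.mem_attach, true_and, Subtype.exists, Prod.mk.injEq]
    constructor
    · rintro ⟨t', ht', rfl, rfl⟩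
      exact (h.2 t' (hmem t' ht')).choose_spec.1
    · intro hq
      have hc : t ∈ criticalMoments k Q := ⟨m, hq⟩
      exact ⟨t, (Finset.mem_sort _).mpr (h.1.mem_toFinset.mpr hc), rfl,
        (h.2 t hc).unique (h.2 t hc).choose_spec.1 hq⟩
  exact ⟨L, hs, hL, typeOf_eq h L hs hL⟩

/-- The type is unchanged by an increasing change of time that reaches every critical moment. -/
theorem typeOf_eq_of_strictMono {T' : Type*} [LinearOrder T'] {Q' : T' → Finset (Fin n) → Prop}
    (h : IsPleasant k Q) (h' : IsPleasant k Q') {φ : T → T'} (hφ : StrictMono φ)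
    (hQ : ∀ t (m : MultiIndex n k), Q' (φ t) m.1 ↔ Q t m.1)
    (hrange : ∀ t' (m : MultiIndex n k), Q' t' m.1 → t' ∈ Set.range φ) :
    typeOf h = typeOf h' := by
  obtain ⟨L, hs, hL, ht⟩ := h.exists_chronology
  rw [ht, typeOf_eq h' (L.map fun e => (φ e.1, e.2)) ?_ ?_, List.map_map]
  · rfl
  · rw [List.pairwise_map]
    exact hs.imp fun hlt => hφ hlt
  · intro t' m
    simp only [List.mem_map, Prod.mk.injEq, Prod.exists]
    constructor
    · rintro ⟨t, m', he, rfl, rfl⟩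
      exact (hQ t m').mpr ((hL t m').mp he)
    · intro hq
      obtain ⟨t, rfl⟩ := hrange t' m hq
      exact ⟨t, m, (hL t m).mpr ((hQ t m).mp hq), rfl, rfl⟩

end TypeOf

/-! ### Functions that are locally constant off a nowhere dense set -/

/-- A function that, near each point of a preconnected set, is constant on a fixed dense set, has
the same local value at all points of the preconnected set. -/
theorem IsPreconnected.exists_eventually_eq {X G : Type*} [TopologicalSpace X] {V S : Set X}
    (hS : IsPreconnected S) (hV : ∀ r ∈ S, (𝓝[V] r).NeBot) {f : X → G} (hne : S.Nonempty)
    (hf : ∀ r ∈ S, ∃ g, ∀ᶠ p in 𝓝[V] r, f p = g) :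
    ∃ g, ∀ r ∈ S, ∀ᶠ p in 𝓝[V] r, f p = g := by
  classical
  obtain ⟨r₀, hr₀⟩ := hne
  have : Nonempty G := ⟨(hf r₀ hr₀).choose⟩
  choose! u hu using hf
  let : TopologicalSpace G := ⊥
  have : DiscreteTopology G := ⟨rfl⟩
  have hcont : ContinuousOn u S := by
    intro r hr
    refine ContinuousWithinAt.congr_of_eventuallyEq
      continuousWithinAt_const ?_ rfl
    obtain ⟨U, hU, hrU, hUV⟩ := mem_nhdsWithin.mp (hu r hr)
    filter_upwards [inter_mem_nhdsWithin S (hU.mem_nhds hrU)] with r' hr'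
    have := hV r' hr'.1
    have h1 : ∀ᶠ p in 𝓝[V] r', f p = u r :=
      mem_nhdsWithin.mpr ⟨U, hU, hr'.2, hUV⟩
    obtain ⟨p, hp1, hp2⟩ := (h1.and (hu r' hr'.1)).exists
    exact hp2.symm.trans hp1
  refine ⟨u r₀, fun r hr => ?_⟩
  rw [← hS.constant hcont hr hr₀]
  exact hu r hr

section Jump

variable {T : Type*} [LinearOrder T] {n k : ℕ}

theorem filter_le_eq_filter_lt_append {L : List (T × MultiIndex n k)}
    (hs : L.Pairwise fun e e' => e.1 < e'.1) {t : T} {m : MultiIndex n k} (h : (t, m) ∈ L) :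
    L.filter (fun e => e.1 ≤ t) = L.filter (fun e => e.1 < t) ++ [(t, m)] := by
  obtain ⟨A, B, rfl⟩ := List.append_of_mem h
  rw [List.pairwise_append, List.pairwise_cons] at hs
  have hA : ∀ e ∈ A, e.1 < t := fun e he => hs.2.2 e he _ List.mem_cons_self
  have hB : ∀ e ∈ B, t < e.1 := fun e he => hs.2.1.1 e he
  have hA1 : A.filter (fun e => e.1 ≤ t) = A :=
    List.filter_eq_self.mpr fun e he => by simpa using (hA e he).le
  have hA2 : A.filter (fun e => e.1 < t) = A :=
    List.filter_eq_self.mpr fun e he => by simpa using hA e he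
  have hB1 : B.filter (fun e => e.1 ≤ t) = [] :=
    List.filter_eq_nil_iff.mpr fun e he => by simpa using hB e he
  have hB2 : B.filter (fun e => e.1 < t) = [] :=
    List.filter_eq_nil_iff.mpr fun e he => by simpa using (hB e he).le
  simp [List.filter_append, hA1, hA2, hB1, hB2]

/-- A function of the time that is locally constant except that it is multiplied by a generator
at each critical event is multiplied, in total, by the word of the events. -/
theorem eq_freeBraid_mul_of_jumps [TopologicalSpace T] [OrderTopology T] [PreconnectedSpace T]
    {L : List (T × MultiIndex n k)} (hs : L.Pairwise fun e e' => e.1 < e'.1)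
    (hdense : ∀ t : T, (𝓝[{t | ∀ m, (t, m) ∉ L}] t).NeBot)
    {f : T → FreeBraidGroup n k}
    (hreg : ∀ t, (∀ m, (t, m) ∉ L) → ∀ᶠ s in 𝓝 t, f s = f t)
    (hjump : ∀ t m, (t, m) ∈ L → ∃ g, (∀ᶠ s in 𝓝[<] t, f s = g) ∧
      ∀ᶠ s in 𝓝[>] t, f s = freeBraid [m] * g)
    {a b : T} (ha : ∀ e ∈ L, a < e.1) (hb : ∀ e ∈ L, e.1 < b) :
    f a = freeBraid (L.map Prod.snd) * f b := by
  classical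
  set F : T → FreeBraidGroup n k := fun t =>
    freeBraid ((L.filter fun e => e.1 < t).map Prod.snd) * f t with hF
  -- the partial words to the left and to the right of a moment
  have hlt : ∀ t, ∀ᶠ s in 𝓝[<] t,
      L.filter (fun e => e.1 < s) = L.filter (fun e => e.1 < t) := by
    intro t
    have : ∀ e ∈ L.toFinset, ∀ᶠ s in 𝓝[<] t, (e.1 < s ↔ e.1 < t) := by
      intro e _
      rcases lt_or_ge e.1 t with h | h
      · filter_upwards [mem_nhdsWithin_of_mem_nhds (lt_mem_nhds h)] with s hs
        exact ⟨fun _ => h, fun _ => hs⟩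
      · filter_upwards [self_mem_nhdsWithin] with s hs
        exact ⟨fun h' => absurd (h'.trans hs) h.not_gt, fun h' => absurd h' h.not_gt⟩
    filter_upwards [(Filter.eventually_all_finset _).mpr this] with s hs
    exact List.filter_congr fun e he => by simpa using hs e (List.mem_toFinset.mpr he)
  have hgt : ∀ t, ∀ᶠ s in 𝓝[>] t,
      L.filter (fun e => e.1 < s) = L.filter (fun e => e.1 ≤ t) := by
    intro t
    have : ∀ e ∈ L.toFinset, ∀ᶠ s in 𝓝[>] t, (e.1 < s ↔ e.1 ≤ t) := by
      intro e _
      rcases le_or_gt e.1 t with h | h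
      · filter_upwards [self_mem_nhdsWithin] with s hs
        exact ⟨fun _ => h, fun _ => lt_of_le_of_lt h hs⟩
      · filter_upwards [mem_nhdsWithin_of_mem_nhds (gt_mem_nhds h)] with s hs
        exact ⟨fun h' => absurd (h'.trans hs) (lt_irrefl _), fun h' => absurd h' h.not_ge⟩
    filter_upwards [(Filter.eventually_all_finset _).mpr this] with s hs
    exact List.filter_congr fun e he => by simpa using hs e (List.mem_toFinset.mpr he)
  have hFL : ∀ t, ∃ g, ∀ᶠ s in 𝓝[{t | ∀ m, (t, m) ∉ L}] t, F s = g := by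
    intro t
    by_cases ht : ∃ m, (t, m) ∈ L
    · obtain ⟨m, hm⟩ := ht
      obtain ⟨g, hg1, hg2⟩ := hjump t m hm
      refine ⟨freeBraid ((L.filter fun e => e.1 < t).map Prod.snd) * g, ?_⟩
      have hle : ∀ᶠ s in 𝓝[<] t, F s = freeBraid ((L.filter fun e => e.1 < t).map Prod.snd) * g :=
          by
        filter_upwards [hlt t, hg1] with s h1 h2
        simp only [hF]
        rw [h1, h2]
      have hge : ∀ᶠ s in 𝓝[>] t, F s = freeBraid ((L.filter fun e => e.1 < t).map Prod.snd) * g :=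
          by
        filter_upwards [hgt t, hg2] with s h1 h2
        simp only [hF]
        rw [h1, h2, filter_le_eq_filter_lt_append hs hm, List.map_append, freeBraid_append,
          mul_assoc, ← mul_assoc (freeBraid _) (freeBraid [m])]
        simp [freeBraid_mul_self]
      have hne : ∀ᶠ s in 𝓝[≠] t, F s = freeBraid ((L.filter fun e => e.1 < t).map Prod.snd) * g :=
          by
        rw [← Set.Iio_union_Ioi, nhdsWithin_union]
        exact Filter.eventually_sup.mpr ⟨hle, hge⟩
      refine hne.filter_mono (nhdsWithin_mono t ?_)
      rintro s hs rfl
      exact hs m hm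
    · push Not at ht
      refine ⟨freeBraid ((L.filter fun e => e.1 < t).map Prod.snd) * f t, ?_⟩
      have hle : L.filter (fun e => e.1 ≤ t) = L.filter (fun e => e.1 < t) := by
        refine List.filter_congr fun e he => ?_
        have : e.1 ≠ t := fun h => ht e.2 (h ▸ he)
        simp [lt_iff_le_and_ne, this]
      have h1 : ∀ᶠ s in 𝓝 t, L.filter (fun e => e.1 < s) = L.filter (fun e => e.1 < t) := by
        rw [← nhdsLT_sup_nhdsGE, ← Set.Ioi_insert, nhdsWithin_insert]
        refine Filter.eventually_sup.mpr ⟨hlt t, Filter.eventually_sup.mpr ⟨?_, ?_⟩⟩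
        · exact Filter.eventually_pure.mpr rfl
        · exact (hgt t).mono fun s h => h.trans hle
      refine Filter.Eventually.filter_mono nhdsWithin_le_nhds ?_
      filter_upwards [h1, hreg t ht] with s h2 h3
      simp only [hF]
      rw [h2, h3]
  obtain ⟨g, hg⟩ := isPreconnected_univ.exists_eventually_eq (fun t _ => hdense t) ⟨a, trivial⟩
    (fun t _ => hFL t)
  have hval : ∀ t, (∀ m, (t, m) ∉ L) → F t = g := fun t ht =>
    (hg t trivial).self_of_nhdsWithin ht
  have hA : F a = f a := by
    simp only [hF]
    rw [List.filter_eq_nil_iff.mpr (by intro e he; simpa using (ha e he).le)]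
    simp [freeBraid]
  have hB : F b = freeBraid (L.map Prod.snd) * f b := by
    simp only [hF]
    rw [List.filter_eq_self.mpr (by intro e he; simpa using hb e he)]
  rw [← hA, ← hB, hval a fun m hm => lt_irrefl _ (ha _ hm),
    hval b fun m hm => lt_irrefl _ (hb _ hm)]

end Jump

/-! ### Generic perturbations along a line -/

theorem Polynomial.eventually_eval_ne_zero {P : Polynomial ℝ} (hP : P ≠ 0) (a : ℝ) :
    ∀ᶠ e in 𝓝[≠] a, P.eval e ≠ 0 := by
  have hfin : ({e | P.IsRoot e} \ {a}).Finite := (P.finite_setOfPred_isRoot hP).subset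
      Set.sdiff_subset
  have : ({e | P.IsRoot e} \ {a})ᶜ ∈ 𝓝 a := hfin.isClosed.isOpen_compl.mem_nhds (by simp)
  filter_upwards [mem_nhdsWithin_of_mem_nhds this, self_mem_nhdsWithin] with e he hne h0
  exact he ⟨h0, hne⟩

theorem eventually_add_mul_ne_zero (a : ℝ) {b : ℝ} (hb : b ≠ 0) :
    ∀ᶠ e in 𝓝[≠] (0 : ℝ), a + e * b ≠ 0 := by
  have hP : (Polynomial.C a + Polynomial.X * Polynomial.C b : Polynomial ℝ) ≠ 0 := by
    intro h
    have := congrArg (fun P : Polynomial ℝ => P.coeff 1) h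
    simp [hb, Polynomial.coeff_C] at this
  filter_upwards [Polynomial.eventually_eval_ne_zero hP 0] with e he
  simpa [mul_comm e] using he

theorem mem_closure_of_eventually_add_smul {E : Type*} [AddCommGroup E] [Module ℝ E]
    [TopologicalSpace E] [ContinuousAdd E] [ContinuousSMul ℝ E] {A : Set E} {z : E} (v : E)
    (h : ∀ᶠ e in 𝓝[≠] (0 : ℝ), z + e • v ∈ A) : z ∈ closure A := by
  refine mem_closure_of_tendsto (f := fun e : ℝ => z + e • v) (b := 𝓝[≠] 0) ?_ h
  have : ContinuousAt (fun e : ℝ => z + e • v) 0 := by fun_prop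
  have h2 := this.tendsto
  simp only [zero_smul, add_zero] at h2
  exact h2.mono_left nhdsWithin_le_nhds

/-! ### Divided differences -/

section DividedDifference

variable {n : ℕ}

/-- The divided difference, over the nodes `x i` with `i ∈ S`, of the function with the values
`y i` there. -/
noncomputable def dividedDifference (x y : Fin n → ℝ) (S : Finset (Fin n)) : ℝ :=
  ∑ i ∈ S, y i / ∏ j ∈ S.erase i, (x i - x j)

theorem dividedDifference_empty (x y : Fin n → ℝ) : dividedDifference x y ∅ = 0 := by
  simp [dividedDifference]

theorem dividedDifference_add_smul (x y y' : Fin n → ℝ) (e : ℝ) (S : Finset (Fin n)) :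
    dividedDifference x (y + e • y') S =
      dividedDifference x y S + e * dividedDifference x y' S := by
  simp only [dividedDifference, Finset.mul_sum, ← Finset.sum_add_distrib]
  refine Finset.sum_congr rfl fun i _ => ?_
  simp only [Pi.add_apply, Pi.smul_apply, smul_eq_mul]
  ring

theorem dividedDifference_erase_eq_sum {x y : Fin n → ℝ} {S : Finset (Fin n)}
    (hx : Function.Injective x) {a : Fin n} (ha : a ∈ S) :
    dividedDifference x y (S.erase a) =
      ∑ i ∈ S, y i * (x i - x a) / ∏ j ∈ S.erase i, (x i - x j) := by
  rw [← Finset.sum_erase (a := a) S (by simp)]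
  refine Finset.sum_congr rfl fun i hi => ?_
  obtain ⟨hia, hiS⟩ := Finset.mem_erase.mp hi
  rw [← Finset.mul_prod_erase (S.erase i) (fun j => x i - x j)
    (Finset.mem_erase.mpr ⟨hia.symm, ha⟩), Finset.erase_right_comm]
  have : x i - x a ≠ 0 := sub_ne_zero.mpr fun h => hia (hx h)
  rw [mul_comm (y i), mul_div_mul_left _ _ this]

/-- The recursion for divided differences. -/
theorem dividedDifference_erase_sub_erase {x y : Fin n → ℝ} {S : Finset (Fin n)}
    (hx : Function.Injective x) {a b : Fin n} (ha : a ∈ S) (hb : b ∈ S) :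
    dividedDifference x y (S.erase a) - dividedDifference x y (S.erase b) =
      (x b - x a) * dividedDifference x y S := by
  rw [dividedDifference_erase_eq_sum hx ha, dividedDifference_erase_eq_sum hx hb,
    ← Finset.sum_sub_distrib, dividedDifference, Finset.mul_sum]
  refine Finset.sum_congr rfl fun i _ => ?_
  ring

theorem dividedDifference_cube {x : Fin n → ℝ} (hx : Function.Injective x)
    {S : Finset (Fin n)} (hS : S.card = 4) :
    dividedDifference x (fun i => x i ^ 3) S = 1 := by
  have := Lagrange.leadingCoeff_eq_sum (s := S) (v := x) hx.injOn
    (P := (Polynomial.X ^ 3 : Polynomial ℝ)) (by rw [hS, Polynomial.degree_X_pow]; norm_num)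
  simpa [dividedDifference] using this.symm

theorem dividedDifference_single_of_notMem {x : Fin n → ℝ} {i : Fin n} {S : Finset (Fin n)}
    (hi : i ∉ S) : dividedDifference x (Pi.single i 1) S = 0 := by
  refine Finset.sum_eq_zero fun j hj => ?_
  rw [Pi.single_eq_of_ne (by rintro rfl; exact hi hj), zero_div]

theorem dividedDifference_single_of_mem {x : Fin n → ℝ} (hx : Function.Injective x) {i : Fin n}
    {S : Finset (Fin n)} (hi : i ∈ S) : dividedDifference x (Pi.single i 1) S ≠ 0 := by
  rw [dividedDifference, Finset.sum_eq_single i]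
  · rw [Pi.single_eq_same]
    refine one_div_ne_zero (Finset.prod_ne_zero_iff.mpr fun j hj => sub_ne_zero.mpr fun h => ?_)
    exact (Finset.mem_erase.mp hj).1 (hx h).symm
  · intro j _ hj
    rw [Pi.single_eq_of_ne hj, zero_div]
  · exact fun h => absurd hi h

end DividedDifference

/-! ### Affine charts of the configuration space -/

section Chart

variable {n : ℕ}

/-- The abscissas of the points in the coordinate system that is sheared by `c`. -/
def chartX (c : ℝ) (z : Fin n → Plane) : Fin n → ℝ := fun i => z i 0 + c * z i 1

/-- The ordinates of the points, which no shear changes. -/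
def chartY (z : Fin n → Plane) : Fin n → ℝ := fun i => z i 1

/-- The divided differences of the ordinates with respect to the sheared abscissas. -/
noncomputable def chartDiff (c : ℝ) (z : Fin n → Plane) (S : Finset (Fin n)) : ℝ :=
  dividedDifference (chartX c z) (chartY z) S

/-- The configurations in very general position for the chart `c`: the abscissas are distinct, and
so are all divided differences (the empty one being `0`). -/
def chartGeneric (c : ℝ) : Set (Fin n → Plane) :=
  {z | Function.Injective (chartX c z) ∧ Function.Injective (chartDiff c z)}

/-- The displacement of points that leaves the sheared abscissas fixed and changes the
ordinates by `y`. -/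
def vertical (c : ℝ) (y : Fin n → ℝ) : Fin n → Plane := fun i => !₂[-c * y i, y i]

theorem chartX_add_smul_vertical (c : ℝ) (z : Fin n → Plane) (y : Fin n → ℝ) (e : ℝ) :
    chartX c (z + e • vertical c y) = chartX c z := by
  ext i
  simp [chartX, vertical]
  ring

theorem chartDiff_add_smul_vertical (c : ℝ) (z : Fin n → Plane) (y : Fin n → ℝ) (e : ℝ)
    (S : Finset (Fin n)) :
    chartDiff c (z + e • vertical c y) S =
      chartDiff c z S + e * dividedDifference (chartX c z) y S := by
  rw [chartDiff, chartX_add_smul_vertical, chartDiff, ← dividedDifference_add_smul]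
  congr 1

theorem continuous_chartX (c : ℝ) (i : Fin n) :
    Continuous fun z : Fin n → Plane => chartX c z i := by
  unfold chartX
  fun_prop

theorem continuous_chartY (i : Fin n) : Continuous fun z : Fin n → Plane => chartY z i := by
  unfold chartY
  fun_prop

theorem continuousAt_chartDiff {c : ℝ} {z : Fin n → Plane}
    (hz : Function.Injective (chartX c z)) (S : Finset (Fin n)) :
    ContinuousAt (fun z => chartDiff c z S) z := by
  unfold chartDiff dividedDifference
  refine tendsto_finsetSum _ fun i _ => ?_
  refine ContinuousAt.div₀ ?_ ?_ ?_
  · exact (continuous_chartY i).continuousAt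
  · refine tendsto_finsetProd _ fun j _ => ?_
    exact ((continuous_chartX c i).sub (continuous_chartX c j)).continuousAt
  · refine Finset.prod_ne_zero_iff.mpr fun j hj => sub_ne_zero.mpr fun h => ?_
    exact (Finset.mem_erase.mp hj).1 (hz h).symm

theorem isOpen_injective_chartX (c : ℝ) :
    IsOpen {z : Fin n → Plane | Function.Injective (chartX c z)} := by
  have : {z : Fin n → Plane | Function.Injective (chartX c z)} =
      ⋂ p : {p : Fin n × Fin n // p.1 ≠ p.2}, {z | chartX c z p.1.1 ≠ chartX c z p.1.2} := by
    ext z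
    simp only [Set.mem_ofPred_eq, Set.mem_iInter, Subtype.forall, Prod.forall]
    exact ⟨fun h i j hij he => hij (h he), fun h i j he => by_contra fun hij => h i j hij he⟩
  rw [this]
  exact isOpen_iInter_of_finite fun p =>
    isOpen_ne_fun (continuous_chartX c _) (continuous_chartX c _)

theorem dense_injective_chartX (c : ℝ) :
    Dense {z : Fin n → Plane | Function.Injective (chartX c z)} := by
  intro z
  refine mem_closure_of_eventually_add_smul (fun i => !₂[((i : ℕ) : ℝ), 0]) ?_
  have : ∀ p : {p : Fin n × Fin n // p.1 ≠ p.2}, ∀ᶠ e in 𝓝[≠] (0 : ℝ),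
      (chartX c z p.1.1 - chartX c z p.1.2) + e * (((p.1.1 : ℕ) : ℝ) - ((p.1.2 : ℕ) : ℝ)) ≠ 0 :=
    fun p => eventually_add_mul_ne_zero _ (sub_ne_zero.mpr fun h =>
      p.2 (Fin.ext (Nat.cast_injective h)))
  filter_upwards [Filter.eventually_all.mpr this] with e he i j hij
  by_contra hne
  refine he ⟨(i, j), hne⟩ ?_
  simp only [chartX, Pi.add_apply, Pi.smul_apply, PiLp.add_apply, PiLp.smul_apply, smul_eq_mul,
    Matrix.cons_val_zero, Matrix.cons_val_one, Matrix.cons_val_fin_one] at hij ⊢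
  linarith

theorem dense_and_isOpen_chartGeneric (c : ℝ) : Dense (chartGeneric c : Set (Fin n → Plane)) ∧
    IsOpen (chartGeneric c : Set (Fin n → Plane)) := by
  let O : Set (Fin n → Plane) := {z | Function.Injective (chartX c z)}
  -- the conditions on pairs of divided differences; a displacement of one point that belongs to
  -- only one of the two sets separates them
  let I := {p : Finset (Fin n) × Finset (Fin n) // ¬ p.1 ⊆ p.2}
  let A : I → Set (Fin n → Plane) := fun p => {z | z ∈ O ∧ chartDiff c z p.1.1 ≠ chartDiff c z
      p.1.2}
  have hopen : ∀ p, IsOpen (A p) := by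
    intro p
    rw [isOpen_iff_mem_nhds]
    rintro z ⟨hz, hne⟩
    filter_upwards [(isOpen_injective_chartX c).mem_nhds hz,
      ((continuousAt_chartDiff hz p.1.1).sub
        (continuousAt_chartDiff hz p.1.2)).eventually_ne (sub_ne_zero.mpr hne)] with z' h1 h2
    exact ⟨h1, sub_ne_zero.mp h2⟩
  have hdense : ∀ p, Dense (A p) := by
    rintro ⟨⟨S, S'⟩, hSS⟩
    obtain ⟨i, hi, hi'⟩ := Finset.not_subset.mp hSS
    refine ((dense_injective_chartX c).mono fun z hz => ?_).of_closure
    refine mem_closure_of_eventually_add_smul (vertical c (Pi.single i 1)) ?_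
    filter_upwards [eventually_add_mul_ne_zero (chartDiff c z S - chartDiff c z S')
      (dividedDifference_single_of_mem hz hi)] with e he
    refine ⟨?_, ?_⟩
    · change Function.Injective _
      rw [chartX_add_smul_vertical]
      exact hz
    · simp only [chartDiff_add_smul_vertical, dividedDifference_single_of_notMem hi']
      intro h
      apply he
      linarith
  have heq : (chartGeneric c : Set (Fin n → Plane)) = O ∩ ⋂ p, A p := by
    ext z
    simp only [Set.mem_inter_iff, Set.mem_iInter]
    constructor
    · rintro ⟨h1, h2⟩
      exact ⟨h1, fun p => ⟨h1, fun h => p.2 (h2 h ▸ subset_rfl)⟩⟩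
    · rintro ⟨h1, h2⟩
      refine ⟨h1, fun S S' h => Finset.Subset.antisymm ?_ ?_⟩ <;> by_contra hS
      · exact (h2 ⟨(S, S'), hS⟩).2 h
      · exact (h2 ⟨(S', S), hS⟩).2 h.symm
  have hO := isOpen_injective_chartX (n := n) c
  have hAopen : IsOpen (⋂ p, A p) := isOpen_iInter_of_finite hopen
  rw [heq]
  exact ⟨(dense_injective_chartX c).inter_of_isOpen_left (dense_iInter_of_isOpen hopen hdense) hO,
    hO.inter hAopen⟩

theorem nhdsWithin_chartGeneric_neBot (c : ℝ) (z : Fin n → Plane) :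
    (𝓝[chartGeneric c] z).NeBot :=
  mem_closure_iff_nhdsWithin_neBot.mp ((dense_and_isOpen_chartGeneric c).1 z)

end Chart

/-! ### The sweep words of a configuration -/

section Sweep

variable {n : ℕ}

/-- The triples in `B`, sorted by decreasing divided difference. -/
noncomputable def sweepWord (c : ℝ) (B : Finset (MultiIndex n 3)) (z : Fin n → Plane) :
    List (MultiIndex n 3) :=
  B.toList.mergeSort fun m m' => chartDiff c z m'.1 ≤ chartDiff c z m.1

theorem sweepWord_perm (c : ℝ) (B : Finset (MultiIndex n 3)) (z : Fin n → Plane) :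
    (sweepWord c B z).Perm B.toList :=
  List.mergeSort_perm _ _

theorem mem_sweepWord {c : ℝ} {B : Finset (MultiIndex n 3)} {z : Fin n → Plane}
    {m : MultiIndex n 3} : m ∈ sweepWord c B z ↔ m ∈ B := by
  rw [(sweepWord_perm c B z).mem_iff, Finset.mem_toList]

theorem nodup_sweepWord (c : ℝ) (B : Finset (MultiIndex n 3)) (z : Fin n → Plane) :
    (sweepWord c B z).Nodup :=
  (sweepWord_perm c B z).nodup_iff.mpr B.nodup_toList

theorem pairwise_sweepWord {c : ℝ} (B : Finset (MultiIndex n 3)) {z : Fin n → Plane}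
    (hz : z ∈ chartGeneric c) :
    (sweepWord c B z).Pairwise fun m m' => chartDiff c z m'.1 < chartDiff c z m.1 := by
  have h1 : (sweepWord c B z).Pairwise fun m m' => chartDiff c z m'.1 ≤ chartDiff c z m.1 := by
    have := List.pairwise_mergeSort (l := B.toList)
      (le := fun m m' : MultiIndex n 3 => decide (chartDiff c z m'.1 ≤ chartDiff c z m.1))
      (by intro a b d; simp only [decide_eq_true_eq]; exact fun h h' => h'.trans h)
      (by intro a b; simpa using le_total _ _)
    simpa only [decide_eq_true_eq, sweepWord] using this
  refine (h1.and (nodup_sweepWord c B z)).imp fun h => lt_of_le_of_ne h.1 fun he => ?_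
  exact h.2 (Subtype.ext (hz.2 he).symm)

theorem exists_eq_erase_of_subset {α : Type*} [DecidableEq α] {s S : Finset α} (hs : s ⊆ S)
    (hc : S.card = s.card + 1) : ∃ a ∈ S, s = S.erase a := by
  obtain ⟨a, ha⟩ := Finset.card_eq_one.mp
    (show (S \ s).card = 1 by rw [Finset.card_sdiff_of_subset hs]; omega)
  have haS : a ∈ S \ s := ha ▸ Finset.mem_singleton_self a
  exact ⟨a, (Finset.mem_sdiff.mp haS).1, by
    rw [Finset.erase_eq, ← ha, Finset.sdiff_sdiff_eq_self hs]⟩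

/-- Two triples of a tied pair either commute or have a degenerate quadruple as their union. -/
theorem commute_or_chartDiff_union_eq_zero {c : ℝ} {r : Fin n → Plane}
    (hr : Function.Injective (chartX c r)) {m m' : MultiIndex n 3} (hne : m ≠ m')
    (h : chartDiff c r m.1 = chartDiff c r m'.1) :
    Commute (freeBraid [m]) (freeBraid [m']) ∨
      ((m.1 ∪ m'.1).card = 4 ∧ chartDiff c r (m.1 ∪ m'.1) = 0) := by
  by_cases hc : (m.1 ∩ m'.1).card + 1 < 3
  · exact Or.inl (freeBraid_commute hc)
  right
  have h3 := m.2
  have h3' := m'.2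
  have hlt : (m.1 ∩ m'.1).card < 3 := by
    by_contra hge
    have h1 : m.1 ∩ m'.1 = m.1 :=
      Finset.eq_of_subset_of_card_le Finset.inter_subset_left (by omega)
    have h2 : m.1 ∩ m'.1 = m'.1 :=
      Finset.eq_of_subset_of_card_le Finset.inter_subset_right (by omega)
    exact hne (Subtype.ext (h1.symm.trans h2))
  have hu := Finset.card_union_add_card_inter m.1 m'.1
  have hu4 : (m.1 ∪ m'.1).card = 4 := by omega
  refine ⟨hu4, ?_⟩
  obtain ⟨a, haU, ha⟩ := exists_eq_erase_of_subset (Finset.subset_union_left (s₁ := m.1) (s₂ :=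
      m'.1)) (by omega)
  obtain ⟨b, hbU, hb⟩ := exists_eq_erase_of_subset (Finset.subset_union_right (s₁ := m.1) (s₂ :=
      m'.1)) (by omega)
  have key := dividedDifference_erase_sub_erase (y := chartY r) hr haU hbU
  rw [← ha, ← hb] at key
  change chartDiff c r m.1 - chartDiff c r m'.1 = _ * chartDiff c r (m.1 ∪ m'.1) at key
  rw [h, sub_self, eq_comm, mul_eq_zero, sub_eq_zero] at key
  refine key.resolve_left fun hab => hne (Subtype.ext ?_)
  exact (ha.trans (congrArg _ (hr hab).symm)).trans hb.symm

theorem facet_eq_erase (u : Fin 4 ↪ Fin n) (j : Fin 4) :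
    (facet (k := 3) u j).1 = (Finset.univ.map u).erase (u j) := by
  simp [facet, Finset.map_erase]

/-- In a quadruple that is ordered by the abscissas, the divided differences of the triples are
monotone in the omitted point; the sign of the third divided difference is the direction. -/
theorem chartDiff_facet_lt {c : ℝ} {p : Fin n → Plane} (hp : Function.Injective (chartX c p))
    {u : Fin 4 ↪ Fin n} (hu : StrictMono (chartX c p ∘ u)) {a b : Fin 4} (hab : a < b) :
    (0 < chartDiff c p (Finset.univ.map u) →
      chartDiff c p (facet (k := 3) u b).1 < chartDiff c p (facet (k := 3) u a).1) ∧
    (chartDiff c p (Finset.univ.map u) < 0 →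
      chartDiff c p (facet (k := 3) u a).1 < chartDiff c p (facet (k := 3) u b).1) := by
  have key := dividedDifference_erase_sub_erase (y := chartY p) (S := Finset.univ.map u) hp
    (a := u a) (b := u b) (by simp) (by simp)
  rw [← facet_eq_erase, ← facet_eq_erase] at key
  change chartDiff c p (facet (k := 3) u a).1 - chartDiff c p (facet (k := 3) u b).1 =
    _ * chartDiff c p (Finset.univ.map u) at key
  have hx : 0 < chartX c p (u b) - chartX c p (u a) := sub_pos.mpr (hu hab)
  constructor <;> intro h
  · have := mul_pos hx h
    linarith
  · have := mul_neg_of_pos_of_neg hx h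
    linarith

/-- The four triples of a quadruple, in their order in a sweep word, form one of the two sides of
a tetrahedron relation. -/
theorem freeBraid_eq_tetraWord {c : ℝ} {p : Fin n → Plane} (hp : p ∈ chartGeneric c)
    {u : Fin 4 ↪ Fin n} (hu : StrictMono (chartX c p ∘ u)) {L : List (MultiIndex n 3)}
    (hL : L.Pairwise fun m m' => chartDiff c p m'.1 < chartDiff c p m.1) (hnd : L.Nodup)
    (hmem : ∀ m, m ∈ L ↔ m.1 ⊆ Finset.univ.map u) :
    freeBraid L = freeBraid (tetraWord (k := 3) u) := by
  have hinj : Function.Injective (facet (k := 3) u) := by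
    intro a b hab
    by_contra hne
    have h1 : u a ∈ (facet (k := 3) u b).1 := by
      rw [facet_eq_erase]; simp [hne]
    rw [← hab, facet_eq_erase] at h1
    simp at h1
  have hnd' : (tetraWord (k := 3) u).Nodup := List.nodup_ofFn.mpr hinj
  have hperm : L.Perm (tetraWord (k := 3) u) := by
    refine (List.perm_ext_iff_of_nodup hnd hnd').mpr fun m => ?_
    rw [hmem, tetraWord, List.mem_ofFn]
    constructor
    · intro hm
      obtain ⟨a, haU, ha⟩ := exists_eq_erase_of_subset hm (by rw [m.2]; simp)
      obtain ⟨j, -, rfl⟩ := Finset.mem_map.mp haU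
      exact ⟨j, Subtype.ext ((facet_eq_erase u j).trans ha.symm)⟩
    · rintro ⟨j, rfl⟩
      rw [facet_eq_erase]
      exact Finset.erase_subset _ _
  have hasymm : ∀ a b : MultiIndex n 3, chartDiff c p b.1 < chartDiff c p a.1 →
      chartDiff c p a.1 < chartDiff c p b.1 → a = b := fun a b h h' => absurd h h'.not_gt
  have hne : chartDiff c p (Finset.univ.map u) ≠ 0 := by
    intro h0
    rw [← dividedDifference_empty (chartX c p) (chartY p)] at h0
    have := congrArg Finset.card (hp.2 h0)
    simp at this
  rcases lt_or_gt_of_ne hne with h | h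
  · rw [← freeBraid_tetraWord_reverse]
    congr 1
    refine List.Perm.eq_of_pairwise (fun a b _ _ => hasymm a b) hL ?_
      (hperm.trans (List.reverse_perm _).symm)
    rw [List.pairwise_reverse, tetraWord, List.pairwise_ofFn]
    exact fun a b hab => (chartDiff_facet_lt hp.1 hu hab).2 h
  · congr 1
    refine List.Perm.eq_of_pairwise (fun a b _ _ => hasymm a b) hL ?_ hperm
    rw [tetraWord, List.pairwise_ofFn]
    exact fun a b hab => (chartDiff_facet_lt hp.1 hu hab).1 h

theorem exists_embedding_strictMono {x : Fin n → ℝ} (hx : Function.Injective x)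
    {S : Finset (Fin n)} (hS : S.card = 4) :
    ∃ u : Fin 4 ↪ Fin n, Finset.univ.map u = S ∧ StrictMono (x ∘ u) := by
  let e := S.orderEmbOfFin hS
  let σ := Tuple.sort (x ∘ e)
  refine ⟨σ.toEmbedding.trans e.toEmbedding, ?_, ?_⟩
  · rw [← Finset.map_map]
    have : Finset.univ.map σ.toEmbedding = Finset.univ := by simp
    rw [this]
    ext i
    simp only [Finset.mem_map, Finset.mem_univ, true_and]
    exact Set.ext_iff.mp (Finset.range_orderEmbOfFin S hS) i
  · refine (Tuple.monotone_sort (x ∘ e)).strictMono_of_injective ?_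
    exact (hx.comp e.injective).comp σ.injective

/-- The sweep word of a set of triples is locally constant, as a free braid, at a configuration
in which at most one quadruple is degenerate and no tie joins the set to its complement. -/
theorem exists_eventually_freeBraid_sweepWord_eq_of_unique {c : ℝ} {B : Finset (MultiIndex n 3)}
    {r : Fin n → Plane} (hr : Function.Injective (chartX c r))
    (hB : ∀ m ∈ B, ∀ m' ∉ B, chartDiff c r m.1 ≠ chartDiff c r m'.1)
    (hQ : ∀ S S' : Finset (Fin n), S.card = 4 → S'.card = 4 → chartDiff c r S = 0 →
      chartDiff c r S' = 0 → S = S') :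
    ∃ g, ∀ᶠ p in 𝓝[chartGeneric c] r, freeBraid (sweepWord c B p) = g := by
  classical
  -- a neighbourhood in which strict inequalities at `r` persist
  have hd : ∀ᶠ p in 𝓝 r, ∀ m m' : MultiIndex n 3,
      chartDiff c r m.1 < chartDiff c r m'.1 → chartDiff c p m.1 < chartDiff c p m'.1 := by
    refine Filter.eventually_all.mpr fun m => Filter.eventually_all.mpr fun m' => ?_
    by_cases h : chartDiff c r m.1 < chartDiff c r m'.1
    · filter_upwards [(continuousAt_chartDiff hr m.1).eventually_lt
        (continuousAt_chartDiff hr m'.1) h] with p hp _ using hp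
    · exact Filter.Eventually.of_forall fun p h' => absurd h' h
  have hX : ∀ᶠ p in 𝓝 r, ∀ i j : Fin n,
      chartX c r i < chartX c r j → chartX c p i < chartX c p j := by
    refine Filter.eventually_all.mpr fun i => Filter.eventually_all.mpr fun j => ?_
    by_cases h : chartX c r i < chartX c r j
    · filter_upwards [(continuous_chartX c i).continuousAt.eventually_lt
        (continuous_chartX c j).continuousAt h] with p hp _ using hp
    · exact Filter.Eventually.of_forall fun p h' => absurd h' h
  have hev : ∀ᶠ p in 𝓝[chartGeneric c] r, p ∈ chartGeneric c ∧
      (∀ m m' : MultiIndex n 3,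
        chartDiff c r m.1 < chartDiff c r m'.1 → chartDiff c p m.1 < chartDiff c p m'.1) ∧
      (∀ i j : Fin n, chartX c r i < chartX c r j → chartX c p i < chartX c p j) := by
    filter_upwards [self_mem_nhdsWithin, mem_nhdsWithin_of_mem_nhds hd,
      mem_nhdsWithin_of_mem_nhds hX] with p h1 h2 h3 using ⟨h1, h2, h3⟩
  have := nhdsWithin_chartGeneric_neBot c r
  obtain ⟨q, hqg, hqd, hqX⟩ := hev.exists
  refine ⟨freeBraid (sweepWord c B q), ?_⟩
  filter_upwards [hev] with p hp
  obtain ⟨hpg, hpd, hpX⟩ := hp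
  have hpq : (sweepWord c B p).Perm (sweepWord c B q) :=
    (sweepWord_perm c B p).trans (sweepWord_perm c B q).symm
  -- letters whose order differs near `r` are tied at `r`
  have hle : ∀ {p'}, (∀ m m' : MultiIndex n 3, chartDiff c r m.1 < chartDiff c r m'.1 →
      chartDiff c p' m.1 < chartDiff c p' m'.1) → ∀ {m m' : MultiIndex n 3},
      chartDiff c p' m'.1 < chartDiff c p' m.1 → chartDiff c r m'.1 ≤ chartDiff c r m.1 :=
    fun h m m' hlt => not_lt.mp fun h' => (h m m' h').not_gt hlt
  have htie : ∀ {m m' : MultiIndex n 3}, chartDiff c p m'.1 < chartDiff c p m.1 →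
      chartDiff c q m.1 < chartDiff c q m'.1 → chartDiff c r m.1 = chartDiff c r m'.1 :=
    fun h h' => le_antisymm (hle hqd h') (hle hpd h)
  have hneq : ∀ {m m' : MultiIndex n 3}, chartDiff c p m'.1 < chartDiff c p m.1 → m ≠ m' := by
    rintro m _ h rfl
    exact lt_irrefl _ h
  by_cases hfar : ∀ m ∈ B, ∀ m' ∈ B, m ≠ m' → chartDiff c r m.1 = chartDiff c r m'.1 →
      Commute (freeBraid [m]) (freeBraid [m'])
  · rw [freeBraid_eq_prod_map, freeBraid_eq_prod_map]
    refine hpq.prod_map_eq_of_pairwise_commute _ (pairwise_sweepWord B hpg)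
      (pairwise_sweepWord B hqg) fun m hm m' hm' h h' => ?_
    exact hfar m (mem_sweepWord.mp hm) m' (mem_sweepWord.mp hm') (hneq h) (htie h h')
  -- otherwise, the four triples of one quadruple are tied
  push Not at hfar
  obtain ⟨m₁, hm₁, m₂, hm₂, hne₁₂, htie₁₂, hncomm⟩ := hfar
  obtain ⟨hS4, hS0⟩ := (commute_or_chartDiff_union_eq_zero hr hne₁₂ htie₁₂).resolve_left hncomm
  obtain ⟨u, hu, hmono⟩ := exists_embedding_strictMono hr hS4
  set S := m₁.1 ∪ m₂.1 with hSdef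
  set v := chartDiff c r m₁.1 with hv
  have hadj : ∀ {m m' : MultiIndex n 3}, m ≠ m' → chartDiff c r m.1 = chartDiff c r m'.1 →
      Commute (freeBraid [m]) (freeBraid [m']) ∨ (m.1 ⊆ S ∧ m'.1 ⊆ S) := by
    intro m m' hne h
    refine (commute_or_chartDiff_union_eq_zero hr hne h).imp id fun ⟨h4, h0⟩ => ?_
    have := hQ _ _ h4 hS4 h0 hS0
    exact ⟨this ▸ Finset.subset_union_left, this ▸ Finset.subset_union_right⟩
  have hface : ∀ m : MultiIndex n 3, m.1 ⊆ S → chartDiff c r m.1 = v := by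
    intro m hm
    obtain ⟨a, haS, ha⟩ := exists_eq_erase_of_subset hm (by rw [hS4, m.2])
    obtain ⟨b, hbS, hb⟩ := exists_eq_erase_of_subset (show m₁.1 ⊆ S from Finset.subset_union_left)
      (by rw [hS4, m₁.2])
    have key := dividedDifference_erase_sub_erase (y := chartY r) hr haS hbS
    rw [← ha, ← hb] at key
    change chartDiff c r m.1 - v = _ * chartDiff c r S at key
    rw [hS0, mul_zero, sub_eq_zero] at key
    exact key
  have hfaceB : ∀ m : MultiIndex n 3, m.1 ⊆ S → m ∈ B := by
    intro m hm
    by_contra hmB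
    exact hB m₁ hm₁ m hmB (hface m hm).symm
  -- the letters before, in, and after the degenerate quadruple
  let κ : MultiIndex n 3 → ℕ := fun m =>
    if m.1 ⊆ S then 1 else if v ≤ chartDiff c r m.1 then 0 else 2
  have hsplit : ∀ {p'}, p' ∈ chartGeneric c →
      (∀ m m' : MultiIndex n 3, chartDiff c r m.1 < chartDiff c r m'.1 →
        chartDiff c p' m.1 < chartDiff c p' m'.1) →
      freeBraid (sweepWord c B p') =
        freeBraid ((sweepWord c B p').filter fun m => κ m = 0) *
          freeBraid ((sweepWord c B p').filter fun m => κ m = 1) *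
          freeBraid ((sweepWord c B p').filter fun m => κ m = 2) := by
    intro p' hg hmono'
    rw [← freeBraid_append, ← freeBraid_append, freeBraid_eq_prod_map, freeBraid_eq_prod_map]
    have hpw := pairwise_sweepWord B hg
    have hnd := nodup_sweepWord c B p'
    have hperm : (sweepWord c B p').Perm
        ((sweepWord c B p').filter (fun m => κ m = 0) ++
          (sweepWord c B p').filter (fun m => κ m = 1) ++
          (sweepWord c B p').filter (fun m => κ m = 2)) := by
      refine (List.perm_ext_iff_of_nodup hnd ?_).mpr fun m => ?_
      · simp only [List.nodup_append, hnd.filter, List.mem_append, List.mem_filter,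
          decide_eq_true_eq, true_and]
        refine ⟨?_, ?_⟩
        · rintro a ⟨-, ha⟩ b ⟨-, hb⟩ rfl
          omega
        · rintro a (⟨-, ha⟩ | ⟨-, ha⟩) b ⟨-, hb⟩ rfl <;> omega
      · simp only [List.mem_append, List.mem_filter, decide_eq_true_eq]
        have : κ m = 0 ∨ κ m = 1 ∨ κ m = 2 := by
          simp only [κ]; split_ifs <;> simp
        tauto
    refine hperm.prod_map_eq_of_pairwise_commute _
      (R' := fun a b => κ a < κ b ∨ κ a = κ b ∧ chartDiff c p' b.1 < chartDiff c p' a.1)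
      hpw ?_ ?_
    · have hf : ∀ i : ℕ, ((sweepWord c B p').filter fun m => κ m = i).Pairwise
          fun a b => κ a < κ b ∨ κ a = κ b ∧ chartDiff c p' b.1 < chartDiff c p' a.1 := by
        intro i
        refine (hpw.filter _).imp_of_mem fun {a b} ha hb h => Or.inr ⟨?_, h⟩
        rw [List.mem_filter, decide_eq_true_eq] at ha hb
        rw [ha.2, hb.2]
      simp only [List.pairwise_append, hf, List.mem_append, List.mem_filter,
        decide_eq_true_eq, true_and]
      refine ⟨?_, ?_⟩
      · rintro a ⟨-, ha⟩ b ⟨-, hb⟩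
        left; omega
      · rintro a (⟨-, ha⟩ | ⟨-, ha⟩) b ⟨-, hb⟩ <;> left <;> omega
    · intro a _ b _ hab hba
      have hbal := hle hmono' hab
      have hne : a ≠ b := by rintro rfl; exact lt_irrefl _ hab
      rcases hba with hk | ⟨-, h⟩
      · -- an inversion between different classes is a tie with a letter outside the quadruple
        by_cases ha : a.1 ⊆ S
        · by_cases hb : b.1 ⊆ S
          · simp [κ, ha, hb] at hk
          · have hva := hface a ha
            by_cases hvb : v ≤ chartDiff c r b.1
            · refine (hadj hne (le_antisymm (hva ▸ hvb) hbal)).resolve_right fun h => hb h.2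
            · simp [κ, ha, hb, hvb] at hk
        · by_cases hva : v ≤ chartDiff c r a.1
          · simp [κ, ha, hva] at hk
          · by_cases hb : b.1 ⊆ S
            · exact absurd ((hface b hb) ▸ hbal) hva
            · by_cases hvb : v ≤ chartDiff c r b.1
              · exact absurd (hvb.trans hbal) hva
              · simp [κ, ha, hb, hva, hvb] at hk
      · exact absurd h hab.not_gt
  rw [hsplit hpg hpd, hsplit hqg hqd]
  have hout : ∀ i, i ≠ 1 → freeBraid ((sweepWord c B p).filter fun m => κ m = i) =
      freeBraid ((sweepWord c B q).filter fun m => κ m = i) := by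
    intro i hi
    rw [freeBraid_eq_prod_map, freeBraid_eq_prod_map]
    refine (hpq.filter _).prod_map_eq_of_pairwise_commute _ ((pairwise_sweepWord B hpg).filter _)
      ((pairwise_sweepWord B hqg).filter _) fun m hm m' hm' h h' => ?_
    refine (hadj (hneq h) (htie h h')).resolve_right fun hS => ?_
    have := (List.mem_filter.mp hm).2
    simp only [κ, hS.1, if_true, decide_eq_true_eq] at this
    exact hi this.symm
  have hin : ∀ {p'}, p' ∈ chartGeneric c →
      (∀ i j : Fin n, chartX c r i < chartX c r j → chartX c p' i < chartX c p' j) →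
      freeBraid ((sweepWord c B p').filter fun m => κ m = 1) =
        freeBraid (tetraWord (k := 3) u) := by
    intro p' hg hX'
    refine freeBraid_eq_tetraWord hg (fun a b hab => hX' _ _ (hmono hab))
      ((pairwise_sweepWord B hg).filter _) ((nodup_sweepWord c B p').filter _) fun m => ?_
    rw [List.mem_filter, mem_sweepWord, hu, decide_eq_true_eq]
    constructor
    · rintro ⟨-, h⟩
      by_contra hS
      simp only [κ, hS, if_false] at h
      split_ifs at h
      all_goals omega
    · exact fun h => ⟨hfaceB m h, by simp [κ, h]⟩
  rw [hout 0 (by norm_num), hout 2 (by norm_num), hin hpg hpX, hin hqg hqX]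

end Sweep

section Sweep

variable {n : ℕ}

/-- The sweep word of a set of triples that lies, at a configuration, strictly below its complement
is locally constant there as a free braid: adding multiples of the cubes of the abscissas to the
ordinates raises all third divided differences at the same speed, so that a nearby configuration
is moved to one without degenerate quadruples through configurations with at most one of them. -/
theorem exists_eventually_freeBraid_sweepWord_eq {c : ℝ} {B : Finset (MultiIndex n 3)}
    {z : Fin n → Plane} (hz : Function.Injective (chartX c z))
    (hB : ∀ m ∈ B, ∀ m' ∉ B, chartDiff c z m.1 < chartDiff c z m'.1) :
    ∃ g, ∀ᶠ p in 𝓝[chartGeneric c] z, freeBraid (sweepWord c B p) = g := by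
  let N : Set (Fin n → Plane) := {p | Function.Injective (chartX c p) ∧
    ∀ m ∈ B, ∀ m' ∉ B, chartDiff c p m.1 < chartDiff c p m'.1}
  have hN : ∀ p ∈ N, ∀ᶠ q in 𝓝 p, q ∈ N := by
    rintro p ⟨hp, hpB⟩
    have : ∀ᶠ q in 𝓝 p, ∀ m m' : MultiIndex n 3, m ∈ B → m' ∉ B →
        chartDiff c q m.1 < chartDiff c q m'.1 := by
      refine Filter.eventually_all.mpr fun m => Filter.eventually_all.mpr fun m' => ?_
      by_cases h : m ∈ B ∧ m' ∉ B
      · filter_upwards [(continuousAt_chartDiff hp m.1).eventually_lt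
          (continuousAt_chartDiff hp m'.1) (hpB m h.1 m' h.2)] with q hq _ _ using hq
      · exact Filter.Eventually.of_forall fun q h1 h2 => absurd ⟨h1, h2⟩ h
    filter_upwards [(isOpen_injective_chartX c).mem_nhds hp, this] with q h1 h2
    exact ⟨h1, fun m hm m' hm' => h2 m m' hm hm'⟩
  let Φ : (Fin n → Plane) × ℝ → (Fin n → Plane) := fun a =>
    a.1 + a.2 • vertical c (fun i => chartX c a.1 i ^ 3)
  have hΦ : Continuous Φ := by
    have hv : Continuous fun a : (Fin n → Plane) × ℝ =>
        vertical c (fun i => chartX c a.1 i ^ 3) := by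
      refine continuous_pi fun i => ?_
      have hX : Continuous fun a : (Fin n → Plane) × ℝ => chartX c a.1 i :=
        (continuous_chartX c i).comp continuous_fst
      unfold vertical
      fun_prop
    exact continuous_fst.add (continuous_snd.smul hv)
  have hΦX : ∀ p s, chartX c (Φ (p, s)) = chartX c p := fun p s =>
    chartX_add_smul_vertical c p _ s
  have hΦQ : ∀ p s, Function.Injective (chartX c p) → ∀ S : Finset (Fin n), S.card = 4 →
      chartDiff c (Φ (p, s)) S = chartDiff c p S + s := by
    intro p s hp S hS
    simp only [Φ, chartDiff_add_smul_vertical]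
    rw [dividedDifference_cube hp hS, mul_one]
  have hΦ0 : ∀ p, Φ (p, 0) = p := fun p => by simp [Φ]
  -- the amount `r₀` by which the third divided differences are raised
  have hz0 : ∀ᶠ s in 𝓝 (0 : ℝ), Φ (z, s) ∈ N := by
    have h1 : Filter.Tendsto (fun s : ℝ => Φ (z, s)) (𝓝 0) (𝓝 (Φ (z, 0))) :=
      (hΦ.comp (Continuous.prodMk_right z)).tendsto 0
    rw [hΦ0] at h1
    exact h1.eventually (hN z ⟨hz, hB⟩)
  obtain ⟨δ, hδ, hδN⟩ := Metric.eventually_nhds_iff.mp hz0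
  have hne : ∀ᶠ s in 𝓝[>] (0 : ℝ), ∀ S : Finset (Fin n), chartDiff c z S + s * 1 ≠ 0 :=
    Filter.Eventually.filter_mono (nhdsWithin_mono _ fun s (hs : 0 < s) => hs.ne')
      (Filter.eventually_all.mpr fun S => eventually_add_mul_ne_zero _ one_ne_zero)
  obtain ⟨r₀, hr₀, hr₀0, hr₀δ⟩ := (hne.and (eventually_mem_nhdsWithin.and
    (mem_nhdsWithin_of_mem_nhds (gt_mem_nhds hδ)))).exists
  have hr₀0 : 0 < r₀ := hr₀0
  have hzN : ∀ s ∈ Set.Icc 0 r₀, Φ (z, s) ∈ N := fun s hs => hδN (by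
    rw [Real.dist_eq, sub_zero, abs_of_nonneg hs.1]; exact hs.2.trans_lt hr₀δ)
  have htube : ∀ᶠ p in 𝓝 z, ∀ s ∈ Set.Icc 0 r₀, Φ (p, s) ∈ N :=
    isCompact_Icc.eventually_forall_of_forall_eventually fun s hs =>
      hΦ.continuousAt.eventually (hN _ (hzN s hs))
  obtain ⟨hrinj, hrB⟩ := hzN r₀ ⟨hr₀0.le, le_rfl⟩
  obtain ⟨g, hg⟩ := exists_eventually_freeBraid_sweepWord_eq_of_unique hrinj
    (fun m hm m' hm' => (hrB m hm m' hm').ne) (fun S S' hS _ h0 _ => by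
      rw [hΦQ z r₀ hz S hS] at h0
      exact absurd h0 (by simpa using hr₀ S))
  refine ⟨g, ?_⟩
  have hg' : ∀ᶠ p in 𝓝 z, ∀ᶠ q in 𝓝[chartGeneric c] (Φ (p, r₀)),
      freeBraid (sweepWord c B q) = g := by
    have h1 : ∀ᶠ y in 𝓝 (Φ (z, r₀)), ∀ᶠ q in 𝓝[chartGeneric c] y,
        freeBraid (sweepWord c B q) = g := eventually_nhds_nhdsWithin.mpr hg
    exact (hΦ.comp (Continuous.prodMk_left r₀)).continuousAt.eventually h1
  filter_upwards [self_mem_nhdsWithin, mem_nhdsWithin_of_mem_nhds htube,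
    mem_nhdsWithin_of_mem_nhds hg'] with p hpg hpN hpr
  have hpath : IsPreconnected ((fun s => Φ (p, s)) '' Set.Icc 0 r₀) :=
    isPreconnected_Icc.image _ (hΦ.comp (Continuous.prodMk_right p)).continuousOn
  obtain ⟨g', hg'⟩ := hpath.exists_eventually_eq
    (f := fun q => freeBraid (sweepWord c B q)) (V := chartGeneric c)
    (fun r _ => nhdsWithin_chartGeneric_neBot c r)
    ⟨_, Set.mem_image_of_mem _ ⟨le_rfl, hr₀0.le⟩⟩ (by
      rintro _ ⟨s, hs, rfl⟩
      obtain ⟨h1, h2⟩ := hpN s hs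
      refine exists_eventually_freeBraid_sweepWord_eq_of_unique h1
        (fun m hm m' hm' => (h2 m hm m' hm').ne) fun S S' hS hS' h0 h0' => ?_
      rw [hΦQ p s hpg.1 S hS] at h0
      rw [hΦQ p s hpg.1 S' hS'] at h0'
      exact hpg.2 (add_right_cancel (h0.trans h0'.symm)))
  have hp0 := hg' p ⟨0, ⟨le_rfl, hr₀0.le⟩, hΦ0 p⟩
  have := nhdsWithin_chartGeneric_neBot c (Φ (p, r₀))
  obtain ⟨q, hq1, hq2⟩ := (hpr.and (hg' _ ⟨r₀, ⟨hr₀0.le, le_rfl⟩, rfl⟩)).exists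
  rw [hp0.self_of_nhdsWithin hpg, ← hq2, hq1]

open Classical in
/-- The triples of negative divided difference. -/
noncomputable def negTriples (c : ℝ) (z : Fin n → Plane) : Finset (MultiIndex n 3) :=
  Finset.univ.filter fun m => chartDiff c z m.1 < 0

theorem mem_negTriples {c : ℝ} {z : Fin n → Plane} {m : MultiIndex n 3} :
    m ∈ negTriples c z ↔ chartDiff c z m.1 < 0 := by
  simp [negTriples]

open Classical in
/-- The free braid that is swept out when a large multiple of the squares of the abscissas is added
to the ordinates: the product of the triples of negative divided difference, by decreasing divided
difference, for configurations in very general position near `z`. -/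
noncomputable def sweepBraid (c : ℝ) (z : Fin n → Plane) : FreeBraidGroup n 3 :=
  if h : ∃ g, ∀ᶠ p in 𝓝[chartGeneric c] z, freeBraid (sweepWord c (negTriples c z) p) = g
  then h.choose else 1

theorem eventually_sweepBraid {c : ℝ} {z : Fin n → Plane}
    (hz : Function.Injective (chartX c z)) :
    ∀ᶠ p in 𝓝[chartGeneric c] z,
      freeBraid (sweepWord c (negTriples c z) p) = sweepBraid c z := by
  have h := exists_eventually_freeBraid_sweepWord_eq (B := negTriples c z) hz
    fun m hm m' hm' => (mem_negTriples.mp hm).trans_le (not_lt.mp fun h =>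
        hm' (mem_negTriples.mpr h))
  rw [sweepBraid, dif_pos h]
  exact h.choose_spec

theorem eventually_sweepBraid_eq_of_eventually {c : ℝ} {z₀ : Fin n → Plane}
    (hz₀ : Function.Injective (chartX c z₀)) {B : Finset (MultiIndex n 3)}
    {g : FreeBraidGroup n 3}
    (h : ∀ᶠ p in 𝓝[chartGeneric c] z₀, freeBraid (sweepWord c B p) = g) :
    ∀ᶠ z in 𝓝 z₀, negTriples c z = B → sweepBraid c z = g := by
  filter_upwards [eventually_nhds_nhdsWithin.mpr h,
    (isOpen_injective_chartX c).mem_nhds hz₀] with z h1 hz hB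
  subst hB
  have := nhdsWithin_chartGeneric_neBot c z
  obtain ⟨p, hp1, hp2⟩ := (h1.and (eventually_sweepBraid hz)).exists
  exact hp2.symm.trans hp1

theorem eventually_sweepBraid_eq {c : ℝ} {z₀ : Fin n → Plane}
    (hz₀ : Function.Injective (chartX c z₀)) :
    ∀ᶠ z in 𝓝 z₀, negTriples c z = negTriples c z₀ → sweepBraid c z = sweepBraid c z₀ :=
  eventually_sweepBraid_eq_of_eventually hz₀ (eventually_sweepBraid hz₀)

/-- A triple that becomes negative is the first letter of the new sweep word. -/
theorem eventually_sweepBraid_eq_mul {c : ℝ} {z₀ : Fin n → Plane}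
    (hz₀ : Function.Injective (chartX c z₀)) {m₀ : MultiIndex n 3}
    (hm₀ : chartDiff c z₀ m₀.1 = 0) :
    ∀ᶠ z in 𝓝 z₀, (∀ m, m ∈ negTriples c z ↔ m = m₀ ∨ m ∈ negTriples c z₀) →
      sweepBraid c z = freeBraid [m₀] * sweepBraid c z₀ := by
  classical
  have hnot : m₀ ∉ negTriples c z₀ := fun h => (mem_negTriples.mp h).ne hm₀
  have hev : ∀ᶠ p in 𝓝[chartGeneric c] z₀,
      freeBraid (sweepWord c (insert m₀ (negTriples c z₀)) p) =
        freeBraid [m₀] * sweepBraid c z₀ := by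
    have hlt : ∀ᶠ p in 𝓝 z₀, ∀ m ∈ negTriples c z₀, chartDiff c p m.1 < chartDiff c p m₀.1 :=
      (Filter.eventually_all_finset _).mpr fun m hm =>
        (continuousAt_chartDiff hz₀ m.1).eventually_lt (continuousAt_chartDiff hz₀ m₀.1)
          (by rw [hm₀]; exact mem_negTriples.mp hm)
    filter_upwards [eventually_sweepBraid hz₀, mem_nhdsWithin_of_mem_nhds hlt,
      self_mem_nhdsWithin] with p h1 h2 hp
    have : sweepWord c (insert m₀ (negTriples c z₀)) p =
        m₀ :: sweepWord c (negTriples c z₀) p := by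
      refine List.Perm.eq_of_pairwise (fun a b _ _ h h' => absurd h (lt_asymm h'))
        (pairwise_sweepWord _ hp) ?_ ?_
      · exact List.pairwise_cons.mpr ⟨fun m hm => h2 m (mem_sweepWord.mp hm),
          pairwise_sweepWord _ hp⟩
      · refine (sweepWord_perm _ _ _).trans ((Finset.toList_insert hnot).trans ?_)
        exact (sweepWord_perm _ _ _).symm.cons m₀
    rw [this, freeBraid_cons, h1]
  filter_upwards [eventually_sweepBraid_eq_of_eventually hz₀ hev] with z hz h
  exact hz (by ext m; rw [h m, Finset.mem_insert])

end Sweep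

/-! ### Collinearity -/

section Collinearity

variable {n : ℕ}

theorem exists_eq_triple (m : MultiIndex n 3) :
    ∃ i j l : Fin n, i ≠ j ∧ i ≠ l ∧ j ≠ l ∧ m.1 = {i, j, l} := by
  obtain ⟨i, j, l, h1, h2, h3, h⟩ := Finset.card_eq_three.mp m.2
  exact ⟨i, j, l, h1, h2, h3, h⟩

theorem collinearOn_triple_iff {z : Fin n → Plane} {i j l : Fin n} (hij : z i ≠ z j) :
    CollinearOn z {i, j, l} ↔ signedArea (z i) (z j) (z l) = 0 := by
  have himg : z '' (({i, j, l} : Finset (Fin n)) : Set (Fin n)) = {z i, z j, z l} := by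
    simp [Set.image_insert_eq]
  rw [CollinearOn, himg, collinear_iff_of_mem (p₀ := z i) (by simp)]
  constructor
  · rintro ⟨v, hv⟩
    obtain ⟨a, ha⟩ := hv (z j) (by simp)
    obtain ⟨b, hb⟩ := hv (z l) (by simp)
    rw [ha, hb, signedArea]
    simp
    ring
  · intro h
    simp only [signedArea] at h
    refine ⟨z j - z i, ?_⟩
    have hex : ∃ r : ℝ, z l = r • (z j - z i) +ᵥ z i := by
      have hne : z j 0 - z i 0 ≠ 0 ∨ z j 1 - z i 1 ≠ 0 := by
        by_contra hc
        push Not at hc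
        apply hij
        ext a
        fin_cases a
        · exact (sub_eq_zero.mp hc.1).symm
        · exact (sub_eq_zero.mp hc.2).symm
      rcases hne with h0 | h0
      · refine ⟨(z l 0 - z i 0) / (z j 0 - z i 0), ?_⟩
        ext a
        fin_cases a
        · simp; field_simp; ring
        · simp; field_simp; linarith
      · refine ⟨(z l 1 - z i 1) / (z j 1 - z i 1), ?_⟩
        ext a
        fin_cases a
        · simp; field_simp; linarith
        · simp; field_simp; ring
    simp only [Set.mem_insert_iff, Set.mem_singleton_iff, forall_eq_or_imp, forall_eq]
    exact ⟨⟨0, by simp⟩, ⟨1, by simp⟩, hex⟩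

theorem isGoodProperty_collinearOn {z : Fin n → Plane} (hz : Function.Injective z) :
    IsGoodProperty 3 (CollinearOn z) where
  subset s t hts hs := Collinear.subset (Set.image_mono (by exact_mod_cast hts)) hs
  small s hs := by
    obtain ⟨i, j, -, rfl⟩ := Finset.card_eq_two.mp (show s.card = 2 by omega)
    rw [CollinearOn]
    simpa [Set.image_insert_eq] using collinear_pair ℝ (z i) (z j)
  glue i h h' := by
    have e1 : z '' ((Finset.univ.image fun j : Fin 3 => i j.castSucc : Finset (Fin n)) :
        Set (Fin n)) = {z (i 0), z (i 1), z (i 2)} := by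
      simp [Fin.univ_succ, Set.image_insert_eq]
    have e2 : z '' ((Finset.univ.image fun j : Fin 3 => i j.succ : Finset (Fin n)) :
        Set (Fin n)) = {z (i 1), z (i 2), z (i 3)} := by
      simp [Fin.univ_succ, Set.image_insert_eq]
    have e3 : z '' ((Finset.univ.image i : Finset (Fin n)) : Set (Fin n)) =
        {z (i 0), z (i 3), z (i 1), z (i 2)} := by
      simp [Fin.univ_succ, Set.image_insert_eq]
      grind
    rw [CollinearOn, e1] at h
    rw [CollinearOn, e2] at h'
    rw [CollinearOn, e3]
    have hne : z (i 1) ≠ z (i 2) := fun h => by simpa using i.injective (hz h)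
    exact collinear_insert_insert_of_mem_affineSpan_pair
      (h.mem_affineSpan_of_mem_of_ne (by simp) (by simp) (by simp) hne)
      (h'.mem_affineSpan_of_mem_of_ne (by simp) (by simp) (by simp) hne)

/-- The signed area in terms of the divided difference and of the Vandermonde determinant of the
abscissas. -/
theorem signedArea_eq_chartDiff_mul {c : ℝ} {z : Fin n → Plane}
    (hz : Function.Injective (chartX c z)) {i j l : Fin n} (hij : i ≠ j) (hil : i ≠ l)
    (hjl : j ≠ l) :
    signedArea (z i) (z j) (z l) = chartDiff c z {i, j, l} *
      ((chartX c z j - chartX c z i) * (chartX c z l - chartX c z i) *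
        (chartX c z l - chartX c z j)) := by
  have h1 : chartX c z i - chartX c z j ≠ 0 := sub_ne_zero.mpr fun h => hij (hz h)
  have h2 : chartX c z i - chartX c z l ≠ 0 := sub_ne_zero.mpr fun h => hil (hz h)
  have h3 : chartX c z j - chartX c z l ≠ 0 := sub_ne_zero.mpr fun h => hjl (hz h)
  have e1 : ({i, j, l} : Finset (Fin n)).erase i = {j, l} := by ext a; simp; grind
  have e2 : ({i, j, l} : Finset (Fin n)).erase j = {i, l} := by ext a; simp; grind
  have e3 : ({i, j, l} : Finset (Fin n)).erase l = {i, j} := by ext a; simp; grind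
  have hd : chartDiff c z {i, j, l} =
      chartY z i / ((chartX c z i - chartX c z j) * (chartX c z i - chartX c z l)) +
      chartY z j / (-(chartX c z i - chartX c z j) * (chartX c z j - chartX c z l)) +
      chartY z l / ((chartX c z i - chartX c z l) * (chartX c z j - chartX c z l)) := by
    rw [chartDiff, dividedDifference, Finset.sum_insert (by simp [hij, hil]),
      Finset.sum_pair hjl, e1, e2, e3, Finset.prod_pair hjl, Finset.prod_pair hil,
      Finset.prod_pair hij, neg_sub, add_assoc]
    congr 3
    ring
  have hs : signedArea (z i) (z j) (z l) =
      -(chartX c z i - chartX c z j) * (chartY z l - chartY z i) +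
      (chartY z j - chartY z i) * (chartX c z i - chartX c z l) := by
    simp only [signedArea, chartX, chartY]
    ring
  rw [hd, hs]
  field_simp
  ring

theorem injective_of_injective_chartX {c : ℝ} {z : Fin n → Plane}
    (hz : Function.Injective (chartX c z)) : Function.Injective z :=
  fun i j h => hz (by simp [chartX, h])

theorem chartDiff_eq_zero_iff {c : ℝ} {z : Fin n → Plane}
    (hz : Function.Injective (chartX c z)) (m : MultiIndex n 3) :
    chartDiff c z m.1 = 0 ↔ CollinearOn z m.1 := by
  obtain ⟨i, j, l, hij, hil, hjl, hm⟩ := exists_eq_triple m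
  rw [hm, collinearOn_triple_iff fun h => hij (injective_of_injective_chartX hz h),
    signedArea_eq_chartDiff_mul hz hij hil hjl, mul_eq_zero]
  have h1 : chartX c z j - chartX c z i ≠ 0 := sub_ne_zero.mpr fun h => hij (hz h).symm
  have h2 : chartX c z l - chartX c z i ≠ 0 := sub_ne_zero.mpr fun h => hil (hz h).symm
  have h3 : chartX c z l - chartX c z j ≠ 0 := sub_ne_zero.mpr fun h => hjl (hz h).symm
  simp [h1, h2, h3]

theorem noThreeCollinear_of_mem_chartGeneric {c : ℝ} {z : Fin n → Plane}
    (hz : z ∈ chartGeneric c) : NoThreeCollinear z := by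
  intro m hm
  rw [← chartDiff_eq_zero_iff hz.1, ← dividedDifference_empty (chartX c z) (chartY z)] at hm
  have := congrArg Finset.card (hz.2 hm)
  rw [m.2] at this
  simp at this

theorem nhdsWithin_noThreeCollinear_neBot (z : Fin n → Plane) :
    (𝓝[{p | NoThreeCollinear p}] z).NeBot :=
  (nhdsWithin_chartGeneric_neBot 0 z).mono
    (nhdsWithin_mono z fun _ h => noThreeCollinear_of_mem_chartGeneric h)

theorem exists_injective_chartX {z : Fin n → Plane} (hz : Function.Injective z) :
    ∃ c, Function.Injective (chartX c z) := by
  have : ∀ p : {p : Fin n × Fin n // p.1 ≠ p.2}, ∀ᶠ c in 𝓝[≠] (0 : ℝ),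
      chartX c z p.1.1 ≠ chartX c z p.1.2 := by
    rintro ⟨⟨i, j⟩, hij⟩
    by_cases h1 : z i 1 - z j 1 = 0
    · refine Filter.Eventually.of_forall fun c hc => hij (hz ?_)
      simp only [chartX] at hc
      ext a
      fin_cases a
      · simp only [Fin.zero_eta]
        linear_combination hc - c * h1
      · exact sub_eq_zero.mp h1
    · filter_upwards [eventually_add_mul_ne_zero (z i 0 - z j 0) h1] with c hc h
      simp only [chartX] at h
      exact hc (by linear_combination h)
  obtain ⟨c, hc⟩ := (Filter.eventually_all.mpr this).exists
  exact ⟨c, fun i j h => by_contra fun hij => hc ⟨(i, j), hij⟩ h⟩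

end Collinearity

/-! ### Local behaviour of the sweep braid -/

section SweepBraid

variable {n : ℕ} {c : ℝ} {z₀ : Fin n → Plane}

theorem eventually_mem_negTriples_iff (hz₀ : Function.Injective (chartX c z₀)) :
    ∀ᶠ z in 𝓝 z₀, ∀ m : MultiIndex n 3, chartDiff c z₀ m.1 ≠ 0 →
      (m ∈ negTriples c z ↔ m ∈ negTriples c z₀) := by
  refine Filter.eventually_all.mpr fun m => ?_
  rcases lt_trichotomy (chartDiff c z₀ m.1) 0 with h | h | h
  · filter_upwards [(continuousAt_chartDiff hz₀ m.1).eventually_lt continuousAt_const h]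
      with z hz _
    exact ⟨fun _ => mem_negTriples.mpr h, fun _ => mem_negTriples.mpr hz⟩
  · exact Filter.Eventually.of_forall fun z h' => absurd h h'
  · filter_upwards [continuousAt_const.eventually_lt (continuousAt_chartDiff hz₀ m.1) h]
      with z hz _
    exact ⟨fun h' => absurd (mem_negTriples.mp h') hz.not_gt,
      fun h' => absurd (mem_negTriples.mp h') h.not_gt⟩

theorem eventually_sweepBraid_eq_of_noThreeCollinear (hz₀ : Function.Injective (chartX c z₀))
    (h : NoThreeCollinear z₀) : ∀ᶠ z in 𝓝 z₀, sweepBraid c z = sweepBraid c z₀ := by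
  filter_upwards [eventually_sweepBraid_eq hz₀, eventually_mem_negTriples_iff hz₀] with z h1 h2
  refine h1 (Finset.ext fun m => h2 m ?_)
  rw [Ne, chartDiff_eq_zero_iff hz₀]
  exact h m

/-- Near a configuration with one collinear triple, the sweep braid changes by the generator of
this triple when the divided difference becomes negative. -/
theorem eventually_sweepBraid_eq_of_unique (hz₀ : Function.Injective (chartX c z₀))
    {m₀ : MultiIndex n 3} (h₀ : CollinearOn z₀ m₀.1)
    (h : ∀ m : MultiIndex n 3, CollinearOn z₀ m.1 → m = m₀) :
    ∀ᶠ z in 𝓝 z₀, (chartDiff c z m₀.1 < 0 → sweepBraid c z = freeBraid [m₀] * sweepBraid c z₀) ∧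
      (0 < chartDiff c z m₀.1 → sweepBraid c z = sweepBraid c z₀) := by
  have hd₀ := (chartDiff_eq_zero_iff hz₀ m₀).mpr h₀
  have hnot : m₀ ∉ negTriples c z₀ := fun h => (mem_negTriples.mp h).ne hd₀
  filter_upwards [eventually_sweepBraid_eq hz₀, eventually_sweepBraid_eq_mul hz₀ hd₀,
    eventually_mem_negTriples_iff hz₀] with z h1 h2 h3
  have h3' : ∀ m, m ≠ m₀ → (m ∈ negTriples c z ↔ m ∈ negTriples c z₀) := fun m hm =>
    h3 m fun hd => hm (h m ((chartDiff_eq_zero_iff hz₀ m).mp hd))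
  constructor
  · intro hneg
    refine h2 fun m => ?_
    by_cases hm : m = m₀
    · subst hm
      simp [mem_negTriples.mpr hneg]
    · simp [hm, h3' m hm]
  · intro hpos
    refine h1 (Finset.ext fun m => ?_)
    by_cases hm : m = m₀
    · subst hm
      simp [hnot, mem_negTriples, hpos.le]
    · exact h3' m hm

/-- The sign of the divided difference of a triple is, locally, the sign of its signed area up to
a constant factor. -/
theorem exists_eventually_signedArea_eq_mul (hz₀ : Function.Injective (chartX c z₀)) {i j l : Fin n}
    (hij : i ≠ j) (hil : i ≠ l) (hjl : j ≠ l) :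
    (∀ᶠ z in 𝓝 z₀, ∃ V : ℝ, 0 < V ∧ signedArea (z i) (z j) (z l) = chartDiff c z {i, j, l} * V) ∨
    (∀ᶠ z in 𝓝 z₀, ∃ V : ℝ, V < 0 ∧
      signedArea (z i) (z j) (z l) = chartDiff c z {i, j, l} * V) := by
  let V : (Fin n → Plane) → ℝ := fun z => (chartX c z j - chartX c z i) *
    (chartX c z l - chartX c z i) * (chartX c z l - chartX c z j)
  have hV : Continuous V := by
    have := continuous_chartX (n := n) c
    exact (((this j).sub (this i)).mul ((this l).sub (this i))).mul ((this l).sub (this j))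
  have hV0 : V z₀ ≠ 0 :=
    mul_ne_zero (mul_ne_zero (sub_ne_zero.mpr fun h => hij (hz₀ h).symm)
      (sub_ne_zero.mpr fun h => hil (hz₀ h).symm)) (sub_ne_zero.mpr fun h => hjl (hz₀ h).symm)
  rcases lt_or_gt_of_ne hV0 with h | h
  · right
    filter_upwards [hV.continuousAt.eventually_lt continuousAt_const h,
      (isOpen_injective_chartX c).mem_nhds hz₀] with z h1 h2
    exact ⟨V z, h1, signedArea_eq_chartDiff_mul h2 hij hil hjl⟩
  · left
    filter_upwards [continuousAt_const.eventually_lt hV.continuousAt h,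
      (isOpen_injective_chartX c).mem_nhds hz₀] with z h1 h2
    exact ⟨V z, h1, signedArea_eq_chartDiff_mul h2 hij hil hjl⟩

/-- Near a configuration in which only the triple `i, j, l` is collinear, the sweep braid takes one
value on each side of the wall, and the two values differ by the generator of the triple. -/
theorem exists_eventually_sweepBraid_eq_of_unique (hz₀ : Function.Injective (chartX c z₀))
    {m₀ : MultiIndex n 3} {i j l : Fin n} (hm₀ : m₀.1 = {i, j, l}) (hij : i ≠ j) (hil : i ≠ l)
    (hjl : j ≠ l) (h₀ : CollinearOn z₀ m₀.1)
    (h : ∀ m : MultiIndex n 3, CollinearOn z₀ m.1 → m = m₀) :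
    ∃ g, ∀ᶠ z in 𝓝 z₀,
      (signedArea (z i) (z j) (z l) < 0 → sweepBraid c z = freeBraid [m₀] * g) ∧
      (0 < signedArea (z i) (z j) (z l) → sweepBraid c z = g) := by
  have key := eventually_sweepBraid_eq_of_unique hz₀ h₀ h
  rw [hm₀] at key
  rcases exists_eventually_signedArea_eq_mul hz₀ hij hil hjl with hV | hV
  · refine ⟨sweepBraid c z₀, ?_⟩
    filter_upwards [key, hV] with z h1 ⟨V, hV, h2⟩
    rw [h2]
    exact ⟨fun h => h1.1 (by_contra fun hc =>
        h.not_ge (mul_nonneg (not_lt.mp hc) hV.le)),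
      fun h => h1.2 (by_contra fun hc =>
        h.not_ge (mul_nonpos_of_nonpos_of_nonneg (not_lt.mp hc) hV.le))⟩
  · refine ⟨freeBraid [m₀] * sweepBraid c z₀, ?_⟩
    filter_upwards [key, hV] with z h1 ⟨V, hV, h2⟩
    rw [h2, ← mul_assoc, freeBraid_mul_self, one_mul]
    exact ⟨fun h => h1.2 (by_contra fun hc =>
        h.not_ge (mul_nonneg_of_nonpos_of_nonpos (not_lt.mp hc) hV.le)),
      fun h => h1.1 (by_contra fun hc =>
        h.not_ge (mul_nonpos_of_nonneg_of_nonpos (not_lt.mp hc) hV.le))⟩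

end SweepBraid

/-! ### Polynomial motions in general position -/

section PolynomialMotion

open Polynomial

variable {n : ℕ}

/-- The positions at the time `t` of points whose coordinates are polynomials in the time. -/
noncomputable def polyMotion (D : Fin n → Fin 2 → ℝ[X]) (t : ℝ) : Fin n → Plane :=
  fun i => !₂[(D i 0).eval t, (D i 1).eval t]

/-- The signed area of three points of a polynomial motion, as a polynomial in the time. -/
noncomputable def polyArea (D : Fin n → Fin 2 → ℝ[X]) (i j l : Fin n) : ℝ[X] :=
  (D j 0 - D i 0) * (D l 1 - D i 1) - (D j 1 - D i 1) * (D l 0 - D i 0)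

/-- The polynomial motion in which the points are displaced by `t (1 - t) w`. -/
noncomputable def perturb (D : Fin n → Fin 2 → ℝ[X]) (w : Fin n → Plane) : Fin n → Fin 2 → ℝ[X] :=
  fun i a => D i a + X * (1 - X) * C (w i a)

/-- A polynomial motion on `[0, 1]` whose signed areas have only simple zeros, and in which no
two triples become collinear at the same time. -/
def IsTransverse (D : Fin n → Fin 2 → ℝ[X]) : Prop :=
  ∀ t ∈ Set.Icc (0 : ℝ) 1,
    (∀ i j l : Fin n, i ≠ j → i ≠ l → j ≠ l → (polyArea D i j l).eval t = 0 →
      (derivative (polyArea D i j l)).eval t ≠ 0) ∧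
    ∀ i j l i' j' l' : Fin n, i ≠ j → i ≠ l → j ≠ l → i' ≠ j' → i' ≠ l' → j' ≠ l' →
      i ≠ i' → i ≠ j' → i ≠ l' → (polyArea D i j l).eval t = 0 →
      (polyArea D i' j' l').eval t ≠ 0

theorem eval_polyArea (D : Fin n → Fin 2 → ℝ[X]) (i j l : Fin n) (t : ℝ) :
    (polyArea D i j l).eval t =
      signedArea (polyMotion D t i) (polyMotion D t j) (polyMotion D t l) := by
  simp [polyArea, polyMotion, signedArea]

theorem polyMotion_perturb (D : Fin n → Fin 2 → ℝ[X]) (w : Fin n → Plane) (t : ℝ) :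
    polyMotion (perturb D w) t = polyMotion D t + (t * (1 - t)) • w := by
  ext i a
  fin_cases a <;> simp [polyMotion, perturb]

theorem continuous_polyMotion (D : Fin n → Fin 2 → ℝ[X]) : Continuous (polyMotion D) := by
  unfold polyMotion
  refine continuous_pi fun i => ?_
  fun_prop

theorem continuous_polyMotion_perturb (D : Fin n → Fin 2 → ℝ[X]) :
    Continuous fun a : (Fin n → Plane) × ℝ => polyMotion (perturb D a.1) a.2 := by
  simp only [polyMotion_perturb]
  have := (continuous_polyMotion D).comp (continuous_snd (X := Fin n → Plane))
  exact this.add (by fun_prop)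

theorem continuous_eval_polyArea_perturb (D : Fin n → Fin 2 → ℝ[X]) (i j l : Fin n) :
    Continuous fun a : (Fin n → Plane) × ℝ => (polyArea (perturb D a.1) i j l).eval a.2 := by
  simp only [polyArea, perturb, eval_sub, eval_mul, eval_add, eval_X, eval_one, eval_C]
  fun_prop

theorem continuous_eval_derivative_polyArea_perturb (D : Fin n → Fin 2 → ℝ[X]) (i j l : Fin n) :
    Continuous fun a : (Fin n → Plane) × ℝ =>
      (derivative (polyArea (perturb D a.1) i j l)).eval a.2 := by
  simp only [polyArea, perturb, derivative_sub, derivative_mul, derivative_add, derivative_X,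
    derivative_one, derivative_C, eval_sub, eval_mul, eval_add, eval_X, eval_one, eval_C, eval_zero]
  fun_prop

/-- The effect on the signed area of moving the first point. -/
theorem polyArea_perturb_add_single (D : Fin n → Fin 2 → ℝ[X]) (w : Fin n → Plane) (v : Plane)
    {i j l : Fin n} (hij : i ≠ j) (hil : i ≠ l) :
    polyArea (perturb D (w + Pi.single i v)) i j l = polyArea (perturb D w) i j l +
      X * (1 - X) * (C (v 0) * (perturb D w j 1 - perturb D w l 1) -
        C (v 1) * (perturb D w j 0 - perturb D w l 0)) := by
  simp only [polyArea, perturb, Pi.add_apply, PiLp.add_apply, Pi.single_eq_same,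
    Pi.single_eq_of_ne hij.symm, Pi.single_eq_of_ne hil.symm, PiLp.zero_apply, map_add, map_zero]
  ring

theorem polyArea_perturb_add_single_of_ne (D : Fin n → Fin 2 → ℝ[X]) (w : Fin n → Plane)
    (v : Plane) {i i' j l : Fin n} (hi : i' ≠ i) (hij : i' ≠ j) (hil : i' ≠ l) :
    polyArea (perturb D (w + Pi.single i' v)) i j l = polyArea (perturb D w) i j l := by
  simp [polyArea, perturb, Pi.single_eq_of_ne hi.symm, Pi.single_eq_of_ne hij.symm,
    Pi.single_eq_of_ne hil.symm]

theorem mem_closure_of_eventually_add_single {A : Set (Fin n → Plane)} {w : Fin n → Plane}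
    (i : Fin n) {v : ℝ → Plane} (hv : ContinuousAt v 0) (hv0 : v 0 = 0)
    (h : ∀ᶠ e in 𝓝[≠] (0 : ℝ), w + Pi.single i (v e) ∈ A) : w ∈ closure A := by
  refine mem_closure_of_tendsto (f := fun e : ℝ => w + Pi.single i (v e)) (b := 𝓝[≠] 0) ?_ h
  have h1 : ContinuousAt (fun e : ℝ => w + Pi.single i (v e)) 0 := by
    refine continuousAt_const.add ?_
    exact (continuous_single i).continuousAt.comp hv
  have h2 := h1.tendsto
  simp only [hv0, Pi.single_zero, add_zero] at h2
  exact h2.mono_left nhdsWithin_le_nhds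

theorem eventually_add_mul_add_sq_mul_ne_zero (a : ℝ) {b d : ℝ} (h : b ≠ 0 ∨ d ≠ 0) :
    ∀ᶠ e in 𝓝[≠] (0 : ℝ), a + (e * b - e ^ 2 * d) ≠ 0 := by
  have hP : (C a + (X * C b - X ^ 2 * C d) : ℝ[X]) ≠ 0 := by
    intro h0
    have h1 := congrArg (fun P : ℝ[X] => P.coeff 1) h0
    have h2 := congrArg (fun P : ℝ[X] => P.coeff 2) h0
    simp [coeff_C, coeff_X_pow] at h1 h2
    tauto
  filter_upwards [eventually_eval_ne_zero hP 0] with e he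
  simpa only [eval_add, eval_sub, eval_mul, eval_pow, eval_X, eval_C] using he

variable {D : Fin n → Fin 2 → ℝ[X]} {w : Fin n → Plane}

theorem eval_polyArea_perturb_eq {t : ℝ} (ht : t * (1 - t) = 0) (i j l : Fin n) :
    (polyArea (perturb D w) i j l).eval t = (polyArea D i j l).eval t := by
  rw [eval_polyArea, eval_polyArea, polyMotion_perturb, ht, zero_smul, add_zero]

theorem polyMotion_ne_iff (D : Fin n → Fin 2 → ℝ[X]) (t : ℝ) (j l : Fin n) :
    polyMotion D t j ≠ polyMotion D t l ↔
      ((D j 1 - D l 1).eval t ≠ 0 ∨ (D j 0 - D l 0).eval t ≠ 0) := by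
  rw [← not_and_or, not_iff_not, PiLp.ext_iff, Fin.forall_fin_two]
  simp [polyMotion, sub_eq_zero, and_comm]

/-- Moving the point `i` along the curve `(e, e²)`, on which a nonzero linear function has no small
zeros except `e = 0`, destroys the collinearity of `i`, `j` and `l` at finitely many given moments. -/
theorem eventually_eval_polyArea_perturb_ne_zero {i j l : Fin n} (hij : i ≠ j) (hil : i ≠ l)
    (hjl : j ≠ l)
    (hend : ∀ t, t * (1 - t) = 0 → (polyArea D i j l).eval t ≠ 0)
    (hinj : ∀ t ∈ Set.Icc (0 : ℝ) 1, Function.Injective (polyMotion (perturb D w) t))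
    {Z : Set ℝ} (hZ : Z.Finite) :
    ∀ᶠ e in 𝓝[≠] (0 : ℝ), ∀ t ∈ Z, t ∈ Set.Icc (0 : ℝ) 1 →
      (polyArea (perturb D (w + Pi.single i !₂[e, e ^ 2])) i j l).eval t ≠ 0 := by
  refine (Filter.eventually_all_finite hZ).mpr fun t _ => ?_
  by_cases ht : t ∈ Set.Icc (0 : ℝ) 1
  swap
  · exact Filter.Eventually.of_forall fun e h => absurd h ht
  by_cases hs : t * (1 - t) = 0
  · refine Filter.Eventually.of_forall fun e _ => ?_
    rw [eval_polyArea_perturb_eq hs]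
    exact hend t hs
  · have hq := (polyMotion_ne_iff _ t j l).mp fun h => hjl (hinj t ht h)
    filter_upwards [eventually_add_mul_add_sq_mul_ne_zero
      ((polyArea (perturb D w) i j l).eval t)
      (hq.imp (mul_ne_zero hs) (mul_ne_zero hs))] with e he _
    rw [polyArea_perturb_add_single D w _ hij hil]
    convert he using 1
    simp only [eval_add, eval_mul, eval_sub, eval_X, eval_one, eval_C, Matrix.cons_val_zero,
      Matrix.cons_val_one, Matrix.cons_val_fin_one]
    ring

/-- A displacement of the point `i` does not affect a triple without `i`, so that the finitely many
moments at which this triple is collinear can be avoided. -/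
theorem mem_closure_noCommonZero {i j l i' j' l' : Fin n} (hij : i ≠ j) (hil : i ≠ l) (hjl : j ≠ l)
    (hii' : i ≠ i') (hij' : i ≠ j') (hil' : i ≠ l')
    (hend : ∀ t, t * (1 - t) = 0 → (polyArea D i j l).eval t ≠ 0)
    (hend' : ∀ t, t * (1 - t) = 0 → (polyArea D i' j' l').eval t ≠ 0)
    (hinj : ∀ t ∈ Set.Icc (0 : ℝ) 1, Function.Injective (polyMotion (perturb D w) t)) :
    w ∈ closure {w | ∀ t ∈ Set.Icc (0 : ℝ) 1, ¬ ((polyArea (perturb D w) i j l).eval t = 0 ∧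
      (polyArea (perturb D w) i' j' l').eval t = 0)} := by
  have hne : polyArea (perturb D w) i' j' l' ≠ 0 := by
    intro h
    have h0 := hend' 0 (by simp)
    rw [← eval_polyArea_perturb_eq (w := w) (by simp), h, eval_zero] at h0
    exact h0 rfl
  refine mem_closure_of_eventually_add_single i (v := fun e => !₂[e, e ^ 2]) (by fun_prop)
    (by ext a; fin_cases a <;> simp) ?_
  filter_upwards [eventually_eval_polyArea_perturb_ne_zero hij hil hjl hend hinj
    (finite_setOfPred_isRoot hne)] with e he t ht
  rintro ⟨h1, h2⟩
  rw [polyArea_perturb_add_single_of_ne D w _ hii' hij' hil'] at h2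
  exact he t h2 ht h1

/-- The first point is moved so that the signed area becomes `f + e K`, where `K` vanishes only
where `f` does not; a double zero then makes `-e` a critical value of the rational function
`f / K`, of which there are finitely many. -/
theorem mem_closure_noDoubleZero {i j l : Fin n} (hij : i ≠ j) (hil : i ≠ l) (hjl : j ≠ l)
    (hend : ∀ t, t * (1 - t) = 0 → (polyArea D i j l).eval t ≠ 0)
    (hinj : ∀ t ∈ Set.Icc (0 : ℝ) 1, Function.Injective (polyMotion (perturb D w) t)) :
    w ∈ closure {w | ∀ t ∈ Set.Icc (0 : ℝ) 1, ¬ ((polyArea (perturb D w) i j l).eval t = 0 ∧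
      (derivative (polyArea (perturb D w) i j l)).eval t = 0)} := by
  set A := {w | ∀ t ∈ Set.Icc (0 : ℝ) 1, ¬ ((polyArea (perturb D w) i j l).eval t = 0 ∧
      (derivative (polyArea (perturb D w) i j l)).eval t = 0)} with hA
  set q₀ := perturb D w j 0 - perturb D w l 0 with hq₀
  set q₁ := perturb D w j 1 - perturb D w l 1 with hq₁
  have hq := (polyMotion_ne_iff _ 0 j l).mp fun h => hjl (hinj 0 ⟨le_rfl, zero_le_one⟩ h)
  rw [← hq₀, ← hq₁] at hq
  -- the first step makes `f` nonzero at the zeros of `k`, the second displaces the point `i` by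
  -- multiples of the vector that corresponds to `K = t (1 - t) k`
  set k : ℝ[X] := C (q₁.eval 0) * q₁ - C (-q₀.eval 0) * q₀ with hk
  have hk0 : k.eval 0 ≠ 0 := by
    simp only [hk, eval_sub, eval_mul, eval_C]
    rcases hq with h | h
    · nlinarith [sq_nonneg (q₀.eval 0), sq_pos_of_ne_zero h]
    · nlinarith [sq_nonneg (q₁.eval 0), sq_pos_of_ne_zero h]
  have hkne : k ≠ 0 := by
    intro h; rw [h, eval_zero] at hk0; exact hk0 rfl
  rw [← closure_closure]
  refine mem_closure_of_eventually_add_single i (v := fun e => !₂[e, e ^ 2]) (by fun_prop)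
    (by ext a; fin_cases a <;> simp) ?_
  filter_upwards [eventually_eval_polyArea_perturb_ne_zero hij hil hjl hend hinj
    (finite_setOfPred_isRoot hkne)] with e he
  set w₁ := w + Pi.single i !₂[e, e ^ 2] with hw₁
  set f := polyArea (perturb D w₁) i j l with hf
  set K := X * (1 - X) * k with hK
  have hf0 : f.eval 0 ≠ 0 := by
    rw [hf, eval_polyArea_perturb_eq (by simp)]
    exact hend 0 (by simp)
  have hR : derivative f * K - f * derivative K ≠ 0 := by
    intro h
    have := congrArg (eval 0) h
    simp [hK, hf0, hk0] at this
  refine mem_closure_of_eventually_add_single i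
    (v := fun e => e • !₂[q₁.eval 0, -q₀.eval 0]) (by fun_prop) (by simp) ?_
  have hev : ∀ᶠ e' in 𝓝[≠] (0 : ℝ), ∀ t ∈ {t | (derivative f * K - f * derivative K).IsRoot t},
      K.eval t ≠ 0 → f.eval t + e' * K.eval t ≠ 0 := by
    refine (Filter.eventually_all_finite (finite_setOfPred_isRoot hR)).mpr fun t _ => ?_
    by_cases h : K.eval t = 0
    · exact Filter.Eventually.of_forall fun e' h' => absurd h h'
    · filter_upwards [eventually_add_mul_ne_zero (f.eval t) h] with e' he' _ using he'
  filter_upwards [hev] with e' he' t ht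
  have harea : polyArea (perturb D (w₁ + Pi.single i (e' • !₂[q₁.eval 0, -q₀.eval 0]))) i j l =
      f + C e' * K := by
    rw [polyArea_perturb_add_single D w₁ _ hij hil]
    have hsame : ∀ j', i ≠ j' → ∀ a, perturb D w₁ j' a = perturb D w j' a := by
      intro j' hj' a
      simp [perturb, hw₁, Pi.single_eq_of_ne hj'.symm]
    simp only [hsame j hij, hsame l hil, hK, hk, ← hq₀, ← hq₁, PiLp.smul_apply, smul_eq_mul,
      Matrix.cons_val_zero, Matrix.cons_val_one, Matrix.cons_val_fin_one, map_mul, map_neg]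
    ring
  rw [harea]
  simp only [derivative_add, derivative_C_mul, eval_add, eval_mul, eval_C]
  rintro ⟨h1, h2⟩
  have hKt : K.eval t ≠ 0 := by
    intro hK0
    rw [hK0, mul_zero, add_zero] at h1
    rw [hK, eval_mul, mul_eq_zero] at hK0
    rcases hK0 with hs | hz
    · rw [hf, eval_polyArea_perturb_eq (by simpa using hs)] at h1
      exact hend t (by simpa using hs) h1
    · exact he t hz ht h1
  refine he' t ?_ hKt h1
  change eval t _ = 0
  simp only [eval_sub, eval_mul]
  linear_combination eval t K * h2 - eval t (derivative K) * h1

theorem isOpen_forall_Icc_not_and {F G : (Fin n → Plane) × ℝ → ℝ} (hF : Continuous F)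
    (hG : Continuous G) :
    IsOpen {w : Fin n → Plane | ∀ t ∈ Set.Icc (0 : ℝ) 1, ¬ (F (w, t) = 0 ∧ G (w, t) = 0)} := by
  rw [isOpen_iff_mem_nhds]
  intro w hw
  refine isCompact_Icc.eventually_forall_of_forall_eventually fun t ht => ?_
  have hopen : IsOpen {a : (Fin n → Plane) × ℝ | ¬ (F a = 0 ∧ G a = 0)} := by
    have : IsClosed {a : (Fin n → Plane) × ℝ | F a = 0 ∧ G a = 0} :=
      (isClosed_eq hF continuous_const).inter (isClosed_eq hG continuous_const)
    exact this.isOpen_compl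
  exact hopen.mem_nhds (hw t ht)

theorem isOpen_forall_Icc_injective (D : Fin n → Fin 2 → ℝ[X]) :
    IsOpen {w : Fin n → Plane |
      ∀ t ∈ Set.Icc (0 : ℝ) 1, Function.Injective (polyMotion (perturb D w) t)} := by
  rw [isOpen_iff_mem_nhds]
  intro w hw
  refine isCompact_Icc.eventually_forall_of_forall_eventually fun t ht => ?_
  have : ∀ᶠ a : (Fin n → Plane) × ℝ in 𝓝 (w, t), ∀ i j : Fin n, i ≠ j →
      polyMotion (perturb D a.1) a.2 i ≠ polyMotion (perturb D a.1) a.2 j := by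
    refine Filter.eventually_all.mpr fun i => Filter.eventually_all.mpr fun j => ?_
    by_cases hij : i = j
    · exact Filter.Eventually.of_forall fun a h => absurd hij h
    have hc := continuous_polyMotion_perturb D
    filter_upwards [(isOpen_ne_fun ((continuous_apply i).comp hc)
      ((continuous_apply j).comp hc)).mem_nhds (fun h => hij (hw t ht h))] with a ha _ using ha
  filter_upwards [this] with a ha i j h
  by_contra hij
  exact ha i j hij h

theorem exists_mem_iInter_of_subset_closure {X ι : Type*} [TopologicalSpace X] [BaireSpace X]
    [Finite ι] {A : ι → Set X} (hA : ∀ c, IsOpen (A c)) {U : Set X} (hU : IsOpen U)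
    (hne : U.Nonempty) (hcl : ∀ c, U ⊆ closure (A c)) : ∃ x ∈ U, ∀ c, x ∈ A c := by
  have hd : Dense (⋂ c, (A c ∪ (closure U)ᶜ)) := by
    have := Finite.to_countable (α := ι)
    refine dense_iInter_of_isOpen (fun c => (hA c).union isClosed_closure.isOpen_compl) fun c => ?_
    intro x
    by_cases hx : x ∈ closure U
    · exact closure_mono Set.subset_union_left (closure_minimal (hcl c) isClosed_closure hx)
    · exact subset_closure (Or.inr hx)
  obtain ⟨x, hxU, hx⟩ := hd.inter_open_nonempty U hU hne
  exact ⟨x, hxU, fun c => ((Set.mem_iInter.mp hx c).resolve_right fun h => h (subset_closure hxU))⟩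

/-- A polynomial motion with terminal states in general position becomes transverse by an
arbitrarily small displacement that fixes the terminal states. -/
theorem exists_isTransverse_perturb (D : Fin n → Fin 2 → ℝ[X])
    (hend : ∀ t, t * (1 - t) = 0 → ∀ i j l : Fin n, i ≠ j → i ≠ l → j ≠ l →
      (polyArea D i j l).eval t ≠ 0)
    (hinj : ∀ t ∈ Set.Icc (0 : ℝ) 1, Function.Injective (polyMotion D t)) {ε : ℝ} (hε : 0 < ε) :
    ∃ w : Fin n → Plane, ‖w‖ < ε ∧
      (∀ t ∈ Set.Icc (0 : ℝ) 1, Function.Injective (polyMotion (perturb D w) t)) ∧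
      IsTransverse (perturb D w) := by
  let U : Set (Fin n → Plane) := {w |
      ∀ t ∈ Set.Icc (0 : ℝ) 1, Function.Injective (polyMotion (perturb D w) t)} ∩ Metric.ball 0 ε
  have hU : IsOpen U := (isOpen_forall_Icc_injective D).inter Metric.isOpen_ball
  have hne : U.Nonempty := by
    refine ⟨0, fun t ht => ?_, Metric.mem_ball_self hε⟩
    rw [polyMotion_perturb, smul_zero, add_zero]
    exact hinj t ht
  let I₁ := {p : Fin n × Fin n × Fin n // p.1 ≠ p.2.1 ∧ p.1 ≠ p.2.2 ∧ p.2.1 ≠ p.2.2}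
  let I₂ := {p : I₁ × I₁ // p.1.1.1 ≠ p.2.1.1 ∧ p.1.1.1 ≠ p.2.1.2.1 ∧ p.1.1.1 ≠ p.2.1.2.2}
  let A : I₁ ⊕ I₂ → Set (Fin n → Plane) := Sum.elim
    (fun p => {w | ∀ t ∈ Set.Icc (0 : ℝ) 1,
      ¬ ((polyArea (perturb D w) p.1.1 p.1.2.1 p.1.2.2).eval t = 0 ∧
        (derivative (polyArea (perturb D w) p.1.1 p.1.2.1 p.1.2.2)).eval t = 0)})
    (fun p => {w | ∀ t ∈ Set.Icc (0 : ℝ) 1,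
      ¬ ((polyArea (perturb D w) p.1.1.1.1 p.1.1.1.2.1 p.1.1.1.2.2).eval t = 0 ∧
        (polyArea (perturb D w) p.1.2.1.1 p.1.2.1.2.1 p.1.2.1.2.2).eval t = 0)})
  have hA : ∀ c, IsOpen (A c) := by
    rintro (p | p)
    · exact isOpen_forall_Icc_not_and (continuous_eval_polyArea_perturb D _ _ _)
        (continuous_eval_derivative_polyArea_perturb D _ _ _)
    · exact isOpen_forall_Icc_not_and (continuous_eval_polyArea_perturb D _ _ _)
        (continuous_eval_polyArea_perturb D _ _ _)
  have hcl : ∀ c, U ⊆ closure (A c) := by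
    rintro (⟨⟨i, j, l⟩, h1, h2, h3⟩ | ⟨⟨⟨⟨i, j, l⟩, h1, h2, h3⟩, ⟨⟨i', j', l'⟩, h4, h5, h6⟩⟩, h7,
        h8, h9⟩)
      w hw
    · exact mem_closure_noDoubleZero h1 h2 h3 (fun t ht => hend t ht i j l h1 h2 h3) hw.1
    · exact mem_closure_noCommonZero h1 h2 h3 h7 h8 h9 (fun t ht => hend t ht i j l h1 h2 h3)
        (fun t ht => hend t ht i' j' l' h4 h5 h6) hw.1
  obtain ⟨w, hwU, hw⟩ := exists_mem_iInter_of_subset_closure hA hU hne hcl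
  refine ⟨w, by simpa using hwU.2, hwU.1, fun t ht => ⟨?_, ?_⟩⟩
  · intro i j l h1 h2 h3 h0 h0'
    exact hw (Sum.inl ⟨(i, j, l), h1, h2, h3⟩) t ht ⟨h0, h0'⟩
  · intro i j l i' j' l' h1 h2 h3 h4 h5 h6 h7 h8 h9 h0 h0'
    exact hw (Sum.inr ⟨(⟨(i, j, l), h1, h2, h3⟩, ⟨(i', j', l'), h4, h5, h6⟩), h7, h8, h9⟩) t ht
      ⟨h0, h0'⟩

end PolynomialMotion

section PolynomialMotion

open Polynomial

variable {n : ℕ} {D : Fin n → Fin 2 → ℝ[X]} {t : ℝ}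

theorem exists_eq_triple_of_mem {m : MultiIndex n 3} {i : Fin n} (hi : i ∈ m.1) :
    ∃ j l : Fin n, i ≠ j ∧ i ≠ l ∧ j ≠ l ∧ m.1 = {i, j, l} := by
  obtain ⟨j, l, hjl, h⟩ := Finset.card_eq_two.mp
    (show (m.1.erase i).card = 2 by rw [Finset.card_erase_of_mem hi, m.2])
  have hj : j ∈ m.1.erase i := by rw [h]; simp
  have hl : l ∈ m.1.erase i := by rw [h]; simp
  exact ⟨j, l, (Finset.ne_of_mem_erase hj).symm, (Finset.ne_of_mem_erase hl).symm, hjl, by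
    rw [← h, Finset.insert_erase hi]⟩

theorem collinearOn_polyMotion_iff (hinj : Function.Injective (polyMotion D t)) {i j l : Fin n}
    (hij : i ≠ j) :
    CollinearOn (polyMotion D t) {i, j, l} ↔ (polyArea D i j l).eval t = 0 := by
  rw [collinearOn_triple_iff fun h => hij (hinj h), eval_polyArea]

theorem noThreeCollinear_iff {z : Fin n → Plane} (hz : Function.Injective z) :
    NoThreeCollinear z ↔ ∀ i j l : Fin n, i ≠ j → i ≠ l → j ≠ l →
      signedArea (z i) (z j) (z l) ≠ 0 := by
  constructor
  · intro h i j l hij hil hjl h0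
    refine h ⟨{i, j, l}, Finset.card_eq_three.mpr ⟨i, j, l, hij, hil, hjl, rfl⟩⟩ ?_
    exact (collinearOn_triple_iff fun h => hij (hz h)).mpr h0
  · intro h m hm
    obtain ⟨i, j, l, hij, hil, hjl, hmi⟩ := exists_eq_triple m
    rw [hmi, collinearOn_triple_iff fun h => hij (hz h)] at hm
    exact h i j l hij hil hjl hm

theorem IsTransverse.eq_of_collinearOn (hD : IsTransverse D) (ht : t ∈ Set.Icc (0 : ℝ) 1)
    (hinj : Function.Injective (polyMotion D t)) {m m' : MultiIndex n 3}
    (hm : CollinearOn (polyMotion D t) m.1) (hm' : CollinearOn (polyMotion D t) m'.1) :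
    m = m' := by
  by_contra hne
  have hsub : ¬ m.1 ⊆ m'.1 := fun h =>
    hne (Subtype.ext (Finset.eq_of_subset_of_card_le h (by rw [m.2, m'.2])))
  obtain ⟨i, hi, hi'⟩ := Finset.not_subset.mp hsub
  obtain ⟨j, l, h1, h2, h3, hmi⟩ := exists_eq_triple_of_mem hi
  obtain ⟨i', j', l', h4, h5, h6, hmi'⟩ := exists_eq_triple m'
  rw [hmi'] at hi' hm'
  rw [hmi, collinearOn_polyMotion_iff hinj h1] at hm
  rw [collinearOn_polyMotion_iff hinj h4] at hm'
  simp only [Finset.mem_insert, Finset.mem_singleton, not_or] at hi'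
  exact (hD t ht).2 i j l i' j' l' h1 h2 h3 h4 h5 h6 hi'.1 hi'.2.1 hi'.2.2 hm hm'

/-- The rectilinear motion from `p` to `q`. -/
noncomputable def linearMotion (p q : Fin n → Plane) : Fin n → Fin 2 → ℝ[X] :=
  fun i a => C (p i a) + X * C (q i a - p i a)

theorem polyMotion_linearMotion (p q : Fin n → Plane) (t : ℝ) :
    polyMotion (linearMotion p q) t = p + t • (q - p) := by
  ext i a
  fin_cases a <;> simp [polyMotion, linearMotion]

end PolynomialMotion

/-! ### The transition functions between charts -/

section Transition

variable {n : ℕ}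

/-- Near a configuration of distinct points, a function on the configurations in general position is
constant if it is locally constant at the neighbouring configurations with at most one collinear
triple: any two configurations in general position are joined by a motion through such
configurations. -/
theorem exists_eventually_eq_of_forall_unique {G : Type*} {φ : (Fin n → Plane) → G}
    {z : Fin n → Plane} {U : Set (Fin n → Plane)} (hU : U ∈ 𝓝 z)
    (hinj : ∀ p ∈ U, Function.Injective p)
    (hφ : ∀ p ∈ U, (∀ m m' : MultiIndex n 3, CollinearOn p m.1 → CollinearOn p m'.1 → m = m') →
      ∃ g, ∀ᶠ q in 𝓝[{q | NoThreeCollinear q}] p, φ q = g) :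
    ∃ g, ∀ᶠ q in 𝓝[{q | NoThreeCollinear q}] z, φ q = g := by
  obtain ⟨ρ, hρ, hρU⟩ := Metric.mem_nhds_iff.mp hU
  have hball : Metric.ball z (ρ / 2) ∈ 𝓝 z := Metric.ball_mem_nhds z (half_pos hρ)
  have := nhdsWithin_noThreeCollinear_neBot z
  have hev : ∀ᶠ q in 𝓝[{q | NoThreeCollinear q}] z,
      q ∈ Metric.ball z (ρ / 2) ∧ NoThreeCollinear q := by
    filter_upwards [mem_nhdsWithin_of_mem_nhds hball, self_mem_nhdsWithin] with q h1 h2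
      using ⟨h1, h2⟩
  obtain ⟨p, hp, hpg⟩ := hev.exists
  refine ⟨φ p, ?_⟩
  filter_upwards [hev] with q ⟨hq, hqg⟩
  -- a transverse motion from `p` to `q` inside the ball
  set D := linearMotion p q with hD
  have hseg : ∀ t ∈ Set.Icc (0 : ℝ) 1, polyMotion D t ∈ Metric.ball z (ρ / 2) := by
    intro t ht
    rw [hD, polyMotion_linearMotion]
    exact (convex_ball z (ρ / 2)).add_smul_sub_mem hp hq ht
  have hsub : Metric.ball z (ρ / 2) ⊆ U :=
    (Metric.ball_subset_ball (half_le_self hρ.le)).trans hρU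
  have h0 : polyMotion D 0 = p := by simp [hD, polyMotion_linearMotion]
  have h1 : polyMotion D 1 = q := by simp [hD, polyMotion_linearMotion]
  obtain ⟨w, hw, hwinj, hwt⟩ := exists_isTransverse_perturb D (by
    intro t ht i j l hij hil hjl
    rw [eval_polyArea]
    rcases mul_eq_zero.mp ht with rfl | ht
    · rw [h0]
      exact (noThreeCollinear_iff (hinj p (hsub hp))).mp hpg i j l hij hil hjl
    · obtain rfl : t = 1 := by linarith
      rw [h1]
      exact (noThreeCollinear_iff (hinj q (hsub hq))).mp hqg i j l hij hil hjl)
    (fun t ht => hinj _ (hsub (hseg t ht))) (half_pos hρ)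
  have hmem : ∀ t ∈ Set.Icc (0 : ℝ) 1, polyMotion (perturb D w) t ∈ U := by
    intro t ht
    apply hρU
    have hst := hseg t ht
    rw [polyMotion_perturb]
    rw [Metric.mem_ball, dist_eq_norm] at hst ⊢
    have hle : ‖(t * (1 - t)) • w‖ ≤ ‖w‖ := by
      rw [norm_smul, Real.norm_eq_abs, abs_of_nonneg (mul_nonneg ht.1 (by linarith [ht.2]))]
      have : t * (1 - t) ≤ 1 := by nlinarith [ht.1, ht.2]
      exact mul_le_of_le_one_left (norm_nonneg w) this
    calc ‖polyMotion D t + (t * (1 - t)) • w - z‖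
        = ‖(polyMotion D t - z) + (t * (1 - t)) • w‖ := by congr 1; abel
      _ ≤ ‖polyMotion D t - z‖ + ‖(t * (1 - t)) • w‖ := norm_add_le _ _
      _ < ρ := by linarith
  have hpath : IsPreconnected (polyMotion (perturb D w) '' Set.Icc 0 1) :=
    isPreconnected_Icc.image _ (continuous_polyMotion _).continuousOn
  obtain ⟨g, hg⟩ := hpath.exists_eventually_eq (f := φ) (V := {q | NoThreeCollinear q})
    (fun r _ => nhdsWithin_noThreeCollinear_neBot r)
    ⟨_, Set.mem_image_of_mem _ ⟨le_rfl, zero_le_one⟩⟩ (by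
      rintro _ ⟨t, ht, rfl⟩
      exact hφ _ (hmem t ht) fun m m' hm hm' => hwt.eq_of_collinearOn ht (hwinj t ht) hm hm')
  have e0 : polyMotion (perturb D w) 0 = p := by rw [polyMotion_perturb, h0]; simp
  have e1 : polyMotion (perturb D w) 1 = q := by rw [polyMotion_perturb, h1]; simp
  have hgp := (hg p ⟨0, ⟨le_rfl, zero_le_one⟩, e0⟩).self_of_nhdsWithin hpg
  have hgq := (hg q ⟨1, ⟨zero_le_one, le_rfl⟩, e1⟩).self_of_nhdsWithin hqg
  rw [hgp, hgq]

/-- The quotient of the sweep braids in two charts is locally constant: crossing a wall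
multiplies both by the same generator. -/
theorem exists_eventually_sweepBraid_inv_mul {c c' : ℝ} {z : Fin n → Plane}
    (hz : Function.Injective (chartX c z)) (hz' : Function.Injective (chartX c' z)) :
    ∃ g, ∀ᶠ q in 𝓝[{q | NoThreeCollinear q}] z, (sweepBraid c' q)⁻¹ * sweepBraid c q = g := by
  refine exists_eventually_eq_of_forall_unique
    (Filter.inter_mem ((isOpen_injective_chartX c).mem_nhds hz)
      ((isOpen_injective_chartX c').mem_nhds hz'))
    (fun p hp => injective_of_injective_chartX hp.1) ?_
  rintro p ⟨hp, hp'⟩ huniq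
  by_cases hgen : NoThreeCollinear p
  · refine ⟨(sweepBraid c' p)⁻¹ * sweepBraid c p, Filter.Eventually.filter_mono nhdsWithin_le_nhds
        ?_⟩
    filter_upwards [eventually_sweepBraid_eq_of_noThreeCollinear hp hgen,
      eventually_sweepBraid_eq_of_noThreeCollinear hp' hgen] with q h1 h2
    rw [h1, h2]
  · simp only [NoThreeCollinear, not_forall, not_not] at hgen
    obtain ⟨m₀, hm₀⟩ := hgen
    obtain ⟨i, j, l, hij, hil, hjl, hm⟩ := exists_eq_triple m₀
    obtain ⟨g, hg⟩ := exists_eventually_sweepBraid_eq_of_unique hp hm hij hil hjl hm₀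
      fun m h => huniq m m₀ h hm₀
    obtain ⟨g', hg'⟩ := exists_eventually_sweepBraid_eq_of_unique hp' hm hij hil hjl hm₀
      fun m h => huniq m m₀ h hm₀
    refine ⟨g'⁻¹ * g, ?_⟩
    filter_upwards [self_mem_nhdsWithin, mem_nhdsWithin_of_mem_nhds hg,
      mem_nhdsWithin_of_mem_nhds hg',
      mem_nhdsWithin_of_mem_nhds ((isOpen_injective_chartX c).mem_nhds hp)] with q h0 h1 h2 h3
    have hne := (noThreeCollinear_iff (injective_of_injective_chartX h3)).mp h0 i j l hij hil hjl
    rcases lt_or_gt_of_ne hne with h | h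
    · rw [h1.1 h, h2.1 h]
      group
    · rw [h1.2 h, h2.2 h]

open Classical in
/-- The transition function from the chart `c` to the chart `c'`: the quotient of the sweep braids
at the configurations in general position near `z`. -/
noncomputable def transition (c c' : ℝ) (z : Fin n → Plane) : FreeBraidGroup n 3 :=
  if h : ∃ g, ∀ᶠ q in 𝓝[{q | NoThreeCollinear q}] z, (sweepBraid c' q)⁻¹ * sweepBraid c q = g
  then h.choose else 1

theorem eventually_transition {c c' : ℝ} {z : Fin n → Plane}
    (hz : Function.Injective (chartX c z)) (hz' : Function.Injective (chartX c' z)) :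
    ∀ᶠ q in 𝓝[{q | NoThreeCollinear q}] z,
      (sweepBraid c' q)⁻¹ * sweepBraid c q = transition c c' z := by
  have h := exists_eventually_sweepBraid_inv_mul hz hz'
  rw [transition, dif_pos h]
  exact h.choose_spec

theorem eventually_transition_eq {c c' : ℝ} {z : Fin n → Plane}
    (hz : Function.Injective (chartX c z)) (hz' : Function.Injective (chartX c' z)) :
    ∀ᶠ z' in 𝓝 z, transition c c' z' = transition c c' z := by
  filter_upwards [eventually_nhds_nhdsWithin.mpr (eventually_transition hz hz'),
    (isOpen_injective_chartX c).mem_nhds hz, (isOpen_injective_chartX c').mem_nhds hz']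
    with z' h1 h2 h3
  have := nhdsWithin_noThreeCollinear_neBot z'
  obtain ⟨q, hq1, hq2⟩ := (h1.and (eventually_transition h2 h3)).exists
  exact hq2.symm.trans hq1

theorem transition_eq_of_noThreeCollinear {c c' : ℝ} {z : Fin n → Plane}
    (hz : Function.Injective (chartX c z)) (hz' : Function.Injective (chartX c' z))
    (h : NoThreeCollinear z) : transition c c' z = (sweepBraid c' z)⁻¹ * sweepBraid c z :=
  ((eventually_transition hz hz').self_of_nhdsWithin h).symm

theorem transition_self {c : ℝ} {z : Fin n → Plane} (hz : Function.Injective (chartX c z)) :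
    transition c c z = 1 := by
  have := nhdsWithin_noThreeCollinear_neBot z
  obtain ⟨q, hq⟩ := (eventually_transition hz hz).exists
  rw [← hq, inv_mul_cancel]

theorem transition_mul {c c' c'' : ℝ} {z : Fin n → Plane}
    (hz : Function.Injective (chartX c z)) (hz' : Function.Injective (chartX c' z))
    (hz'' : Function.Injective (chartX c'' z)) :
    transition c' c'' z * transition c c' z = transition c c'' z := by
  have := nhdsWithin_noThreeCollinear_neBot z
  obtain ⟨q, h1, h2, h3⟩ := ((eventually_transition hz hz').and ((eventually_transition hz'
      hz'').and
    (eventually_transition hz hz''))).exists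
  rw [← h1, ← h2, ← h3]
  group

end Transition

/-! ### The covering of the configuration space -/

section Covering

variable {n : ℕ}

/-- The group of free braids is used as a discrete space, the fibre of a covering. -/
instance FreeBraidGroup.instTopologicalSpace (n k : ℕ) : TopologicalSpace (FreeBraidGroup n k) := ⊥

instance FreeBraidGroup.instDiscreteTopology (n k : ℕ) : DiscreteTopology (FreeBraidGroup n k) :=
  ⟨rfl⟩

/-- The covering of the configuration space with fibre `G_n^3` whose transition functions are the
quotients of the sweep braids of the charts. -/
noncomputable def braidBundle (n : ℕ) : FiberBundleCore ℝ (Config n) (FreeBraidGroup n 3) where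
  baseSet c := {z | Function.Injective (chartX c z.1)}
  isOpen_baseSet c := (isOpen_injective_chartX c).preimage continuous_subtype_val
  indexAt z := (exists_injective_chartX z.2).choose
  mem_baseSet_at z := (exists_injective_chartX z.2).choose_spec
  coordChange c c' z g := transition c c' z.1 * g
  coordChange_self c z hz g := by
    rw [transition_self hz, one_mul]
  continuousOn_coordChange c c' := by
    rintro ⟨z, g⟩ ⟨⟨hz, hz'⟩, -⟩
    refine ContinuousAt.continuousWithinAt ?_
    have h1 : ContinuousAt (fun a : Config n × FreeBraidGroup n 3 =>
        (transition c c' z.1) * a.2) (z, g) :=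
      (continuous_of_discreteTopology (f := fun g => transition c c' z.1 * g)).continuousAt.comp
        continuousAt_snd
    refine h1.congr ?_
    have h2 : ∀ᶠ a : Config n × FreeBraidGroup n 3 in 𝓝 (z, g),
        transition c c' a.1.1 = transition c c' z.1 :=
      (continuous_subtype_val.comp continuous_fst).continuousAt.eventually
        (eventually_transition_eq hz hz')
    filter_upwards [h2] with a ha
    rw [ha]
  coordChange_comp c c' c'' z hz g := by
    rw [← mul_assoc, transition_mul hz.1.1 hz.1.2 hz.2]

theorem isCoveringMap_braidBundle (n : ℕ) :
    IsCoveringMap (Bundle.TotalSpace.proj : (braidBundle n).TotalSpace → Config n) :=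
  FiberBundle.isCoveringMap

/-- The coordinate of a point of the covering in the preferred chart. -/
def fiberCoord (e : (braidBundle n).TotalSpace) : FreeBraidGroup n 3 := e.snd

/-- The coordinate on the fibres of the covering over the configurations in general position, which
is independent of the chart; it jumps by a generator at the walls. -/
noncomputable def braidCoord (e : (braidBundle n).TotalSpace) : FreeBraidGroup n 3 :=
  sweepBraid ((braidBundle n).indexAt e.proj) e.proj.1 * fiberCoord e

theorem braidCoord_eq {c : ℝ} {e : (braidBundle n).TotalSpace}
    (hc : Function.Injective (chartX c e.proj.1)) (he : NoThreeCollinear e.proj.1) :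
    braidCoord e = sweepBraid c e.proj.1 * ((braidBundle n).localTriv c e).2 := by
  rw [FiberBundleCore.localTriv_apply]
  change _ = sweepBraid c e.proj.1 * (transition _ c e.proj.1 * fiberCoord e)
  rw [transition_eq_of_noThreeCollinear ((braidBundle n).mem_baseSet_at e.proj) hc he, braidCoord]
  group

theorem eventually_localTriv_eq {c : ℝ} {e : (braidBundle n).TotalSpace}
    (hc : Function.Injective (chartX c e.proj.1)) :
    ∀ᶠ e' in 𝓝 e, ((braidBundle n).localTriv c e').2 = ((braidBundle n).localTriv c e).2 := by
  have hsrc : e ∈ ((braidBundle n).localTriv c).source :=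
    ((braidBundle n).mem_localTriv_source c e).mpr hc
  have h1 : ContinuousAt (fun e' => ((braidBundle n).localTriv c e').2) e :=
    continuousAt_snd.comp (((braidBundle n).localTriv c).continuousOn.continuousAt
      (((braidBundle n).localTriv c).open_source.mem_nhds hsrc))
  exact h1.eventually ((isOpen_discrete {((braidBundle n).localTriv c e).2}).mem_nhds rfl)

/-- Along a lift of a pleasant stable motion, the canonical coordinate changes by the free braid of
the motion. -/
theorem braidCoord_eq_freeBraid_mul {x y : Config n} (hx : NoThreeCollinear x.1)
    (hy : NoThreeCollinear y.1) (γ : Path x y) (hγ : IsPleasant 3 (trisecant (motion γ)))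
    (hst : IsStable (motion γ)) (Γ : C(unitInterval, (braidBundle n).TotalSpace))
    (hΓ : ∀ t, (Γ t).proj = γ t) :
    braidCoord (Γ 0) = freeBraid (typeOf hγ) * braidCoord (Γ 1) := by
  obtain ⟨L, hs, hL, htype⟩ := hγ.exists_chronology
  have hreg : ∀ t, (∀ m, (t, m) ∉ L) ↔ NoThreeCollinear (γ t).1 := fun t =>
    forall_congr' fun m => not_congr (hL t m)
  have hfin : {t | ∀ m, (t, m) ∉ L}ᶜ.Finite := by
    refine hγ.1.subset fun t ht => ?_
    simp only [Set.mem_compl_iff, Set.mem_ofPred_eq, not_forall, not_not] at ht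
    obtain ⟨m, hm⟩ := ht
    exact ⟨m, (hL t m).mp hm⟩
  have hpunct : ∀ t, ∀ᶠ s in 𝓝[≠] t, NoThreeCollinear (γ s).1 := by
    intro t
    have : ({t | ∀ m, (t, m) ∉ L}ᶜ \ {t})ᶜ ∈ 𝓝 t :=
      (hfin.subset Set.sdiff_subset).isClosed.isOpen_compl.mem_nhds (by simp)
    filter_upwards [mem_nhdsWithin_of_mem_nhds this, self_mem_nhdsWithin] with s h1 h2
    by_contra hc
    exact h1 ⟨fun h => hc ((hreg s).mp h), h2⟩
  have hdense : ∀ t, (𝓝[{t | ∀ m, (t, m) ∉ L}] t).NeBot := by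
    intro t
    have h1 : 𝓝[≠] t ≤ 𝓝[{t | ∀ m, (t, m) ∉ L}] t := by
      refine nhdsWithin_le_iff.mpr ?_
      filter_upwards [hpunct t] with s h using (hreg s).mpr h
    exact Filter.NeBot.mono inferInstance h1
  have hγc : ∀ t, Filter.Tendsto (fun s => (γ s).1) (𝓝 t) (𝓝 (γ t).1) := fun t =>
    (continuous_subtype_val.comp γ.continuous).tendsto t
  -- the canonical coordinate in terms of a chart at `γ t`
  have hlocal : ∀ t c, Function.Injective (chartX c (γ t).1) →
      ∃ v, ∀ᶠ s in 𝓝 t, NoThreeCollinear (γ s).1 →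
        braidCoord (Γ s) = sweepBraid c (γ s).1 * v := by
    intro t c hc
    refine ⟨((braidBundle n).localTriv c (Γ t)).2, ?_⟩
    have h1 : ∀ᶠ s in 𝓝 t, ((braidBundle n).localTriv c (Γ s)).2 =
        ((braidBundle n).localTriv c (Γ t)).2 :=
      Γ.continuous.continuousAt.eventually (eventually_localTriv_eq (by rw [hΓ]; exact hc))
    filter_upwards [h1, (hγc t).eventually ((isOpen_injective_chartX c).mem_nhds hc)]
      with s h2 h3 h4
    rw [braidCoord_eq (c := c) (by rw [hΓ]; exact h3) (by rw [hΓ]; exact h4), h2, hΓ]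
  rw [htype]
  refine eq_freeBraid_mul_of_jumps hs hdense ?_ ?_ ?_ ?_ (f := fun t => braidCoord (Γ t))
  · intro t ht
    have hgen := (hreg t).mp ht
    obtain ⟨c, hc⟩ := exists_injective_chartX (γ t).2
    obtain ⟨v, hv⟩ := hlocal t c hc
    have hgen' : ∀ᶠ s in 𝓝 t, NoThreeCollinear (γ s).1 := by
      rw [← nhdsNE_sup_pure]
      exact Filter.eventually_sup.mpr ⟨hpunct t, Filter.eventually_pure.mpr hgen⟩
    filter_upwards [hv, hgen',
      (hγc t).eventually (eventually_sweepBraid_eq_of_noThreeCollinear hc hgen)] with s h1 h2 h3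
    rw [h1 h2, h3, hv.self_of_nhds hgen]
  · intro t m hm
    have hcol := (hL t m).mp hm
    obtain ⟨c, hc⟩ := exists_injective_chartX (γ t).2
    obtain ⟨v, hv⟩ := hlocal t c hc
    obtain ⟨i, j, l, hij, hil, hjl, hmi⟩ := exists_eq_triple m
    obtain ⟨g, hg⟩ := exists_eventually_sweepBraid_eq_of_unique hc hmi hij hil hjl hcol
      fun m' hm' => (hγ.2 t ⟨m, hcol⟩).unique hm' hcol
    have hg' := (hγc t).eventually hg
    have hlt := hv.filter_mono (nhdsWithin_le_nhds (s := Set.Iio t))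
    have hgt := hv.filter_mono (nhdsWithin_le_nhds (s := Set.Ioi t))
    have hglt := hg'.filter_mono (nhdsWithin_le_nhds (s := Set.Iio t))
    have hggt := hg'.filter_mono (nhdsWithin_le_nhds (s := Set.Ioi t))
    have hplt := (hpunct t).filter_mono (nhdsWithin_mono t fun s (h : s < t) => h.ne)
    have hpgt := (hpunct t).filter_mono (nhdsWithin_mono t fun s (h : t < s) => h.ne')
    rcases hst t m hcol i j l hmi with ⟨h1, h2⟩ | ⟨h1, h2⟩
    · refine ⟨freeBraid [m] * g * v, ?_, ?_⟩
      · filter_upwards [h1, hlt, hglt, hplt] with s e1 e2 e3 e4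
        rw [e2 e4, e3.1 e1]
      · filter_upwards [h2, hgt, hggt, hpgt] with s e1 e2 e3 e4
        rw [e2 e4, e3.2 e1, ← mul_assoc, ← mul_assoc, freeBraid_mul_self, one_mul]
    · refine ⟨g * v, ?_, ?_⟩
      · filter_upwards [h1, hlt, hglt, hplt] with s e1 e2 e3 e4
        rw [e2 e4, e3.2 e1]
      · filter_upwards [h2, hgt, hggt, hpgt] with s e1 e2 e3 e4
        rw [e2 e4, e3.1 e1, mul_assoc]
  · intro e he
    refine lt_of_le_of_ne unitInterval.nonneg' fun h => ?_
    refine (hreg 0).mpr ?_ e.2 (h ▸ he)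
    rwa [γ.source]
  · intro e he
    refine lt_of_le_of_ne unitInterval.le_one' fun h => ?_
    refine (hreg 1).mpr ?_ e.2 (h ▸ he)
    rwa [γ.target]

/-- The free braid of a homotopy class of motions, as the holonomy of the covering. -/
noncomputable def holonomy {x y : Config n} (γ : Path.Homotopic.Quotient x y) :
    FreeBraidGroup n 3 :=
  braidCoord (n := n) ⟨x, (1 : FreeBraidGroup n 3)⟩ *
    (braidCoord ((isCoveringMap_braidBundle n).monodromy γ ⟨⟨x, (1 : FreeBraidGroup n 3)⟩,
        rfl⟩).1)⁻¹

theorem braidCoord_eq_freeBraid_mul_monodromy {x y : Config n} (hx : NoThreeCollinear x.1)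
    (hy : NoThreeCollinear y.1) (γ : Path x y) (hγ : IsPleasant 3 (trisecant (motion γ)))
    (hst : IsStable (motion γ)) (e : (Bundle.TotalSpace.proj : (braidBundle n).TotalSpace →
        _) ⁻¹' {x}) :
    braidCoord e.1 = freeBraid (typeOf hγ) *
      braidCoord ((isCoveringMap_braidBundle n).monodromy (Path.Homotopic.Quotient.mk γ) e).1 := by
  have cov := isCoveringMap_braidBundle n
  have h0 : γ 0 = e.1.proj := γ.source.trans e.2.symm
  have := braidCoord_eq_freeBraid_mul hx hy γ hγ hst (cov.liftPath γ e.1 h0)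
    fun t => congrFun (cov.liftPath_lifts γ e.1 h0) t
  rw [cov.liftPath_zero] at this
  exact this

theorem holonomy_mk {x y : Config n} (hx : NoThreeCollinear x.1) (hy : NoThreeCollinear y.1)
    (γ : Path x y) (hγ : IsPleasant 3 (trisecant (motion γ))) (hst : IsStable (motion γ)) :
    holonomy (Path.Homotopic.Quotient.mk γ) = freeBraid (typeOf hγ) := by
  rw [holonomy, mul_inv_eq_iff_eq_mul]
  exact braidCoord_eq_freeBraid_mul_monodromy hx hy γ hγ hst ⟨⟨x, (1 : FreeBraidGroup n 3)⟩, rfl⟩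

end Covering

/-! ### Approximation by pleasant stable motions -/

section Approximation

open Polynomial

variable {n : ℕ}

theorem ne_of_eq_triple {m : MultiIndex n 3} {i j l : Fin n} (hm : m.1 = {i, j, l}) :
    i ≠ j ∧ i ≠ l ∧ j ≠ l := by
  have h3 := m.2
  rw [hm] at h3
  refine ⟨?_, ?_, ?_⟩ <;> rintro rfl
  · rw [Finset.insert_idem] at h3
    exact absurd (h3 ▸ Finset.card_le_two) (by norm_num)
  · rw [Finset.insert_comm, Finset.pair_eq_singleton] at h3
    exact absurd (h3 ▸ Finset.card_le_two) (by norm_num)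
  · rw [Finset.pair_eq_singleton] at h3
    exact absurd (h3 ▸ Finset.card_le_two) (by norm_num)

/-- A motion in the configuration space with the coordinates of a transverse polynomial motion is
pleasant. -/
theorem isPleasant_of_isTransverse {x y : Config n} {D : Fin n → Fin 2 → ℝ[X]} {γ : Path x y}
    (hγ : ∀ t, (γ t).1 = polyMotion D t) (hx : NoThreeCollinear x.1) (hD : IsTransverse D) :
    IsPleasant 3 (trisecant (motion γ)) := by
  have hinj : ∀ t : unitInterval, Function.Injective (polyMotion D t) := fun t =>
    hγ t ▸ (γ t).2
  have h0 : polyMotion D 0 = x.1 := by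
    have := hγ 0
    rw [γ.source] at this
    exact this.symm
  constructor
  · have hroots : (⋃ p : {p : Fin n × Fin n × Fin n // p.1 ≠ p.2.1 ∧ p.1 ≠ p.2.2 ∧ p.2.1 ≠ p.2.2},
        {t : ℝ | (polyArea D p.1.1 p.1.2.1 p.1.2.2).IsRoot t}).Finite := by
      refine Set.finite_iUnion fun p => finite_setOfPred_isRoot fun h => ?_
      have h1 := (noThreeCollinear_iff x.2).mp hx p.1.1 p.1.2.1 p.1.2.2 p.2.1 p.2.2.1 p.2.2.2
      rw [← h0, ← eval_polyArea, h, eval_zero] at h1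
      exact h1 rfl
    refine Set.Finite.of_finite_image (f := Subtype.val) (hroots.subset ?_)
      Subtype.val_injective.injOn
    rintro _ ⟨t, ⟨m, hm⟩, rfl⟩
    obtain ⟨i, j, l, hij, hil, hjl, hmi⟩ := exists_eq_triple m
    refine Set.mem_iUnion.mpr ⟨⟨(i, j, l), hij, hil, hjl⟩, ?_⟩
    change CollinearOn (γ t).1 m.1 at hm
    rw [hmi, hγ t, collinearOn_polyMotion_iff (hinj t) hij] at hm
    exact hm
  · rintro t ⟨m, hm⟩
    refine ⟨m, hm, fun m' hm' => ?_⟩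
    change CollinearOn (γ t).1 m.1 at hm
    change CollinearOn (γ t).1 m'.1 at hm'
    rw [hγ t] at hm hm'
    exact hD.eq_of_collinearOn t.2 (hinj t) hm' hm

theorem isStable_of_isTransverse {x y : Config n} {D : Fin n → Fin 2 → ℝ[X]} {γ : Path x y}
    (hγ : ∀ t, (γ t).1 = polyMotion D t) (hD : IsTransverse D) : IsStable (motion γ) := by
  intro t m hm i j l hmi
  have hij : i ≠ j ∧ i ≠ l ∧ j ≠ l := ne_of_eq_triple hmi
  change CollinearOn (γ t).1 m.1 at hm
  rw [hmi, hγ t, collinearOn_polyMotion_iff (hγ t ▸ (γ t).2) hij.1] at hm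
  have hder := (hD t t.2).1 i j l hij.1 hij.2.1 hij.2.2 hm
  have harea : ∀ s : unitInterval, signedArea (motion γ s i) (motion γ s j) (motion γ s l) =
      (polyArea D i j l).eval (s : ℝ) := by
    intro s
    rw [eval_polyArea, motion, hγ s]
  simp only [harea]
  have hd : deriv (fun s => (polyArea D i j l).eval s) (t : ℝ) =
      (derivative (polyArea D i j l)).eval (t : ℝ) := Polynomial.deriv _
  have hc : Filter.Tendsto (Subtype.val : unitInterval → ℝ) (𝓝 t) (𝓝 (t : ℝ)) :=
    continuous_subtype_val.tendsto t
  rcases lt_or_gt_of_ne hder with h | h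
  · right
    have key := hc.eventually (eventually_nhdsWithin_sign_eq_of_deriv_neg (hd ▸ h) hm)
    constructor
    · filter_upwards [key.filter_mono nhdsWithin_le_nhds, self_mem_nhdsWithin] with s h1 h2
      rw [sign_pos (sub_pos.mpr (show (s : ℝ) < t from h2)), sign_eq_one_iff] at h1
      exact h1
    · filter_upwards [key.filter_mono nhdsWithin_le_nhds, self_mem_nhdsWithin] with s h1 h2
      rw [sign_neg (sub_neg.mpr (show (t : ℝ) < s from h2)), sign_eq_neg_one_iff] at h1
      exact h1
  · left
    have key := hc.eventually (eventually_nhdsWithin_sign_eq_of_deriv_pos (hd ▸ h) hm)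
    constructor
    · filter_upwards [key.filter_mono nhdsWithin_le_nhds, self_mem_nhdsWithin] with s h1 h2
      rw [sign_neg (sub_neg.mpr (show (s : ℝ) < t from h2)), sign_eq_neg_one_iff] at h1
      exact h1
    · filter_upwards [key.filter_mono nhdsWithin_le_nhds, self_mem_nhdsWithin] with s h1 h2
      rw [sign_pos (sub_pos.mpr (show (t : ℝ) < s from h2)), sign_eq_one_iff] at h1
      exact h1

/-- A polynomial that approximates a continuous function on `[0, 1]` and agrees with it at the
ends. -/
theorem exists_polynomial_near_with_ends (f : C(unitInterval, ℝ)) {ε : ℝ} (hε : 0 < ε) :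
    ∃ P : ℝ[X], (∀ t : unitInterval, |P.eval (t : ℝ) - f t| < ε) ∧ P.eval 0 = f 0 ∧
      P.eval 1 = f 1 := by
  obtain ⟨Q, hQ⟩ := exists_polynomial_near_continuousMap 0 1 f (ε / 2) (half_pos hε)
  have hQt : ∀ t : unitInterval, |Q.eval (t : ℝ) - f t| < ε / 2 := fun t => by
    have := ContinuousMap.norm_coe_le_norm (Q.toContinuousMapOn (Set.Icc (0 : ℝ) 1) - f) t
    exact lt_of_le_of_lt this hQ
  refine ⟨Q + C (f 0 - Q.eval 0) * (1 - X) + C (f 1 - Q.eval 1) * X, fun t => ?_, by simp,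
    by simp⟩
  have h0 := abs_lt.mp (hQt 0)
  have h1 := abs_lt.mp (hQt 1)
  have ht := abs_lt.mp (hQt t)
  have ht0 := t.2.1
  have ht1 := t.2.2
  simp only [Set.Icc.coe_zero, Set.Icc.coe_one] at h0 h1
  simp only [eval_add, eval_mul, eval_C, eval_sub, eval_one, eval_X]
  rw [abs_lt]
  constructor <;> nlinarith [mul_nonneg ht0 (sub_nonneg.mpr h1.1.le),
      mul_nonneg ht0 (sub_nonneg.mpr h1.2.le),
    mul_nonneg (sub_nonneg.mpr ht1) (sub_nonneg.mpr h0.1.le),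
        mul_nonneg (sub_nonneg.mpr ht1) (sub_nonneg.mpr h0.2.le)]

theorem norm_plane_le (v : Plane) : ‖v‖ ≤ |v 0| + |v 1| := by
  rw [EuclideanSpace.norm_eq, Fin.sum_univ_two, Real.norm_eq_abs, Real.norm_eq_abs]
  refine Real.sqrt_le_iff.mpr ⟨by positivity, ?_⟩
  nlinarith [abs_nonneg (v 0), abs_nonneg (v 1)]

/-- Two paths whose connecting segments consist of configurations are homotopic. -/
theorem homotopic_of_segments {x y : Config n} {γ δ : Path x y}
    (h : ∀ s t : unitInterval,
      Function.Injective ((γ t).1 + (s : ℝ) • ((δ t).1 - (γ t).1))) : γ.Homotopic δ := by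
  refine ⟨{ toFun := fun a => ⟨_, h a.1 a.2⟩, continuous_toFun := ?_, map_zero_left := ?_,
            map_one_left := ?_, prop' := ?_ }⟩
  · refine Continuous.subtype_mk ?_ _
    have hγ : Continuous fun a : unitInterval × unitInterval => (γ a.2).1 :=
      continuous_subtype_val.comp (γ.continuous.comp continuous_snd)
    have hδ : Continuous fun a : unitInterval × unitInterval => (δ a.2).1 :=
      continuous_subtype_val.comp (δ.continuous.comp continuous_snd)
    exact hγ.add ((continuous_subtype_val.comp continuous_fst).smul (hδ.sub hγ))
  · intro t
    apply Subtype.ext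
    simp
  · intro t
    apply Subtype.ext
    simp
  · rintro s t (rfl | ht)
    · apply Subtype.ext
      simp
    · obtain rfl : t = 1 := ht
      apply Subtype.ext
      simp

/-- Every motion between configurations in general position is homotopic to a pleasant stable
one: it is approximated by polynomials with the same ends, which are then put in general
position. -/
theorem exists_homotopic_pleasant_stable {x y : Config n} (hx : NoThreeCollinear x.1)
    (hy : NoThreeCollinear y.1) (γ : Path x y) : ∃ δ : Path x y, γ.Homotopic δ ∧
      IsPleasant 3 (trisecant (motion δ)) ∧ IsStable (motion δ) := by
  -- a tube around the path that consists of configurations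
  obtain ⟨ρ, hρ, hρU⟩ : ∃ ρ : ℝ, 0 < ρ ∧ ∀ t : unitInterval, ∀ z : Fin n → Plane,
      ‖z - (γ t).1‖ < ρ → Function.Injective z := by
    have hK : IsCompact (Set.range fun t => (γ t).1) :=
      isCompact_range (continuous_subtype_val.comp γ.continuous)
    have hU : IsOpen {z : Fin n → Plane | Function.Injective z} := by
      rw [isOpen_iff_mem_nhds]
      intro z hz
      obtain ⟨c, hc⟩ := exists_injective_chartX hz
      filter_upwards [(isOpen_injective_chartX c).mem_nhds hc] with z' h'
        using injective_of_injective_chartX h'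
    obtain ⟨ρ, hρ, hsub⟩ := hK.exists_thickening_subset_open hU (by
      rintro _ ⟨t, rfl⟩
      exact (γ t).2)
    refine ⟨ρ, hρ, fun t z hz => hsub ?_⟩
    rw [Metric.mem_thickening_iff]
    exact ⟨(γ t).1, ⟨t, rfl⟩, by rwa [dist_eq_norm]⟩
  have hcoord : ∀ i : Fin n, ∀ a : Fin 2, Continuous fun t : unitInterval => (γ t).1 i a := by
    intro i a
    have h1 : Continuous fun t : unitInterval => (γ t).1 i :=
      (continuous_apply i).comp (continuous_subtype_val.comp γ.continuous)
    fun_prop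
  choose D hD hD0 hD1 using fun (i : Fin n) (a : Fin 2) =>
    exists_polynomial_near_with_ends ⟨_, hcoord i a⟩ (show 0 < ρ / 8 by positivity)
  have e0 : polyMotion D 0 = x.1 := by
    ext i a
    fin_cases a
    · simpa [polyMotion] using hD0 i 0
    · simpa [polyMotion] using hD0 i 1
  have e1 : polyMotion D 1 = y.1 := by
    ext i a
    fin_cases a
    · simpa [polyMotion] using hD1 i 0
    · simpa [polyMotion] using hD1 i 1
  have hnear : ∀ t : unitInterval, ‖polyMotion D t - (γ t).1‖ ≤ ρ / 4 := by
    intro t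
    refine (pi_norm_le_iff_of_nonneg (by positivity)).mpr fun i => (norm_plane_le _).trans ?_
    have h0 := (hD i 0 t).le
    have h1 := (hD i 1 t).le
    simp only [ContinuousMap.coe_mk] at h0 h1
    simp only [polyMotion, Pi.sub_apply, PiLp.sub_apply, Matrix.cons_val_zero,
      Matrix.cons_val_one, Matrix.cons_val_fin_one]
    linarith
  obtain ⟨w, hw, hwinj, hwt⟩ := exists_isTransverse_perturb D (by
    intro t ht i j l hij hil hjl
    rw [eval_polyArea]
    rcases mul_eq_zero.mp ht with rfl | ht
    · rw [e0]
      exact (noThreeCollinear_iff x.2).mp hx i j l hij hil hjl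
    · obtain rfl : t = 1 := by linarith
      rw [e1]
      exact (noThreeCollinear_iff y.2).mp hy i j l hij hil hjl)
    (fun t ht => hρU ⟨t, ht⟩ _ ((hnear ⟨t, ht⟩).trans_lt (by linarith)))
    (show 0 < ρ / 4 by positivity)
  have hnear' : ∀ t : unitInterval, ‖polyMotion (perturb D w) t - (γ t).1‖ < ρ := by
    intro t
    have hle : ‖((t : ℝ) * (1 - t)) • w‖ ≤ ‖w‖ := by
      rw [norm_smul, Real.norm_eq_abs, abs_of_nonneg (mul_nonneg t.2.1 (by linarith [t.2.2]))]
      have : (t : ℝ) * (1 - t) ≤ 1 := by nlinarith [t.2.1, t.2.2]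
      exact mul_le_of_le_one_left (norm_nonneg w) this
    rw [polyMotion_perturb]
    calc ‖polyMotion D t + ((t : ℝ) * (1 - t)) • w - (γ t).1‖
        = ‖(polyMotion D t - (γ t).1) + ((t : ℝ) * (1 - t)) • w‖ := by congr 1; abel
      _ ≤ ‖polyMotion D t - (γ t).1‖ + ‖((t : ℝ) * (1 - t)) • w‖ := norm_add_le _ _
      _ < ρ := by linarith [hnear t]
  let δ : Path x y :=
    { toFun := fun t => ⟨polyMotion (perturb D w) t, hwinj t t.2⟩
      continuous_toFun :=
        ((continuous_polyMotion _).comp continuous_subtype_val).subtype_mk _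
      source' := Subtype.ext (by simp [polyMotion_perturb, e0])
      target' := Subtype.ext (by simp [polyMotion_perturb, e1]) }
  have hδ : ∀ t, (δ t).1 = polyMotion (perturb D w) t := fun t => rfl
  refine ⟨δ, homotopic_of_segments fun s t => hρU t _ ?_, isPleasant_of_isTransverse hδ hx hwt,
    isStable_of_isTransverse hδ hwt⟩
  rw [add_sub_cancel_left, norm_smul, Real.norm_eq_abs, abs_of_nonneg s.2.1]
  exact lt_of_le_of_lt (mul_le_of_le_one_left (norm_nonneg _) s.2.2) (hnear' t)

end Approximation

/-! ### Properties of the holonomy -/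

section Holonomy

variable {n : ℕ}

theorem exists_pleasant_stable_mk_eq {x y : Config n} (hx : NoThreeCollinear x.1)
    (hy : NoThreeCollinear y.1) (γ : Path.Homotopic.Quotient x y) :
    ∃ δ : Path x y, Path.Homotopic.Quotient.mk δ = γ ∧ IsPleasant 3 (trisecant (motion δ)) ∧
      IsStable (motion δ) := by
  obtain ⟨γ, rfl⟩ := Path.Homotopic.Quotient.mk_surjective γ
  obtain ⟨δ, h, h1, h2⟩ := exists_homotopic_pleasant_stable hx hy γ
  exact ⟨δ, Path.Homotopic.Quotient.eq.mpr h.symm, h1, h2⟩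

theorem braidCoord_eq_holonomy_mul {x y : Config n} (hx : NoThreeCollinear x.1)
    (hy : NoThreeCollinear y.1) (γ : Path.Homotopic.Quotient x y)
    (e : (Bundle.TotalSpace.proj : (braidBundle n).TotalSpace → _) ⁻¹' {x}) :
    braidCoord e.1 = holonomy γ * braidCoord ((isCoveringMap_braidBundle n).monodromy γ e).1 := by
  obtain ⟨δ, rfl, h1, h2⟩ := exists_pleasant_stable_mk_eq hx hy γ
  rw [holonomy_mk hx hy δ h1 h2]
  exact braidCoord_eq_freeBraid_mul_monodromy hx hy δ h1 h2 e

theorem holonomy_trans {x y z : Config n} (hx : NoThreeCollinear x.1) (hy : NoThreeCollinear y.1)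
    (hz : NoThreeCollinear z.1) (γ : Path.Homotopic.Quotient x y)
    (δ : Path.Homotopic.Quotient y z) : holonomy (γ.trans δ) = holonomy γ * holonomy δ := by
  let e : (Bundle.TotalSpace.proj : (braidBundle n).TotalSpace → _) ⁻¹' {x} :=
    ⟨⟨x, (1 : FreeBraidGroup n 3)⟩, rfl⟩
  have h1 := braidCoord_eq_holonomy_mul hx hz (γ.trans δ) e
  rw [(isCoveringMap_braidBundle n).monodromy_trans_apply,
    braidCoord_eq_holonomy_mul hx hy γ e, braidCoord_eq_holonomy_mul hy hz δ, ← mul_assoc] at h1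
  exact (mul_right_cancel h1).symm

/-- A motion through configurations in general position has trivial holonomy. -/
theorem holonomy_mk_eq_one {x y : Config n} (γ : Path x y)
    (h : ∀ t, NoThreeCollinear (γ t).1) : holonomy (Path.Homotopic.Quotient.mk γ) = 1 := by
  have hcrit : ∀ (t : unitInterval) (m : MultiIndex n 3), ¬ trisecant (motion γ) t m.1 :=
      fun t m hm => h t m hm
  have hempty : criticalMoments 3 (trisecant (motion γ)) = ∅ :=
    Set.eq_empty_of_forall_notMem fun t ⟨m, hm⟩ => hcrit t m hm
  have hp : IsPleasant 3 (trisecant (motion γ)) :=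
    ⟨by rw [hempty]; exact Set.finite_empty, fun t ht => by rw [hempty] at ht; exact ht.elim⟩
  rw [holonomy_mk (γ.source ▸ h 0) (γ.target ▸ h 1) γ hp fun t m hm => absurd hm (hcrit t m),
    typeOf_eq hp [] List.Pairwise.nil fun t m => by simpa using hcrit t m]
  rfl

end Holonomy

/-! ### Words modulo the local moves -/

section WordQuotient

variable {n k : ℕ}

theorem DotMove.append {v w : List (MultiIndex n k)} (h : DotMove n k v w)
    (a b : List (MultiIndex n k)) : DotMove n k (a ++ v ++ b) (a ++ w ++ b) := by
  cases h with
  | bigon v w m => simpa using DotMove.bigon (a ++ v) (w ++ b) m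
  | far v w m m' h => simpa using DotMove.far (a ++ v) (w ++ b) m m' h
  | tetrahedron v w u => simpa using DotMove.tetrahedron (a ++ v) (w ++ b) u

theorem eqvGen_dotMove_append {v w : List (MultiIndex n k)}
    (h : Relation.EqvGen (DotMove n k) v w) (a b : List (MultiIndex n k)) :
    Relation.EqvGen (DotMove n k) (a ++ v ++ b) (a ++ w ++ b) := by
  induction h with
  | rel v w h => exact .rel _ _ (h.append a b)
  | refl v => exact .refl _
  | symm v w _ ih => exact .symm _ _ ih
  | trans u v w _ _ ih ih' => exact .trans _ _ _ ih ih'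

/-- The congruence on words that is generated by the local moves. -/
def wordCon (n k : ℕ) : Con (FreeMonoid (MultiIndex n k)) where
  r v w := Relation.EqvGen (DotMove n k) v.toList w.toList
  iseqv := ⟨fun v => .refl _, fun h => .symm _ _ h, fun h h' => .trans _ _ _ h h'⟩
  mul' {v w v' w'} h h' := by
    simp only [FreeMonoid.toList_mul]
    have h1 := eqvGen_dotMove_append h [] v'.toList
    have h2 := eqvGen_dotMove_append h' w.toList []
    simp only [List.nil_append, List.append_nil] at h1 h2
    exact .trans _ _ _ h1 h2

/-- The class of a word modulo the local moves. -/
def wordClass (w : List (MultiIndex n k)) : (wordCon n k).Quotient :=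
  (wordCon n k).mk' (FreeMonoid.ofList w)

theorem wordClass_append (v w : List (MultiIndex n k)) :
    wordClass (v ++ w) = wordClass v * wordClass w := by
  simp [wordClass]

theorem wordClass_eq_iff {v w : List (MultiIndex n k)} :
    wordClass v = wordClass w ↔ Relation.EqvGen (DotMove n k) v w :=
  (wordCon n k).eq

/-- A letter is its own inverse modulo the local moves. -/
def letterUnit (m : MultiIndex n k) : (wordCon n k).Quotientˣ where
  val := wordClass [m]
  inv := wordClass [m]
  val_inv := by
    rw [← wordClass_append]
    exact wordClass_eq_iff.mpr (.rel _ _ (by simpa using DotMove.bigon [] [] m))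
  inv_val := by
    rw [← wordClass_append]
    exact wordClass_eq_iff.mpr (.rel _ _ (by simpa using DotMove.bigon [] [] m))

theorem val_lift_freeWord (w : List (MultiIndex n k)) :
    (FreeGroup.lift letterUnit (freeWord w) : (wordCon n k).Quotientˣ).val = wordClass w := by
  induction w with
  | nil => simp [freeWord, wordClass]
  | cons m w ih =>
    have h1 : freeWord (m :: w) = FreeGroup.of m * freeWord w := by simp [freeWord]
    rw [h1, map_mul, Units.val_mul, ih, FreeGroup.lift_apply_of]
    exact (wordClass_append [m] w).symm

theorem lift_relator_eq_one (r : FreeGroup (MultiIndex n k)) (hr : FreeBraidRelator n k r) :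
    FreeGroup.lift (letterUnit (n := n) (k := k)) r = 1 := by
  cases hr with
  | tetrahedron u =>
    rw [map_mul, map_inv, mul_inv_eq_one]
    apply Units.ext
    rw [val_lift_freeWord, val_lift_freeWord, wordClass_eq_iff]
    exact .rel _ _ (by simpa using DotMove.tetrahedron [] [] u)
  | far m m' h =>
    rw [map_mul, map_inv, mul_inv_eq_one]
    apply Units.ext
    rw [val_lift_freeWord, val_lift_freeWord, wordClass_eq_iff]
    exact .rel _ _ (by simpa using DotMove.far [] [] m m' h)
  | square m =>
    apply Units.ext
    rw [val_lift_freeWord, Units.val_one]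
    exact wordClass_eq_iff.mpr (.rel _ _ (by simpa using DotMove.bigon [] [] m))

/-- The local moves imply the relations of the group because the letters are units modulo them. -/
theorem freeBraid_eq_iff {v w : List (MultiIndex n k)} :
    freeBraid v = freeBraid w ↔ Relation.EqvGen (DotMove n k) v w := by
  constructor
  · intro h
    rw [freeBraid_eq_mk, freeBraid_eq_mk] at h
    have h2 := congrArg (PresentedGroup.toGroup lift_relator_eq_one) h
    rw [← wordClass_eq_iff, ← val_lift_freeWord, ← val_lift_freeWord]
    exact congrArg Units.val h2
  · intro h
    induction h with
    | rel v w h =>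
      cases h with
      | bigon v w m =>
        rw [freeBraid_append, freeBraid_append, freeBraid_append, freeBraid_cons m [m],
          freeBraid_mul_self, mul_one]
      | far v w m m' h =>
        rw [freeBraid_append, freeBraid_append, freeBraid_append, freeBraid_append,
          freeBraid_cons m [m'], freeBraid_cons m' [m], (freeBraid_commute h).eq]
      | tetrahedron v w u =>
        rw [freeBraid_append, freeBraid_append, freeBraid_append, freeBraid_append,
          freeBraid_tetraWord_reverse]
    | refl v => rfl
    | symm v w _ ih => exact ih.symm
    | trans u v w _ _ ih ih' => exact ih.trans ih'

end WordQuotient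

/-! ### Pictures -/

section Pictures

open Polynomial

theorem exists_hermite_interpolation {N : ℕ} {v : Fin N → ℝ} (hv : Function.Injective v)
    (a b : Fin N → ℝ) :
    ∃ P : ℝ[X], ∀ j, P.eval (v j) = a j ∧ (derivative P).eval (v j) = b j := by
  set P₀ := Lagrange.interpolate Finset.univ v a
  set B := Lagrange.nodal Finset.univ v
  set R := Lagrange.interpolate Finset.univ v
    fun j => (b j - (derivative P₀).eval (v j)) / (derivative B).eval (v j)
  refine ⟨P₀ + B * R, fun j => ?_⟩
  have hB : B.eval (v j) = 0 := Lagrange.eval_nodal_at_node (Finset.mem_univ j)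
  have hB' : (derivative B).eval (v j) ≠ 0 := by
    rw [Lagrange.eval_nodal_derivative_eval_node_eq (Finset.mem_univ j), Lagrange.eval_nodal]
    exact Finset.prod_ne_zero_iff.mpr fun i hi =>
      sub_ne_zero.mpr fun h => (Finset.mem_erase.mp hi).1 (hv h).symm
  have hP : P₀.eval (v j) = a j := Lagrange.eval_interpolate_at_node _ hv.injOn (Finset.mem_univ j)
  have hR : R.eval (v j) = (b j - (derivative P₀).eval (v j)) / (derivative B).eval (v j) :=
    Lagrange.eval_interpolate_at_node _ hv.injOn (Finset.mem_univ j)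
  constructor
  · simp [hB, hP]
  · simp only [derivative_add, derivative_mul, eval_add, eval_mul, hB, zero_mul, add_zero, hR]
    field_simp
    ring

variable {n k : ℕ}

/-- Every word is the word of a picture, whose strands are graphs of polynomials with prescribed
values and slopes at the heights of the dots. -/
theorem exists_picture (w : List (MultiIndex n k)) : ∃ p : FreeBraidPicture n k, p.word = w := by
  classical
  set N := w.length with hN
  let v : Fin (N + 2) → ℝ := fun j => (j : ℕ) / ((N : ℝ) + 1)
  have hN1 : (0 : ℝ) < N + 1 := by positivity
  have hv : Function.Injective v := by
    intro i j h
    have h1 : ((i : ℕ) : ℝ) = ((j : ℕ) : ℝ) := by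
      have := congrArg (· * ((N : ℝ) + 1)) h
      simpa [v, div_mul_cancel₀ _ hN1.ne'] using this
    exact Fin.ext (Nat.cast_injective h1)
  -- the dots lie at the heights `v 1, …, v N`, whence the shift of the index by one;
  -- the strands of a dot meet at the abscissa `0`, the others pass at a positive abscissa
  let a : Fin n → Fin (N + 2) → ℝ := fun i j =>
    if ∃ h : 0 < (j : ℕ) ∧ (j : ℕ) - 1 < w.length, i ∈ (w[(j : ℕ) - 1]'h.2).1 then 0 else (i :
        ℝ) + 1
  -- the slope of the `i`-th strand is `i`, so that strands meet transversally
  choose P hP using fun i : Fin n => exists_hermite_interpolation hv (a i) fun _ => (i : ℝ)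
  let d : Fin N → Fin (N + 2) := fun j => j.succ.castSucc
  have hd : ∀ (j : Fin N) (i : Fin n), a i (d j) = if i ∈ (w[(j : ℕ)]).1 then 0 else (i : ℝ) + 1 :=
      by
    intro j i
    have : (j : ℕ) < w.length := j.2
    simp [a, d, this]
  have hpos : ∀ i : Fin n, (0 : ℝ) < (i : ℝ) + 1 := fun i => by positivity
  have hbot : ∀ i, (P i).eval 0 = (i : ℝ) + 1 := by
    intro i
    have h1 := (hP i 0).1
    have h2 : v 0 = 0 := by simp [v]
    rw [h2] at h1
    rw [h1]
    simp [a]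
  have htop : ∀ i, (P i).eval 1 = (i : ℝ) + 1 := by
    intro i
    have h1 := (hP i (Fin.last _)).1
    have h2 : v (Fin.last _) = 1 := by
      simp only [v, Fin.val_last, Nat.cast_add, Nat.cast_one]
      exact div_self hN1.ne'
    rw [h2] at h1
    rw [h1]
    simp [a, hN]
  let dots : List (ℝ × MultiIndex n k) :=
    (List.finRange N).map fun j : Fin N => (v (d j), w[(j : ℕ)])
  have hdots : ∀ e ∈ dots, ∃ j : Fin N, e = (v (d j), w[(j : ℕ)]) := by
    intro e he
    obtain ⟨j, -, rfl⟩ := List.mem_map.mp he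
    exact ⟨j, rfl⟩
  refine ⟨{ strand := fun i t => (P i).eval t
            continuousOn := fun i => (P i).continuous.continuousOn
            bottom := hbot
            top := htop
            finite_crossings := ?_
            dots := dots
            sorted := ?_
            height_mem := ?_
            meet := ?_
            only := ?_
            differentiable := fun _ _ i _ => (P i).differentiable.differentiableAt
            transversal := ?_ }, ?_⟩
  · intro i j hij
    have hne : P i - P j ≠ 0 := by
      intro h
      have h0 := congrArg (eval 0) h
      rw [eval_sub, hbot, hbot, eval_zero] at h0
      exact hij (Fin.ext (Nat.cast_injective (R := ℝ) (by linarith)))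
    refine (finite_setOfPred_isRoot hne).subset fun t ht => ?_
    change eval t (P i - P j) = 0
    rw [eval_sub, sub_eq_zero]
    exact ht.2
  · rw [List.pairwise_map]
    refine (List.pairwise_lt_finRange N).imp fun {i j} hij => ?_
    have : ((i : ℕ) : ℝ) < ((j : ℕ) : ℝ) := Nat.cast_lt.mpr hij
    simp only [v, d, Fin.val_castSucc, Fin.val_succ, Nat.cast_add, Nat.cast_one]
    gcongr
  · intro e he
    obtain ⟨j, rfl⟩ := hdots e he
    have : ((j : ℕ) : ℝ) < N := Nat.cast_lt.mpr j.2
    simp only [v, d, Fin.val_castSucc, Fin.val_succ, Nat.cast_add, Nat.cast_one, Set.mem_Ioo]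
    exact ⟨by positivity, (div_lt_one hN1).mpr (by linarith)⟩
  · intro e he i hi j hj
    obtain ⟨q, rfl⟩ := hdots e he
    dsimp only at hi hj ⊢
    rw [(hP i (d q)).1, (hP j (d q)).1, hd, hd, if_pos hi, if_pos hj]
  · intro e he i hi j hj
    obtain ⟨q, rfl⟩ := hdots e he
    dsimp only at hi hj ⊢
    rw [(hP i (d q)).1, (hP j (d q)).1, hd, hd, if_pos hi, if_neg hj]
    exact (hpos j).ne'
  · intro e he i hi j hj hij
    obtain ⟨q, rfl⟩ := hdots e he
    dsimp only
    rw [Polynomial.deriv, Polynomial.deriv, (hP i (d q)).2, (hP j (d q)).2]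
    exact fun h => hij (Fin.ext (Nat.cast_injective (R := ℝ) h))
  · simp only [FreeBraidPicture.word, dots, List.map_map]
    refine List.ext_getElem (by simp [hN]) fun i h1 h2 => by simp

/-- A chain of local moves on words lifts to pictures, since each word of the chain has a picture. -/
theorem pictureEquiv_iff {p q : FreeBraidPicture n k} :
    PictureEquiv p q ↔ freeBraid p.word = freeBraid q.word := by
  constructor
  · intro h
    induction h with
    | rel p q h =>
      rcases h with h | h
      · rw [h]
      · exact freeBraid_eq_iff.mpr (.rel _ _ h)
    | refl p => rfl
    | symm p q _ ih => exact ih.symm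
    | trans p q r _ _ ih ih' => exact ih.trans ih'
  · intro h
    rw [freeBraid_eq_iff] at h
    generalize hv : p.word = v at h
    generalize hw : q.word = w at h
    induction h generalizing p q with
    | rel v w h => exact .rel _ _ (Or.inr (by rw [hv, hw]; exact h))
    | refl v => exact .rel _ _ (Or.inl (hv.trans hw.symm))
    | symm v w _ ih => exact .symm _ _ (ih hw hv)
    | trans u v w _ _ ih ih' =>
      obtain ⟨r, hr⟩ := exists_picture v
      exact .trans _ _ _ (ih hv hr) (ih' hr hw)

end Pictures

/-! ### The invariants of pure braids -/

section PureBraid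

variable {n : ℕ} {x : Config n}

theorem exists_pureBraid_eq (hx : NoThreeCollinear x.1) (b : PureBraidGroup n x) :
    ∃ γ : Path x x, IsPleasant 3 (trisecant (motion γ)) ∧ IsStable (motion γ) ∧
      pureBraid γ = b := by
  obtain ⟨γ, h, h1, h2⟩ := exists_pleasant_stable_mk_eq hx hx (FundamentalGroup.toPath b.unop)
  exact ⟨γ, h1, h2, by rw [pureBraid, h]; rfl⟩

/-- The homomorphism from pure braids to free braids. -/
noncomputable def braidHom (hx : NoThreeCollinear x.1) : PureBraidGroup n x →* FreeBraidGroup n 3 :=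
  MonoidHom.mk' (fun b => holonomy (FundamentalGroup.toPath b.unop)) fun a b =>
    holonomy_trans hx hx hx (FundamentalGroup.toPath a.unop) (FundamentalGroup.toPath b.unop)

theorem braidHom_pureBraid (hx : NoThreeCollinear x.1) (γ : Path x x)
    (hγ : IsPleasant 3 (trisecant (motion γ))) (hst : IsStable (motion γ)) :
    braidHom hx (pureBraid γ) = freeBraid (typeOf hγ) :=
  holonomy_mk hx hx γ hγ hst

theorem existsUnique_braidHom (hx : NoThreeCollinear x.1) :
    ∃! φ : PureBraidGroup n x →* FreeBraidGroup n 3,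
      ∀ γ : Path x x, ∀ hγ : IsPleasant 3 (trisecant (motion γ)), IsStable (motion γ) →
        φ (pureBraid γ) = freeBraid (typeOf hγ) := by
  refine ⟨braidHom hx, fun γ hγ hst => braidHom_pureBraid hx γ hγ hst, fun φ hφ => ?_⟩
  ext b
  obtain ⟨γ, hγ, hst, rfl⟩ := exists_pureBraid_eq hx b
  rw [hφ γ hγ hst, braidHom_pureBraid hx γ hγ hst]

theorem existsUnique_pictureMap (hx : NoThreeCollinear x.1) :
    ∃! ψ : PureBraidGroup n x → PictureClass n 3,
      ∀ γ : Path x x, ∀ hγ : IsPleasant 3 (trisecant (motion γ)), IsStable (motion γ) →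
        ∀ p : FreeBraidPicture n 3, p.word = typeOf hγ → ψ (pureBraid γ) = Quot.mk _ p := by
  choose w hw using freeBraid_surjective (n := n) (k := 3)
  choose P hP using exists_picture (n := n) (k := 3)
  refine ⟨fun b => Quot.mk _ (P (w (braidHom hx b))), fun γ hγ hst p hp => ?_, fun ψ hψ => ?_⟩
  · refine Quot.sound (pictureEquiv_iff.mpr ?_)
    rw [hP, hw, hp, braidHom_pureBraid hx γ hγ hst]
  · funext b
    obtain ⟨γ, hγ, hst, rfl⟩ := exists_pureBraid_eq hx b
    rw [hψ γ hγ hst (P (typeOf hγ)) (hP _)]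
    refine Quot.sound (pictureEquiv_iff.mpr ?_)
    rw [hP, hP, hw, braidHom_pureBraid hx γ hγ hst]

end PureBraid

/-! ### Upright weavings in coordinates -/

section WeavingCoordinates

variable {n : ℕ}

/-- The point of space above the point `a` of the plane, at height `h`. -/
noncomputable def spacePoint (a : Plane) (h : ℝ) : Space := !₂[a 0, a 1, h]

/-- The line that passes through `p` at height `0` and moves horizontally with velocity `v`. -/
noncomputable def weavingLine (p v : Plane) : AffineSubspace ℝ Space :=
  AffineSubspace.mk' (spacePoint p 0) (Submodule.span ℝ {spacePoint v 1})

theorem mem_weavingLine {p v : Plane} {q : Space} :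
    q ∈ weavingLine p v ↔ q 0 = p 0 + q 2 * v 0 ∧ q 1 = p 1 + q 2 * v 1 := by
  rw [weavingLine, AffineSubspace.mem_mk', Submodule.mem_span_singleton]
  constructor
  · rintro ⟨t, ht⟩
    have h0 := congrFun (congrArg WithLp.ofLp ht) 0
    have h1 := congrFun (congrArg WithLp.ofLp ht) 1
    have h2 := congrFun (congrArg WithLp.ofLp ht) 2
    simp [spacePoint] at h0 h1 h2
    rw [← h2]
    constructor <;> linarith
  · rintro ⟨h0, h1⟩
    refine ⟨q 2, ?_⟩
    ext a
    fin_cases a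
    · simp [spacePoint, h0]
    · simp [spacePoint, h1]
    · simp [spacePoint]

theorem spacePoint_mem_weavingLine {p v a : Plane} {t : ℝ} :
    spacePoint a t ∈ weavingLine p v ↔ a = p + t • v := by
  rw [mem_weavingLine, PiLp.ext_iff, Fin.forall_fin_two]
  simp [spacePoint]

theorem direction_weavingLine (p v : Plane) :
    (weavingLine p v).direction = Submodule.span ℝ {spacePoint v 1} :=
  AffineSubspace.direction_mk' _ _

theorem weavingLine_inj {p v p' v' : Plane} :
    weavingLine p v = weavingLine p' v' ↔ p = p' ∧ v = v' := by
  constructor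
  · intro h
    have h0 : spacePoint p 0 ∈ weavingLine p' v' :=
      h ▸ spacePoint_mem_weavingLine.mpr (by simp)
    have h1 : spacePoint (p + (1 : ℝ) • v) 1 ∈ weavingLine p' v' :=
      h ▸ spacePoint_mem_weavingLine.mpr rfl
    rw [spacePoint_mem_weavingLine] at h0 h1
    simp only [zero_smul, add_zero, one_smul] at h0 h1
    exact ⟨h0, by rw [h0] at h1; exact add_left_cancel h1⟩
  · rintro ⟨rfl, rfl⟩
    rfl

/-- A line that is not horizontal, in terms of its intersection with the plane of height `0` and
of its slope. -/
theorem mk'_span_eq_weavingLine (b d : Space) (hd : d 2 ≠ 0) :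
    AffineSubspace.mk' b (Submodule.span ℝ {d}) =
      weavingLine !₂[b 0 - b 2 * (d 0 / d 2), b 1 - b 2 * (d 1 / d 2)] !₂[d 0 / d 2, d 1 / d 2] :=
          by
  ext q
  rw [mem_weavingLine, AffineSubspace.mem_mk', Submodule.mem_span_singleton]
  simp only [Matrix.cons_val_zero, Matrix.cons_val_one, Matrix.cons_val_fin_one]
  constructor
  · rintro ⟨t, ht⟩
    have h0 := congrFun (congrArg WithLp.ofLp ht) 0
    have h1 := congrFun (congrArg WithLp.ofLp ht) 1
    have h2 := congrFun (congrArg WithLp.ofLp ht) 2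
    simp only [PiLp.smul_apply, smul_eq_mul, vsub_eq_sub, PiLp.sub_apply] at h0 h1 h2
    have e2 : q 2 = b 2 + t * d 2 := by linarith
    rw [e2]
    constructor
    · field_simp
      linear_combination -(d 2) * h0
    · field_simp
      linear_combination -(d 2) * h1
  · rintro ⟨h0, h1⟩
    refine ⟨(q 2 - b 2) / d 2, ?_⟩
    ext a
    fin_cases a
    · simp [h0]; field_simp; ring
    · simp [h1]; field_simp; ring
    · simp; field_simp

/-- The determinant of two vectors of the plane. -/
def planeDet (u w : Plane) : ℝ := u 0 * w 1 - u 1 * w 0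

/-- The coordinates of upright weavings: the positions `p i` of the points at height `0` and their
velocities `v i`, such that the lines they determine are pairwise skew. -/
abbrev SkewPair (n : ℕ) : Type := {a : (Fin n → Plane) × (Fin n → Plane) //
  ∀ i j, i ≠ j → planeDet (a.1 i - a.1 j) (a.2 i - a.2 j) ≠ 0}

theorem planeDet_eq_zero_of_smul_eq {u w : Plane} {α β : ℝ} (hαβ : α ≠ 0 ∨ β ≠ 0)
    (h : α • u = β • w) : planeDet u w = 0 := by
  have h0 := congrFun (congrArg WithLp.ofLp h) 0
  have h1 := congrFun (congrArg WithLp.ofLp h) 1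
  simp only [PiLp.smul_apply, smul_eq_mul] at h0 h1
  rw [planeDet]
  rcases hαβ with hα | hβ
  · refine (mul_eq_zero.mp ?_).resolve_left hα
    linear_combination w 1 * h0 - w 0 * h1
  · refine (mul_eq_zero.mp ?_).resolve_left hβ
    linear_combination u 1 * h0 - u 0 * h1

theorem SkewPair.injective_velocity (a : SkewPair n) : Function.Injective a.1.2 := by
  intro i j h
  by_contra hij
  refine a.2 i j hij ?_
  rw [h, sub_self]
  simp [planeDet]

/-- The weaving with given coordinates. -/
noncomputable def SkewPair.toWeaving (a : SkewPair n) : Weaving n where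
  line i := weavingLine (a.1.1 i) (a.1.2 i)
  nonempty i := ⟨spacePoint (a.1.1 i) 0, spacePoint_mem_weavingLine.mpr (by simp)⟩
  finrank_direction i := by
    rw [direction_weavingLine, finrank_span_singleton]
    intro h
    have := congrFun (congrArg WithLp.ofLp h) 2
    simp [spacePoint] at this
  skew i j hij := by
    constructor
    · rw [Set.disjoint_left]
      intro q hi hj
      rw [SetLike.mem_coe, mem_weavingLine] at hi hj
      refine a.2 i j hij (planeDet_eq_zero_of_smul_eq (α := 1) (β := -q 2) (Or.inl one_ne_zero) ?_)
      ext k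
      fin_cases k
      · simp; linarith [hi.1, hj.1]
      · simp; linarith [hi.2, hj.2]
    · intro h
      have hd := h.direction_eq
      rw [direction_weavingLine, direction_weavingLine] at hd
      have hmem : spacePoint (a.1.2 i) 1 ∈ Submodule.span ℝ {spacePoint (a.1.2 j) 1} :=
        hd ▸ Submodule.mem_span_singleton_self _
      obtain ⟨t, ht⟩ := Submodule.mem_span_singleton.mp hmem
      have h0 := congrFun (congrArg WithLp.ofLp ht) 0
      have h1 := congrFun (congrArg WithLp.ofLp ht) 1
      have h2 := congrFun (congrArg WithLp.ofLp ht) 2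
      simp [spacePoint] at h0 h1 h2
      subst h2
      refine hij (a.injective_velocity ?_)
      ext k
      fin_cases k
      · simpa using h0.symm
      · simpa using h1.symm

theorem Weaving.ext_line {W W' : Weaving n} (h : ∀ i, W.line i = W'.line i) : W = W' := by
  cases W
  cases W'
  congr
  exact funext h

theorem SkewPair.toWeaving_injective :
    Function.Injective (SkewPair.toWeaving : SkewPair n → Weaving n) := by
  intro a a' h
  have hi : ∀ i, weavingLine (a.1.1 i) (a.1.2 i) = weavingLine (a'.1.1 i) (a'.1.2 i) :=
    fun i => congrArg (fun W : Weaving n => W.line i) h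
  exact Subtype.ext (Prod.ext (funext fun i => (weavingLine_inj.mp (hi i)).1)
    (funext fun i => (weavingLine_inj.mp (hi i)).2))

theorem SkewPair.isUpright_toWeaving (a : SkewPair n) : a.toWeaving.IsUpright := fun i =>
  ⟨spacePoint (a.1.2 i) 1, by
    change _ ∈ (weavingLine _ _).direction
    rw [direction_weavingLine]
    exact Submodule.mem_span_singleton_self _, by simp [spacePoint]⟩

/-- Lines of a weaving that are given by positions and velocities have skew coordinates. -/
theorem exists_skewPair_of_line_eq {W : Weaving n} {p v : Fin n → Plane}
    (h : ∀ i, W.line i = weavingLine (p i) (v i)) :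
    ∃ a : SkewPair n, a.1 = (p, v) ∧ a.toWeaving = W := by
  refine ⟨⟨(p, v), fun i j hij h0 => ?_⟩, rfl, Weaving.ext_line fun i => (h i).symm⟩
  obtain ⟨hdisj, hpar⟩ := W.skew i j hij
  rw [h, h] at hdisj hpar
  by_cases hv : v i = v j
  · refine hpar ((AffineSubspace.parallel_iff_direction_eq_and_eq_bot_iff_eq_bot).mpr ⟨?_, ?_⟩)
    · rw [direction_weavingLine, direction_weavingLine, hv]
    · have hne : ∀ p v : Plane, weavingLine p v ≠ ⊥ := fun p v =>
        (AffineSubspace.nonempty_iff_ne_bot _).mp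
          ⟨spacePoint p 0, spacePoint_mem_weavingLine.mpr (by simp)⟩
      simp [hne]
  · -- the lines meet at the height at which the relative positions vanish
    have hex : ∃ t : ℝ, p i + t • v i = p j + t • v j := by
      have hne : v i 0 - v j 0 ≠ 0 ∨ v i 1 - v j 1 ≠ 0 := by
        by_contra hc
        push Not at hc
        apply hv
        ext k
        fin_cases k
        · exact sub_eq_zero.mp hc.1
        · exact sub_eq_zero.mp hc.2
      simp only [planeDet, PiLp.sub_apply] at h0
      rcases hne with h1 | h1
      · refine ⟨-(p i 0 - p j 0) / (v i 0 - v j 0), ?_⟩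
        ext k
        fin_cases k
        · simp; field_simp; ring
        · simp; field_simp; linear_combination -h0
      · refine ⟨-(p i 1 - p j 1) / (v i 1 - v j 1), ?_⟩
        ext k
        fin_cases k
        · simp; field_simp; linear_combination h0
        · simp; field_simp; ring
    obtain ⟨t, ht⟩ := hex
    exact Set.disjoint_left.mp hdisj (spacePoint_mem_weavingLine.mpr rfl)
      (spacePoint_mem_weavingLine.mpr ht)

theorem Weaving.IsUpright.exists_skewPair {W : Weaving n} (hW : W.IsUpright) :
    ∃ a : SkewPair n, a.toWeaving = W := by
  choose b hb using W.nonempty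
  choose d hd hd2 using hW
  have hline : ∀ i, W.line i = weavingLine _ _ := fun i => by
    rw [← AffineSubspace.mk'_eq (hb i), ← mk'_span_eq_weavingLine (b i) (d i) (hd2 i)]
    congr 1
    refine (Submodule.eq_of_le_of_finrank_eq ?_ ?_).symm
    · rw [Submodule.span_singleton_le_iff_mem]
      exact hd i
    · rw [W.finrank_direction, finrank_span_singleton]
      intro h
      exact hd2 i (by rw [h]; rfl)
  obtain ⟨a, -, ha⟩ := exists_skewPair_of_line_eq hline
  exact ⟨a, ha⟩

theorem SkewPair.isHorizontalMotion_iff (a : SkewPair n) (D : ℝ → Fin n → Plane) :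
    a.toWeaving.IsHorizontalMotion D ↔ D = fun t => a.1.1 + t • a.1.2 := by
  have h : a.toWeaving.IsHorizontalMotion D ↔ ∀ t i, D t i = a.1.1 i + t • a.1.2 i :=
    forall_congr' fun t => forall_congr' fun i => spacePoint_mem_weavingLine
  rw [h]
  constructor
  · exact fun h => funext fun t => funext fun i => h t i
  · rintro rfl t i
    rfl

theorem existsUnique_horizontalMotion {W : Weaving n} (hW : W.IsUpright) :
    ∃! D : ℝ → Fin n → Plane, W.IsHorizontalMotion D := by
  obtain ⟨a, rfl⟩ := hW.exists_skewPair
  exact ⟨_, (a.isHorizontalMotion_iff _).mpr rfl, fun D hD => (a.isHorizontalMotion_iff D).mp hD⟩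

theorem sup_span_spacePoint_eq_top_iff {u v w : Plane} (huv : u ≠ v) :
    Submodule.span ℝ {spacePoint u 1} ⊔ Submodule.span ℝ {spacePoint v 1} ⊔
      Submodule.span ℝ {spacePoint w 1} = ⊤ ↔ signedArea u v w ≠ 0 := by
  constructor
  · intro h h0
    -- a linear functional that vanishes on the three vectors
    let f : Space →ₗ[ℝ] ℝ :=
      { toFun := fun q => (q 0 - q 2 * u 0) * (v 1 - u 1) - (q 1 - q 2 * u 1) * (v 0 - u 0)
        map_add' := fun q q' => by simp; ring
        map_smul' := fun r q => by simp; ring }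
    have hle : (⊤ : Submodule ℝ Space) ≤ LinearMap.ker f := by
      rw [← h, sup_le_iff, sup_le_iff]
      simp only [Submodule.span_singleton_le_iff_mem, LinearMap.mem_ker]
      simp only [signedArea] at h0
      refine ⟨⟨?_, ?_⟩, ?_⟩
      · simp [f, spacePoint]
      · simp [f, spacePoint]; ring
      · simp [f, spacePoint]; linarith
    have h1 : f !₂[1, 0, 0] = 0 := LinearMap.mem_ker.mp (hle trivial)
    have h2 : f !₂[0, 1, 0] = 0 := LinearMap.mem_ker.mp (hle trivial)
    simp [f] at h1 h2
    apply huv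
    ext k
    fin_cases k
    · simp; linarith
    · simp; linarith
  · intro h
    rw [eq_top_iff]
    intro q _
    set β := ((q 0 - q 2 * u 0) * (w 1 - u 1) - (q 1 - q 2 * u 1) * (w 0 - u 0)) /
      signedArea u v w with hβ
    set γ := ((v 0 - u 0) * (q 1 - q 2 * u 1) - (v 1 - u 1) * (q 0 - q 2 * u 0)) /
      signedArea u v w with hγ
    have hβ' : β * signedArea u v w = _ := div_mul_cancel₀ _ h
    have hγ' : γ * signedArea u v w = _ := div_mul_cancel₀ _ h
    have hq : q = (q 2 - β - γ) • spacePoint u 1 + β • spacePoint v 1 + γ • spacePoint w 1 := by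
      ext k
      fin_cases k
      · simp [spacePoint]
        refine mul_right_cancel₀ h ?_
        have : ((q 2 - β - γ) * u 0 + β * v 0 + γ * w 0) * signedArea u v w =
            q 2 * u 0 * signedArea u v w + (β * signedArea u v w) * (v 0 - u 0) +
              (γ * signedArea u v w) * (w 0 - u 0) := by ring
        rw [this, hβ', hγ', signedArea]
        ring
      · simp [spacePoint]
        refine mul_right_cancel₀ h ?_
        have : ((q 2 - β - γ) * u 1 + β * v 1 + γ * w 1) * signedArea u v w =
            q 2 * u 1 * signedArea u v w + (β * signedArea u v w) * (v 1 - u 1) +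
              (γ * signedArea u v w) * (w 1 - u 1) := by ring
        rw [this, hβ', hγ', signedArea]
        ring
      · simp [spacePoint]; ring
    rw [hq]
    refine Submodule.add_mem_sup (Submodule.add_mem_sup ?_ ?_) ?_ <;>
      exact Submodule.smul_mem _ _ (Submodule.mem_span_singleton_self _)

theorem SkewPair.noThreeCoplanarDirections_iff (a : SkewPair n) :
    a.toWeaving.NoThreeCoplanarDirections ↔ NoThreeCollinear a.1.2 := by
  rw [noThreeCollinear_iff a.injective_velocity]
  refine forall_congr' fun i => forall_congr' fun j => forall_congr' fun l =>
    forall_congr' fun hij => forall_congr' fun _ => forall_congr' fun _ => ?_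
  change (weavingLine _ _).direction ⊔ (weavingLine _ _).direction ⊔
    (weavingLine _ _).direction = ⊤ ↔ _
  rw [direction_weavingLine, direction_weavingLine, direction_weavingLine]
  exact sup_span_spacePoint_eq_top_iff fun h => hij (a.injective_velocity h)

/-! ### Isotopies in coordinates -/

theorem exists_path_of_isotopicThrough {A : Weaving n → Prop} (hA : ∀ V, A V → V.IsUpright)
    {a a' : SkewPair n} (h : Weaving.IsotopicThrough A a.toWeaving a'.toWeaving) :
    ∃ c : Path a a', ∀ s, A (c s).toWeaving := by
  obtain ⟨F, hF0, hF1, hFA, b, d, hb, hd, hF⟩ := h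
  have hd2 : ∀ s i, d s i 2 ≠ 0 := by
    intro s i h0
    obtain ⟨e, he, he2⟩ := hA _ (hFA s) i
    rw [hF, AffineSubspace.direction_mk', Submodule.mem_span_singleton] at he
    obtain ⟨t, rfl⟩ := he
    exact he2 (by simp [h0])
  choose c hc hcF using fun s => exists_skewPair_of_line_eq (W := F s)
    fun i => (hF s i).trans (mk'_span_eq_weavingLine _ _ (hd2 s i))
  have hcont : Continuous c := by
    refine Topology.IsInducing.subtypeVal.continuous_iff.mpr ?_
    have hbi : ∀ i k, Continuous fun s => b s i k := fun i k => by
      have := (continuous_apply i).comp hb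
      fun_prop
    have hdi : ∀ i k, Continuous fun s => d s i k := fun i k => by
      have := (continuous_apply i).comp hd
      fun_prop
    have hq : ∀ i k, Continuous fun s => d s i k / d s i 2 := fun i k =>
      (hdi i k).div (hdi i 2) fun s => hd2 s i
    refine Continuous.congr ?_ fun s => (hc s).symm
    refine Continuous.prodMk (continuous_pi fun i => ?_) (continuous_pi fun i => ?_)
    · have h1 := (hbi i 0).sub ((hbi i 2).mul (hq i 0))
      have h2 := (hbi i 1).sub ((hbi i 2).mul (hq i 1))
      fun_prop
    · have h1 := hq i 0
      have h2 := hq i 1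
      fun_prop
  refine ⟨⟨⟨c, hcont⟩, SkewPair.toWeaving_injective ((hcF 0).trans hF0),
    SkewPair.toWeaving_injective ((hcF 1).trans hF1)⟩, fun s => ?_⟩
  change A (c s).toWeaving
  rw [hcF]
  exact hFA s

theorem isotopicThrough_of_path {A : Weaving n → Prop} {a a' : SkewPair n} (c : Path a a')
    (h : ∀ s, A (c s).toWeaving) : Weaving.IsotopicThrough A a.toWeaving a'.toWeaving := by
  have hc : Continuous fun s => (c s).1 := continuous_subtype_val.comp c.continuous
  have h1 : ∀ i, Continuous fun s => (c s).1.1 i := fun i =>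
    (continuous_apply i).comp (continuous_fst.comp hc)
  have h2 : ∀ i, Continuous fun s => (c s).1.2 i := fun i =>
    (continuous_apply i).comp (continuous_snd.comp hc)
  refine ⟨fun s => (c s).toWeaving, by simp, by simp, h,
    fun s i => spacePoint ((c s).1.1 i) 0, fun s i => spacePoint ((c s).1.2 i) 1,
    continuous_pi fun i => ?_, continuous_pi fun i => ?_, fun s i => rfl⟩
  · have := h1 i
    unfold spacePoint
    fun_prop
  · have := h2 i
    unfold spacePoint
    fun_prop

theorem isOpen_skewPair : IsOpen {a : (Fin n → Plane) × (Fin n → Plane) |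
    ∀ i j, i ≠ j → planeDet (a.1 i - a.1 j) (a.2 i - a.2 j) ≠ 0} := by
  have : {a : (Fin n → Plane) × (Fin n → Plane) |
      ∀ i j, i ≠ j → planeDet (a.1 i - a.1 j) (a.2 i - a.2 j) ≠ 0} =
      ⋂ q : {q : Fin n × Fin n // q.1 ≠ q.2},
        {a | planeDet (a.1 q.1.1 - a.1 q.1.2) (a.2 q.1.1 - a.2 q.1.2) ≠ 0} := by
    ext a
    simp
  rw [this]
  refine isOpen_iInter_of_finite fun q => isOpen_ne_fun ?_ continuous_const
  simp only [planeDet, PiLp.sub_apply]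
  fun_prop

end WeavingCoordinates

/-! ### Rescaled motions and changes of time -/

section Rescaling

variable {n : ℕ}

theorem collinearOn_smul_iff {c : ℝ} (hc : c ≠ 0) (z : Fin n → Plane) (s : Finset (Fin n)) :
    CollinearOn (c • z) s ↔ CollinearOn z s := by
  have h : ∀ (c : ℝ) (z : Fin n → Plane), CollinearOn z s → CollinearOn (c • z) s := by
    intro c z h
    obtain ⟨p, v, hpv⟩ := (collinear_iff_exists_forall_eq_smul_vadd _).mp h
    refine (collinear_iff_exists_forall_eq_smul_vadd _).mpr ⟨c • p, c • v, ?_⟩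
    rintro _ ⟨i, hi, rfl⟩
    obtain ⟨r, hr⟩ := hpv _ ⟨i, hi, rfl⟩
    refine ⟨r, ?_⟩
    rw [Pi.smul_apply, hr, vadd_eq_add, vadd_eq_add, smul_add, smul_comm]
  refine ⟨fun h' => ?_, h c z⟩
  simpa [smul_smul, hc] using h c⁻¹ _ h'

theorem noThreeCollinear_smul_iff {c : ℝ} (hc : c ≠ 0) (z : Fin n → Plane) :
    NoThreeCollinear (c • z) ↔ NoThreeCollinear z :=
  forall_congr' fun m => not_congr (collinearOn_smul_iff hc z m.1)

theorem noThreeCollinear_neg_iff (z : Fin n → Plane) :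
    NoThreeCollinear (-z) ↔ NoThreeCollinear z := by
  rw [← noThreeCollinear_smul_iff (neg_ne_zero.mpr one_ne_zero) z, neg_one_smul]

theorem signedArea_smul (c : ℝ) (u v w : Plane) :
    signedArea (c • u) (c • v) (c • w) = c ^ 2 * signedArea u v w := by
  simp only [signedArea, PiLp.smul_apply, smul_eq_mul]
  ring

variable {T T' : Type*} {D : T → Fin n → Plane} {D' : T' → Fin n → Plane} {φ : T → T'} {r : T → ℝ}

theorem trisecant_iff_of_rescaled (hr : ∀ t, r t ≠ 0) (hD : ∀ t, D' (φ t) = r t • D t) (t : T)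
    (m : MultiIndex n 3) : trisecant D' (φ t) m.1 ↔ trisecant D t m.1 := by
  rw [trisecant, hD]
  exact collinearOn_smul_iff (hr t) _ _

variable [LinearOrder T] [LinearOrder T']

/-- Pleasantness is not affected by rescaling the plane at each moment, nor by an increasing
change of time that reaches all critical moments. -/
theorem isPleasant_iff_of_rescaled (hφ : StrictMono φ) (hr : ∀ t, r t ≠ 0)
    (hD : ∀ t, D' (φ t) = r t • D t) (hrange : ∀ t', NoThreeCollinear (D' t') ∨ t' ∈ Set.range φ) :
    IsPleasant 3 (trisecant D') ↔ IsPleasant 3 (trisecant D) := by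
  have hQ := trisecant_iff_of_rescaled hr hD
  have himage : criticalMoments 3 (trisecant D') = φ '' criticalMoments 3 (trisecant D) := by
    ext t'
    constructor
    · rintro ⟨m, hm⟩
      obtain ⟨t, rfl⟩ := (hrange t').resolve_left fun h => h m hm
      exact ⟨t, ⟨m, (hQ t m).mp hm⟩, rfl⟩
    · rintro ⟨t, ⟨m, hm⟩, rfl⟩
      exact ⟨m, (hQ t m).mpr hm⟩
  rw [IsPleasant, IsPleasant, himage, Set.finite_image_iff hφ.injective.injOn, Set.forall_mem_image]
  simp only [hQ]

theorem typeOf_eq_of_rescaled (hφ : StrictMono φ) (hr : ∀ t, r t ≠ 0)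
    (hD : ∀ t, D' (φ t) = r t • D t) (hrange : ∀ t', NoThreeCollinear (D' t') ∨ t' ∈ Set.range φ)
    (h : IsPleasant 3 (trisecant D)) (h' : IsPleasant 3 (trisecant D')) : typeOf h = typeOf h' :=
  typeOf_eq_of_strictMono h h' hφ (trisecant_iff_of_rescaled hr hD) fun t' m hm =>
    (hrange t').resolve_left fun h => h m hm

variable [TopologicalSpace T] [OrderTopology T] [TopologicalSpace T'] [OrderTopology T']

theorem StrictMono.map_nhdsLT_eq (hφ : StrictMono φ) (hord : (Set.range φ).OrdConnected)
    (hopen : IsOpen (Set.range φ)) (t : T) : Filter.map φ (𝓝[<] t) = 𝓝[<] (φ t) := by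
  rw [(hφ.isEmbedding_of_ordConnected hord).map_nhdsWithin_eq]
  have : φ '' Set.Iio t = Set.Iio (φ t) ∩ Set.range φ := by
    ext u
    constructor
    · rintro ⟨s, hs, rfl⟩
      exact ⟨hφ hs, s, rfl⟩
    · rintro ⟨hu, s, rfl⟩
      exact ⟨s, hφ.lt_iff_lt.mp hu, rfl⟩
  rw [this]
  exact nhdsWithin_inter_of_mem' (mem_nhdsWithin_of_mem_nhds (hopen.mem_nhds ⟨t, rfl⟩))

theorem StrictMono.map_nhdsGT_eq (hφ : StrictMono φ) (hord : (Set.range φ).OrdConnected)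
    (hopen : IsOpen (Set.range φ)) (t : T) : Filter.map φ (𝓝[>] t) = 𝓝[>] (φ t) := by
  rw [(hφ.isEmbedding_of_ordConnected hord).map_nhdsWithin_eq]
  have : φ '' Set.Ioi t = Set.Ioi (φ t) ∩ Set.range φ := by
    ext u
    constructor
    · rintro ⟨s, hs, rfl⟩
      exact ⟨hφ hs, s, rfl⟩
    · rintro ⟨hu, s, rfl⟩
      exact ⟨s, hφ.lt_iff_lt.mp hu, rfl⟩
  rw [this]
  exact nhdsWithin_inter_of_mem' (mem_nhdsWithin_of_mem_nhds (hopen.mem_nhds ⟨t, rfl⟩))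

theorem isStable_iff_of_rescaled (hφ : StrictMono φ) (hord : (Set.range φ).OrdConnected)
    (hopen : IsOpen (Set.range φ)) (hr : ∀ t, r t ≠ 0)
    (hD : ∀ t, D' (φ t) = r t • D t) (hrange : ∀ t', NoThreeCollinear (D' t') ∨ t' ∈ Set.range φ) :
    IsStable D' ↔ IsStable D := by
  have hpos : ∀ t i j l, 0 < signedArea (D' (φ t) i) (D' (φ t) j) (D' (φ t) l) ↔
      0 < signedArea (D t i) (D t j) (D t l) := fun t i j l => by
    simp only [hD, Pi.smul_apply, signedArea_smul]
    exact mul_pos_iff_of_pos_left (sq_pos_iff.mpr (hr t))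
  have hneg : ∀ t i j l, signedArea (D' (φ t) i) (D' (φ t) j) (D' (φ t) l) < 0 ↔
      signedArea (D t i) (D t j) (D t l) < 0 := fun t i j l => by
    simp only [hD, Pi.smul_apply, signedArea_smul]
    exact smul_neg_iff_of_pos_left (sq_pos_iff.mpr (hr t))
  have key : ∀ t, (∀ m : MultiIndex n 3, trisecant D' (φ t) m.1 → ∀ i j l : Fin n, m.1 = {i, j, l} →
      ((∀ᶠ s in 𝓝[<] (φ t), signedArea (D' s i) (D' s j) (D' s l) < 0) ∧
        (∀ᶠ s in 𝓝[>] (φ t), 0 < signedArea (D' s i) (D' s j) (D' s l))) ∨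
      ((∀ᶠ s in 𝓝[<] (φ t), 0 < signedArea (D' s i) (D' s j) (D' s l)) ∧
        (∀ᶠ s in 𝓝[>] (φ t), signedArea (D' s i) (D' s j) (D' s l) < 0))) ↔
      (∀ m : MultiIndex n 3, trisecant D t m.1 → ∀ i j l : Fin n, m.1 = {i, j, l} →
      ((∀ᶠ s in 𝓝[<] t, signedArea (D s i) (D s j) (D s l) < 0) ∧
        (∀ᶠ s in 𝓝[>] t, 0 < signedArea (D s i) (D s j) (D s l))) ∨
      ((∀ᶠ s in 𝓝[<] t, 0 < signedArea (D s i) (D s j) (D s l)) ∧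
        (∀ᶠ s in 𝓝[>] t, signedArea (D s i) (D s j) (D s l) < 0))) := by
    intro t
    simp only [← hφ.map_nhdsLT_eq hord hopen, ← hφ.map_nhdsGT_eq hord hopen, Filter.eventually_map,
      hpos, hneg, trisecant_iff_of_rescaled hr hD]
  constructor
  · exact fun h t => (key t).mp (h (φ t))
  · intro h t' m hm
    obtain ⟨t, rfl⟩ := (hrange t').resolve_left fun h => h m hm
    exact (key t).mpr (h t) m hm

end Rescaling

/-! ### The change of time for weavings -/

section TimeChange

/-- The value of `2 (1 - u) / u` for the moment `u` of the unit interval that corresponds to the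
height `t`: the positive root of `q ^ 2 + 2 t q = 4`. -/
noncomputable def timeRatio (t : ℝ) : ℝ := √(t ^ 2 + 4) - t

theorem timeRatio_pos (t : ℝ) : 0 < timeRatio t := by
  have : |t| < √(t ^ 2 + 4) := by
    rw [← Real.sqrt_sq_eq_abs]
    exact Real.sqrt_lt_sqrt (sq_nonneg t) (by linarith)
  exact sub_pos.mpr ((le_abs_self t).trans_lt this)

theorem timeRatio_sq (t : ℝ) : timeRatio t ^ 2 = 4 - 2 * t * timeRatio t := by
  have : √(t ^ 2 + 4) ^ 2 = t ^ 2 + 4 := Real.sq_sqrt (by positivity)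
  rw [timeRatio]
  linear_combination this

/-- The increasing bijection of the line of heights onto the interior of the unit interval that
solves `t = (2 u - 1) / (u (1 - u))`. -/
noncomputable def timeChange (t : ℝ) : unitInterval :=
  ⟨2 / (2 + timeRatio t), by
    have := timeRatio_pos t
    exact ⟨by positivity, (div_le_one (by positivity)).mpr (by linarith)⟩⟩

theorem timeChange_mul_pos (t : ℝ) : 0 < (timeChange t : ℝ) * (1 - timeChange t) := by
  have := timeRatio_pos t
  have h : (timeChange t : ℝ) * (1 - timeChange t) =
      2 * timeRatio t / (2 + timeRatio t) ^ 2 := by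
    rw [timeChange]
    field_simp
    ring
  rw [h]
  positivity

theorem two_mul_timeChange_sub_one (t : ℝ) :
    2 * (timeChange t : ℝ) - 1 = (timeChange t : ℝ) * (1 - timeChange t) * t := by
  have h0 := timeRatio_pos t
  have h1 := timeRatio_sq t
  rw [timeChange]
  field_simp
  linear_combination -h1

theorem strictMono_timeChange : StrictMono timeChange := by
  intro s t hst
  have hs := timeRatio_pos s
  have ht := timeRatio_pos t
  have hs2 := timeRatio_sq s
  have ht2 := timeRatio_sq t
  have hlt : timeRatio t < timeRatio s := by
    by_contra! hle
    have hpos : 0 < timeRatio s * timeRatio t * ((timeRatio t + 2 * t) - (timeRatio s + 2 * s)) :=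
      mul_pos (mul_pos hs ht) (by linarith)
    have heq : timeRatio s * timeRatio t * ((timeRatio t + 2 * t) - (timeRatio s + 2 * s)) =
        4 * (timeRatio s - timeRatio t) := by
      linear_combination timeRatio s * ht2 - timeRatio t * hs2
    linarith
  exact Subtype.mk_lt_mk.mpr (div_lt_div_of_pos_left two_pos (by positivity) (by linarith))

theorem range_timeChange : Set.range timeChange = Set.Ioo 0 1 := by
  ext u
  constructor
  · rintro ⟨t, rfl⟩
    have h := timeChange_mul_pos t
    have h0 := (timeChange t).2.1
    have h1 := (timeChange t).2.2
    refine ⟨lt_of_le_of_ne h0 fun h' => ?_, lt_of_le_of_ne h1 fun h' => ?_⟩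
    · rw [← h'] at h
      simp at h
    · rw [h'] at h
      simp at h
  · rintro ⟨h0, h1⟩
    have h0' : (0 : ℝ) < u := h0
    have h1' : (0 : ℝ) < 1 - u := sub_pos.mpr h1
    set t : ℝ := (2 * u - 1) / (u * (1 - u)) with ht
    have hsq : t ^ 2 + 4 = (2 * (1 - u) / u + t) ^ 2 := by
      rw [ht]
      field_simp
      ring
    have hnn : 0 ≤ 2 * (1 - u) / u + t := by
      have : 2 * (1 - u) / u + t = (2 * (1 - u) ^ 2 + (2 * u - 1)) / (u * (1 - u)) := by
        rw [ht]
        field_simp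
      rw [this]
      refine div_nonneg ?_ (by positivity)
      nlinarith [sq_nonneg (u : ℝ)]
    have hratio : timeRatio t = 2 * (1 - u) / u := by
      rw [timeRatio, hsq, Real.sqrt_sq hnn, add_sub_cancel_right]
    refine ⟨t, Subtype.ext ?_⟩
    change 2 / (2 + timeRatio t) = (u : ℝ)
    rw [hratio]
    field_simp
    ring

end TimeChange

/-! ### The holonomy of an upright weaving -/

section WeavingHolonomy

variable {n : ℕ}

/-- The horizontal motion of a weaving, rescaled and continued to both infinite heights: at the
moment `u` the points are at `u (1 - u) p + (2 u - 1) v`. -/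
noncomputable def weavingConfig (a : SkewPair n) (u : unitInterval) : Config n :=
  ⟨((u : ℝ) * (1 - u)) • a.1.1 + (2 * (u : ℝ) - 1) • a.1.2, fun i j h => by
    by_contra hij
    refine a.2 i j hij (planeDet_eq_zero_of_smul_eq (α := (u : ℝ) * (1 - u)) (β :=
        -(2 * (u : ℝ) - 1))
      ?_ ?_)
    · by_cases hu : (u : ℝ) * (1 - u) = 0
      · right
        rcases mul_eq_zero.mp hu with h0 | h1
        · rw [h0]
          norm_num
        · rw [show (u : ℝ) = 1 by linarith]
          norm_num
      · exact Or.inl hu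
    · simp only [Pi.add_apply, Pi.smul_apply] at h
      rw [smul_sub, neg_smul, smul_sub, sub_eq_iff_eq_add, ← sub_eq_zero]
      rw [← sub_eq_zero] at h
      rw [← h]
      abel⟩

theorem weavingConfig_zero (a : SkewPair n) : (weavingConfig a 0).1 = -a.1.2 := by
  simp [weavingConfig]

theorem weavingConfig_one (a : SkewPair n) : (weavingConfig a 1).1 = a.1.2 := by
  simp only [weavingConfig, Set.Icc.coe_one]
  norm_num

theorem continuous_weavingConfig :
    Continuous fun q : SkewPair n × unitInterval => weavingConfig q.1 q.2 := by
  refine Continuous.subtype_mk ?_ _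
  have h1 : Continuous fun q : SkewPair n × unitInterval => q.1.1.1 := by fun_prop
  have h2 : Continuous fun q : SkewPair n × unitInterval => q.1.1.2 := by fun_prop
  have h3 : Continuous fun q : SkewPair n × unitInterval => (q.2 : ℝ) := by fun_prop
  exact ((h3.mul (continuous_const.sub h3)).smul h1).add
    (((continuous_const.mul h3).sub continuous_const).smul h2)

/-- The motion of a weaving as a path in the configuration space. -/
noncomputable def weavingPath (a : SkewPair n) : Path (weavingConfig a 0) (weavingConfig a 1) where
  toFun := weavingConfig a
  continuous_toFun := continuous_weavingConfig.comp (Continuous.prodMk_right a)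
  source' := rfl
  target' := rfl

theorem weavingConfig_timeChange (a : SkewPair n) (t : ℝ) :
    (weavingConfig a (timeChange t)).1 =
      ((timeChange t : ℝ) * (1 - timeChange t)) • (a.1.1 + t • a.1.2) := by
  change ((timeChange t : ℝ) * (1 - timeChange t)) • a.1.1 +
    (2 * (timeChange t : ℝ) - 1) • a.1.2 = _
  rw [two_mul_timeChange_sub_one, smul_add, smul_smul]

theorem noThreeCollinear_weavingConfig_or_mem_range (a : SkewPair n) (ha : NoThreeCollinear a.1.2)
    (u : unitInterval) : NoThreeCollinear (motion (weavingPath a) u) ∨ u ∈ Set.range timeChange :=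
        by
  rw [range_timeChange]
  by_cases h0 : u = 0
  · left
    subst h0
    change NoThreeCollinear (weavingConfig a 0).1
    rw [weavingConfig_zero, noThreeCollinear_neg_iff]
    exact ha
  by_cases h1 : u = 1
  · left
    subst h1
    change NoThreeCollinear (weavingConfig a 1).1
    rw [weavingConfig_one]
    exact ha
  · exact Or.inr ⟨unitInterval.pos_iff_ne_zero.mpr h0, unitInterval.lt_one_iff_ne_one.mpr h1⟩

theorem isPleasant_weavingPath_iff (a : SkewPair n) (ha : NoThreeCollinear a.1.2) :
    IsPleasant 3 (trisecant (motion (weavingPath a))) ↔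
      IsPleasant 3 (trisecant fun t : ℝ => a.1.1 + t • a.1.2) :=
  isPleasant_iff_of_rescaled strictMono_timeChange (fun t => (timeChange_mul_pos t).ne')
    (weavingConfig_timeChange a) (noThreeCollinear_weavingConfig_or_mem_range a ha)

theorem isStable_weavingPath_iff (a : SkewPair n) (ha : NoThreeCollinear a.1.2) :
    IsStable (motion (weavingPath a)) ↔ IsStable fun t : ℝ => a.1.1 + t • a.1.2 :=
  isStable_iff_of_rescaled strictMono_timeChange (range_timeChange ▸ Set.ordConnected_Ioo)
    (range_timeChange ▸ isOpen_Ioo) (fun t => (timeChange_mul_pos t).ne')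
    (weavingConfig_timeChange a) (noThreeCollinear_weavingConfig_or_mem_range a ha)

/-- The invariant of an upright weaving, in terms of its coordinates. -/
noncomputable def weavingHolonomy (a : SkewPair n) : FreeBraidGroup n 3 :=
  holonomy (Path.Homotopic.Quotient.mk (weavingPath a))

theorem noThreeCollinear_weavingConfig_zero {a : SkewPair n} (ha : NoThreeCollinear a.1.2) :
    NoThreeCollinear (weavingConfig a 0).1 := by
  rw [weavingConfig_zero, noThreeCollinear_neg_iff]
  exact ha

theorem noThreeCollinear_weavingConfig_one {a : SkewPair n} (ha : NoThreeCollinear a.1.2) :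
    NoThreeCollinear (weavingConfig a 1).1 := by
  rw [weavingConfig_one]
  exact ha

theorem weavingHolonomy_eq (a : SkewPair n) (ha : NoThreeCollinear a.1.2)
    (h : IsPleasant 3 (trisecant fun t : ℝ => a.1.1 + t • a.1.2))
    (hst : IsStable fun t : ℝ => a.1.1 + t • a.1.2) :
    weavingHolonomy a = freeBraid (typeOf h) := by
  have h' := (isPleasant_weavingPath_iff a ha).mpr h
  rw [weavingHolonomy, holonomy_mk (noThreeCollinear_weavingConfig_zero ha)
    (noThreeCollinear_weavingConfig_one ha) _ h' ((isStable_weavingPath_iff a ha).mpr hst)]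
  rw [typeOf_eq_of_rescaled strictMono_timeChange (fun t => (timeChange_mul_pos t).ne')
    (weavingConfig_timeChange a) (noThreeCollinear_weavingConfig_or_mem_range a ha) h h']

/-! ### General position of weavings -/

/-- Small displacements of the coordinates of a weaving are joined to it by a segment. -/
theorem SkewPair.exists_forall_path (a : SkewPair n) : ∃ ε > 0, ∀ b, ‖b - a.1‖ < ε →
    ∃ a' : SkewPair n, a'.1 = b ∧ ∃ c : Path a a', ∀ s, (c s).1 = a.1 + (s : ℝ) • (b - a.1) := by
  obtain ⟨ε, hε, hball⟩ := Metric.isOpen_iff.mp isOpen_skewPair a.1 a.2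
  refine ⟨ε, hε, fun b hb => ?_⟩
  have hmem : ∀ s : unitInterval, a.1 + (s : ℝ) • (b - a.1) ∈ Metric.ball a.1 ε := fun s => by
    rw [mem_ball_iff_norm, add_sub_cancel_left, norm_smul, Real.norm_eq_abs, abs_of_nonneg s.2.1]
    exact lt_of_le_of_lt (mul_le_of_le_one_left (norm_nonneg _) s.2.2) hb
  refine ⟨⟨b, hball (mem_ball_iff_norm.mpr hb)⟩, rfl,
    { toFun := fun s => ⟨_, hball (hmem s)⟩
      continuous_toFun := Continuous.subtype_mk (by fun_prop) _
      source' := Subtype.ext (by simp)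
      target' := Subtype.ext (by simp) }, fun s => rfl⟩

theorem SkewPair.exists_path_generic (a : SkewPair n) :
    ∃ a' : SkewPair n, NoThreeCollinear a'.1.2 ∧ Nonempty (Path a a') := by
  obtain ⟨ε, hε, hpath⟩ := a.exists_forall_path
  have := nhdsWithin_noThreeCollinear_neBot a.1.2
  obtain ⟨v, hv, hvε⟩ := (Filter.nonempty_of_mem (Filter.inter_mem self_mem_nhdsWithin
    (mem_nhdsWithin_of_mem_nhds (Metric.ball_mem_nhds a.1.2 hε)) :
      {p | NoThreeCollinear p} ∩ Metric.ball a.1.2 ε ∈ 𝓝[{p | NoThreeCollinear p}] a.1.2))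
  obtain ⟨a', ha', c, -⟩ := hpath (a.1.1, v) (by
    rw [Prod.norm_def]
    simpa [hε] using mem_ball_iff_norm.mp hvε)
  exact ⟨a', by rw [ha']; exact hv, ⟨c⟩⟩

section

open Polynomial

/-- The motion of a weaving as a polynomial motion. -/
noncomputable def weavingPoly (a : (Fin n → Plane) × (Fin n → Plane)) : Fin n → Fin 2 → ℝ[X] :=
  fun i k => X * (1 - X) * C (a.1 i k) + (2 * X - 1) * C (a.2 i k)

theorem polyMotion_weavingPoly (a : SkewPair n) (u : unitInterval) :
    polyMotion (weavingPoly a.1) u = (weavingConfig a u).1 := by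
  ext i k
  fin_cases k <;> simp [polyMotion, weavingPoly, weavingConfig]

theorem perturb_weavingPoly (p v w : Fin n → Plane) :
    perturb (weavingPoly (p, v)) w = weavingPoly (p + w, v) := by
  funext i k
  simp only [perturb, weavingPoly, Pi.add_apply, PiLp.add_apply, C_add]
  ring

end

/-- A weaving with generic directions is deformed into one with a pleasant stable motion by
translating its lines. -/
theorem SkewPair.exists_path_pleasant_stable (a : SkewPair n) (ha : NoThreeCollinear a.1.2) :
    ∃ (a' : SkewPair n) (c : Path a a'), (∀ s, (c s).1.2 = a.1.2) ∧
      IsPleasant 3 (trisecant fun t : ℝ => a'.1.1 + t • a'.1.2) ∧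
      IsStable fun t : ℝ => a'.1.1 + t • a'.1.2 := by
  obtain ⟨ε, hε, hpath⟩ := a.exists_forall_path
  have hend : ∀ t : ℝ, t * (1 - t) = 0 → ∀ i j l : Fin n, i ≠ j → i ≠ l → j ≠ l →
      (polyArea (weavingPoly a.1) i j l).eval t ≠ 0 := by
    intro t ht i j l hij hil hjl
    rw [eval_polyArea]
    rcases mul_eq_zero.mp ht with rfl | ht
    · have := polyMotion_weavingPoly a 0
      rw [Set.Icc.coe_zero] at this
      rw [this]
      exact (noThreeCollinear_iff (weavingConfig a 0).2).mp
        (noThreeCollinear_weavingConfig_zero ha) i j l hij hil hjl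
    · obtain rfl : t = 1 := by linarith
      have := polyMotion_weavingPoly a 1
      rw [Set.Icc.coe_one] at this
      rw [this]
      exact (noThreeCollinear_iff (weavingConfig a 1).2).mp
        (noThreeCollinear_weavingConfig_one ha) i j l hij hil hjl
  obtain ⟨w, hw, -, hwt⟩ := exists_isTransverse_perturb (weavingPoly a.1) hend
    (fun t ht => polyMotion_weavingPoly a ⟨t, ht⟩ ▸ (weavingConfig a ⟨t, ht⟩).2) hε
  have hb : (a.1.1 + w, a.1.2) - a.1 = (w, 0) := by
    ext <;> simp
  obtain ⟨a', ha', c, hc⟩ := hpath (a.1.1 + w, a.1.2) (by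
    rw [hb, Prod.norm_def]
    simpa [hε] using hw)
  rw [show a.1 = (a.1.1, a.1.2) from rfl, perturb_weavingPoly, ← ha'] at hwt
  have hv : a'.1.2 = a.1.2 := by rw [ha']
  have hv' : NoThreeCollinear a'.1.2 := hv ▸ ha
  have hγ : ∀ t, (weavingPath a' t).1 = polyMotion (weavingPoly a'.1) t := fun t =>
    (polyMotion_weavingPoly a' t).symm
  refine ⟨a', c, fun s => ?_, (isPleasant_weavingPath_iff a' hv').mp
    (isPleasant_of_isTransverse hγ (noThreeCollinear_weavingConfig_zero hv') hwt),
    (isStable_weavingPath_iff a' hv').mp (isStable_of_isTransverse hγ hwt)⟩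
  rw [hc, hb]
  simp

/-! ### Invariance under isotopy -/

/-- The path of the states of the weavings of an isotopy, at a fixed moment. -/
noncomputable def weavingEnd {a a' : SkewPair n} (c : Path a a') (u : unitInterval) :
    Path (weavingConfig a u) (weavingConfig a' u) :=
  c.map (f := fun a => weavingConfig a u)
    (continuous_weavingConfig.comp (Continuous.prodMk_left u))

/-- The square swept out by the motions of the weavings of an isotopy commutes up to homotopy. -/
theorem mk_weavingPath_trans {a a' : SkewPair n} (c : Path a a') :
    (Path.Homotopic.Quotient.mk (weavingPath a)).trans
        (Path.Homotopic.Quotient.mk (weavingEnd c 1)) =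
      (Path.Homotopic.Quotient.mk (weavingEnd c 0)).trans
        (Path.Homotopic.Quotient.mk (weavingPath a')) := by
  let F : C(SkewPair n × unitInterval, Config n) := ⟨_, continuous_weavingConfig⟩
  let ι : Path (0 : unitInterval) 1 := ⟨ContinuousMap.id _, rfl, rfl⟩
  have key : ((Path.refl a).prod ι).trans (c.prod (Path.refl 1)) |>.Homotopic
      ((c.prod (Path.refl 0)).trans ((Path.refl a').prod ι)) := by
    rw [Path.trans_prod_eq_prod_trans, Path.trans_prod_eq_prod_trans]
    refine ⟨Path.Homotopic.prodHomotopy ?_ ?_⟩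
    · exact (Path.Homotopy.reflTrans c).trans (Path.Homotopy.transRefl c).symm
    · exact (Path.Homotopy.transRefl ι).trans (Path.Homotopy.reflTrans ι).symm
  have h := Path.Homotopic.Quotient.eq.mpr (key.map F)
  rw [Path.map_trans, Path.map_trans, Path.Homotopic.Quotient.mk_trans,
    Path.Homotopic.Quotient.mk_trans] at h
  exact h

theorem weavingHolonomy_mul_holonomy {a a' : SkewPair n} (ha : NoThreeCollinear a.1.2)
    (ha' : NoThreeCollinear a'.1.2) (c : Path a a') :
    weavingHolonomy a * holonomy (Path.Homotopic.Quotient.mk (weavingEnd c 1)) =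
      holonomy (Path.Homotopic.Quotient.mk (weavingEnd c 0)) * weavingHolonomy a' := by
  have h := congrArg holonomy (mk_weavingPath_trans c)
  rw [holonomy_trans (noThreeCollinear_weavingConfig_zero ha)
    (noThreeCollinear_weavingConfig_one ha) (noThreeCollinear_weavingConfig_one ha'),
    holonomy_trans (noThreeCollinear_weavingConfig_zero ha)
    (noThreeCollinear_weavingConfig_zero ha') (noThreeCollinear_weavingConfig_one ha')] at h
  exact h

/-- Weavings that are isotopic through weavings with generic directions have the same holonomy,
since the states at infinite height stay in general position. -/
theorem weavingHolonomy_eq_of_path {a a' : SkewPair n} (c : Path a a')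
    (hc : ∀ s, NoThreeCollinear (c s).1.2) : weavingHolonomy a = weavingHolonomy a' := by
  have ha : NoThreeCollinear a.1.2 := by simpa using hc 0
  have ha' : NoThreeCollinear a'.1.2 := by simpa using hc 1
  have h0 : holonomy (Path.Homotopic.Quotient.mk (weavingEnd c 0)) = 1 :=
    holonomy_mk_eq_one _ fun s => noThreeCollinear_weavingConfig_zero (hc s)
  have h1 : holonomy (Path.Homotopic.Quotient.mk (weavingEnd c 1)) = 1 :=
    holonomy_mk_eq_one _ fun s => noThreeCollinear_weavingConfig_one (hc s)
  have h := weavingHolonomy_mul_holonomy ha ha' c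
  rwa [h0, h1, mul_one, one_mul] at h

/-- The point reflection of the plane, on configurations. -/
def negConfig : C(Config n, Config n) where
  toFun z := ⟨-z.1, fun _ _ h => z.2 (neg_injective h)⟩
  continuous_toFun := (continuous_neg.comp continuous_subtype_val).subtype_mk _

/-- The point reflection of the plane does not change holonomies. -/
theorem holonomy_map_negConfig {x y : Config n} (hx : NoThreeCollinear x.1)
    (hy : NoThreeCollinear y.1) (γ : Path x y) :
    holonomy (Path.Homotopic.Quotient.mk (γ.map negConfig.continuous)) =
      holonomy (Path.Homotopic.Quotient.mk γ) := by
  obtain ⟨δ, hδ, hp, hst⟩ := exists_homotopic_pleasant_stable hx hy γ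
  have hD : ∀ t, motion (δ.map negConfig.continuous) (id t) = (-1 : ℝ) • motion δ t := fun t =>
    (neg_one_smul ℝ (motion δ t)).symm
  have hr : ∀ t : unitInterval, (-1 : ℝ) ≠ 0 := fun t => by norm_num
  have hrange : ∀ t : unitInterval,
      NoThreeCollinear (motion (δ.map negConfig.continuous) t) ∨
        t ∈ Set.range (id : unitInterval → unitInterval) := fun t => Or.inr ⟨t, rfl⟩
  have hp' := (isPleasant_iff_of_rescaled strictMono_id hr hD hrange).mpr hp
  have hst' := (isStable_iff_of_rescaled strictMono_id (Set.range_id ▸ Set.ordConnected_univ)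
    (Set.range_id ▸ isOpen_univ) hr hD hrange).mpr hst
  have hx' : NoThreeCollinear (negConfig x).1 := (noThreeCollinear_neg_iff x.1).mpr hx
  have hy' : NoThreeCollinear (negConfig y).1 := (noThreeCollinear_neg_iff y.1).mpr hy
  rw [Path.Homotopic.Quotient.eq.mpr hδ, Path.Homotopic.Quotient.eq.mpr (hδ.map negConfig),
    holonomy_mk hx hy δ hp hst, holonomy_mk hx' hy' _ hp' hst',
    typeOf_eq_of_rescaled strictMono_id hr hD hrange hp hp']

theorem holonomy_eq_of_eq_neg {x y x' y' : Config n} (hx : NoThreeCollinear x.1)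
    (hy : NoThreeCollinear y.1) (γ : Path x y) (γ' : Path x' y')
    (h : ∀ t, (γ' t).1 = -(γ t).1) :
    holonomy (Path.Homotopic.Quotient.mk γ') = holonomy (Path.Homotopic.Quotient.mk γ) := by
  have h' : ∀ t, γ' t = negConfig (γ t) := fun t => Subtype.ext (h t)
  obtain rfl : x' = negConfig x := by simpa using h' 0
  obtain rfl : y' = negConfig y := by simpa using h' 1
  obtain rfl : γ' = γ.map negConfig.continuous := Path.ext (funext h')
  exact holonomy_map_negConfig hx hy γ

/-- Along an arbitrary isotopy the states at the two infinite heights are related by the point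
reflection of the plane, so that the holonomies of the weavings are conjugate. -/
theorem conjClasses_mk_weavingHolonomy_eq {a a' : SkewPair n} (ha : NoThreeCollinear a.1.2)
    (ha' : NoThreeCollinear a'.1.2) (c : Path a a') :
    ConjClasses.mk (weavingHolonomy a) = ConjClasses.mk (weavingHolonomy a') := by
  have h := weavingHolonomy_mul_holonomy ha ha' c
  rw [holonomy_eq_of_eq_neg (noThreeCollinear_weavingConfig_one ha)
      (noThreeCollinear_weavingConfig_one ha')
    (weavingEnd c 1) (weavingEnd c 0) fun s =>
      (weavingConfig_zero (c s)).trans (congrArg Neg.neg (weavingConfig_one (c s)).symm)] at h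
  rw [ConjClasses.mk_eq_mk_iff_isConj]
  refine IsConj.symm (isConj_iff.mpr
    ⟨holonomy (Path.Homotopic.Quotient.mk (weavingEnd c 1)), ?_⟩)
  rw [← h, mul_inv_cancel_right]

end WeavingHolonomy

/-! ### The invariants of weavings -/

section WeavingInvariants

variable {n : ℕ}

theorem Weaving.IsUpright.exists_isotopicThrough_pleasant_stable {W : Weaving n}
    (hW : W.IsUpright) :
    ∃ W' D, Weaving.IsotopicThrough Weaving.IsUpright W W' ∧ W'.NoThreeCoplanarDirections ∧
      W'.IsHorizontalMotion D ∧ IsPleasant 3 (trisecant D) ∧ IsStable D := by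
  obtain ⟨a, rfl⟩ := hW.exists_skewPair
  obtain ⟨b, hb, ⟨c⟩⟩ := a.exists_path_generic
  obtain ⟨b', c', hc', hp, hst⟩ := b.exists_path_pleasant_stable hb
  refine ⟨b'.toWeaving, _, isotopicThrough_of_path (c.trans c') fun s =>
    SkewPair.isUpright_toWeaving _, b'.noThreeCoplanarDirections_iff.mpr ?_,
    (b'.isHorizontalMotion_iff _).mpr rfl, hp, hst⟩
  have := hc' 1
  rw [c'.target] at this
  rw [this]
  exact hb

theorem Weaving.IsUpright.exists_isotopicThrough_generic_pleasant_stable {W : Weaving n}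
    (hW : W.IsUpright) (hgen : W.NoThreeCoplanarDirections) :
    ∃ W' D, Weaving.IsotopicThrough (fun V => V.IsUpright ∧ V.NoThreeCoplanarDirections) W W' ∧
      W'.IsHorizontalMotion D ∧ IsPleasant 3 (trisecant D) ∧ IsStable D := by
  obtain ⟨a, rfl⟩ := hW.exists_skewPair
  have ha := a.noThreeCoplanarDirections_iff.mp hgen
  obtain ⟨a', c, hc, hp, hst⟩ := a.exists_path_pleasant_stable ha
  refine ⟨a'.toWeaving, _, isotopicThrough_of_path c fun s =>
    ⟨SkewPair.isUpright_toWeaving _, (c s).noThreeCoplanarDirections_iff.mpr ?_⟩,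
    (a'.isHorizontalMotion_iff _).mpr rfl, hp, hst⟩
  rw [hc]
  exact ha

/-- The class of a weaving is computed from a weaving with generic directions isotopic to it. -/
theorem existsUnique_weavingConjClass (n : ℕ) :
    ∃! c : {W : Weaving n // W.IsUpright} → ConjClasses (FreeBraidGroup n 3),
      (∀ W W', Weaving.IsotopicThrough Weaving.IsUpright W.1 W'.1 → c W = c W') ∧
      (∀ W D, W.1.NoThreeCoplanarDirections → W.1.IsHorizontalMotion D →
        ∀ h : IsPleasant 3 (trisecant D), IsStable D →
          c W = ConjClasses.mk (freeBraid (typeOf h))) := by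
  choose a ha using fun W : {W : Weaving n // W.IsUpright} => W.2.exists_skewPair
  choose b hb hab using fun W : {W : Weaving n // W.IsUpright} => (a W).exists_path_generic
  have h1 : ∀ W W' : {W : Weaving n // W.IsUpright},
      Weaving.IsotopicThrough Weaving.IsUpright W.1 W'.1 →
      ConjClasses.mk (weavingHolonomy (b W)) = ConjClasses.mk (weavingHolonomy (b W')) := by
    intro W W' h
    rw [← ha W, ← ha W'] at h
    obtain ⟨c, -⟩ := exists_path_of_isotopicThrough (fun V hV => hV) h
    exact conjClasses_mk_weavingHolonomy_eq (hb W) (hb W')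
      (((hab W).some.symm.trans c).trans (hab W').some)
  have h2 : ∀ (W : {W : Weaving n // W.IsUpright}) D, W.1.NoThreeCoplanarDirections →
      W.1.IsHorizontalMotion D → ∀ h : IsPleasant 3 (trisecant D), IsStable D →
        ConjClasses.mk (weavingHolonomy (b W)) = ConjClasses.mk (freeBraid (typeOf h)) := by
    intro W D hgen hD h hst
    rw [← ha W, SkewPair.noThreeCoplanarDirections_iff] at hgen
    rw [← ha W, SkewPair.isHorizontalMotion_iff] at hD
    subst hD
    rw [← weavingHolonomy_eq (a W) hgen h hst]
    exact (conjClasses_mk_weavingHolonomy_eq hgen (hb W) (hab W).some).symm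
  refine ⟨fun W => ConjClasses.mk (weavingHolonomy (b W)), ⟨h1, h2⟩, ?_⟩
  rintro c ⟨hc1, hc2⟩
  funext W
  obtain ⟨W', D, hiso, hgen, hD, hp, hst⟩ := W.2.exists_isotopicThrough_pleasant_stable
  have hW' : W'.IsUpright := by
    obtain ⟨F, -, hF1, hF, -⟩ := hiso
    exact hF1 ▸ hF 1
  rw [hc1 W ⟨W', hW'⟩ hiso, hc2 ⟨W', hW'⟩ D hgen hD hp hst]
  exact ((h1 W ⟨W', hW'⟩ hiso).trans (h2 ⟨W', hW'⟩ D hgen hD hp hst)).symm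

theorem existsUnique_weavingBraid (n : ℕ) :
    ∃! g : {W : Weaving n // W.IsUpright ∧ W.NoThreeCoplanarDirections} → FreeBraidGroup n 3,
      (∀ W W', Weaving.IsotopicThrough
        (fun V => V.IsUpright ∧ V.NoThreeCoplanarDirections) W.1 W'.1 → g W = g W') ∧
      (∀ W D, W.1.IsHorizontalMotion D →
        ∀ h : IsPleasant 3 (trisecant D), IsStable D → g W = freeBraid (typeOf h)) := by
  choose a ha using
    fun W : {W : Weaving n // W.IsUpright ∧ W.NoThreeCoplanarDirections} => W.2.1.exists_skewPair
  have hgen : ∀ W, NoThreeCollinear (a W).1.2 := fun W => by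
    rw [← SkewPair.noThreeCoplanarDirections_iff, ha]
    exact W.2.2
  have h1 : ∀ W W' : {W : Weaving n // W.IsUpright ∧ W.NoThreeCoplanarDirections},
      Weaving.IsotopicThrough (fun V => V.IsUpright ∧ V.NoThreeCoplanarDirections) W.1 W'.1 →
      weavingHolonomy (a W) = weavingHolonomy (a W') := by
    intro W W' h
    rw [← ha W, ← ha W'] at h
    obtain ⟨c, hc⟩ := exists_path_of_isotopicThrough (fun V hV => hV.1) h
    exact weavingHolonomy_eq_of_path c fun s =>
      (c s).noThreeCoplanarDirections_iff.mp (hc s).2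
  have h2 : ∀ (W : {W : Weaving n // W.IsUpright ∧ W.NoThreeCoplanarDirections}) D,
      W.1.IsHorizontalMotion D → ∀ h : IsPleasant 3 (trisecant D), IsStable D →
        weavingHolonomy (a W) = freeBraid (typeOf h) := by
    intro W D hD h hst
    rw [← ha W, SkewPair.isHorizontalMotion_iff] at hD
    subst hD
    exact weavingHolonomy_eq (a W) (hgen W) h hst
  refine ⟨fun W => weavingHolonomy (a W), ⟨h1, h2⟩, ?_⟩
  rintro g ⟨hg1, hg2⟩
  funext W
  obtain ⟨W', D, hiso, hD, hp, hst⟩ := W.2.1.exists_isotopicThrough_generic_pleasant_stable W.2.2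
  have hW' : W'.IsUpright ∧ W'.NoThreeCoplanarDirections := by
    obtain ⟨F, -, hF1, hF, -⟩ := hiso
    exact hF1 ▸ hF 1
  rw [hg1 W ⟨W', hW'⟩ hiso, hg2 ⟨W', hW'⟩ D hD hp hst]
  exact ((h1 W ⟨W', hW'⟩ hiso).trans (h2 ⟨W', hW'⟩ D hD hp hst)).symm

end WeavingInvariants

theorem mainTheorem3 (n : ℕ) :
    -- collinearity is a 3-good property of pairwise distinct points of the plane
    (∀ z : Config n, IsGoodProperty 3 (CollinearOn z.1)) ∧
    -- motions with given initial and terminal states in general position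
    (∀ x y : Config n, NoThreeCollinear x.1 → NoThreeCollinear y.1 →
      (∀ γ : Path x y, ∃ δ : Path x y, γ.Homotopic δ ∧
        IsPleasant 3 (trisecant (motion δ)) ∧ IsStable (motion δ)) ∧
      (∀ γ δ : Path x y, ∀ hγ : IsPleasant 3 (trisecant (motion γ)),
        ∀ hδ : IsPleasant 3 (trisecant (motion δ)),
        IsStable (motion γ) → IsStable (motion δ) → γ.Homotopic δ →
        freeBraid (typeOf hγ) = freeBraid (typeOf hδ))) ∧
    -- pure braids: the invariant valued in `G_n^3`, which is a homomorphism
    (∀ x : Config n, NoThreeCollinear x.1 →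
      ∃! φ : PureBraidGroup n x →* FreeBraidGroup n 3,
        ∀ γ : Path x x, ∀ hγ : IsPleasant 3 (trisecant (motion γ)), IsStable (motion γ) →
          φ (pureBraid γ) = freeBraid (typeOf hγ)) ∧
    -- pictures up to equivalence are the same as elements of `G_n^3`
    ((∀ w : List (MultiIndex n 3), ∃ p : FreeBraidPicture n 3, p.word = w) ∧
      (∀ p q : FreeBraidPicture n 3,
        PictureEquiv p q ↔ freeBraid p.word = freeBraid q.word)) ∧
    -- pure braids: the invariant valued in pictures
    (∀ x : Config n, NoThreeCollinear x.1 →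
      ∃! ψ : PureBraidGroup n x → PictureClass n 3,
        ∀ γ : Path x x, ∀ hγ : IsPleasant 3 (trisecant (motion γ)), IsStable (motion γ) →
          ∀ p : FreeBraidPicture n 3, p.word = typeOf hγ → ψ (pureBraid γ) = Quot.mk _ p) ∧
    -- each upright weaving has one well-defined horizontal motion
    (∀ W : Weaving n, W.IsUpright → ∃! D : ℝ → Fin n → Plane, W.IsHorizontalMotion D) ∧
    -- each upright weaving is isotopic, through upright weavings, to a pleasant stable one
    (∀ W : Weaving n, W.IsUpright →
      ∃ W' D, Weaving.IsotopicThrough Weaving.IsUpright W W' ∧ W'.NoThreeCoplanarDirections ∧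
        W'.IsHorizontalMotion D ∧ IsPleasant 3 (trisecant D) ∧ IsStable D) ∧
    -- weavings: the conjugacy class is invariant under isotopies through upright weavings
    (∃! c : {W : Weaving n // W.IsUpright} → ConjClasses (FreeBraidGroup n 3),
      (∀ W W', Weaving.IsotopicThrough Weaving.IsUpright W.1 W'.1 → c W = c W') ∧
      (∀ W D, W.1.NoThreeCoplanarDirections → W.1.IsHorizontalMotion D →
        ∀ h : IsPleasant 3 (trisecant D), IsStable D →
          c W = ConjClasses.mk (freeBraid (typeOf h)))) ∧
    -- weavings whose initial and terminal states are in general position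
    (∀ W : Weaving n, W.IsUpright → W.NoThreeCoplanarDirections →
      ∃ W' D, Weaving.IsotopicThrough
          (fun V => V.IsUpright ∧ V.NoThreeCoplanarDirections) W W' ∧
        W'.IsHorizontalMotion D ∧ IsPleasant 3 (trisecant D) ∧ IsStable D) ∧
    -- for these the element of `G_n^3` itself is invariant
    (∃! g : {W : Weaving n // W.IsUpright ∧ W.NoThreeCoplanarDirections} → FreeBraidGroup n 3,
      (∀ W W', Weaving.IsotopicThrough
        (fun V => V.IsUpright ∧ V.NoThreeCoplanarDirections) W.1 W'.1 → g W = g W') ∧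
      (∀ W D, W.1.IsHorizontalMotion D →
        ∀ h : IsPleasant 3 (trisecant D), IsStable D → g W = freeBraid (typeOf h))) := by
  refine ⟨fun z => isGoodProperty_collinearOn z.2, fun x y hx hy =>
    ⟨exists_homotopic_pleasant_stable hx hy, fun γ δ hγ hδ hγs hδs h => ?_⟩,
    fun x hx => existsUnique_braidHom hx, ⟨exists_picture, fun p q => pictureEquiv_iff⟩,
    fun x hx => existsUnique_pictureMap hx, fun W hW => existsUnique_horizontalMotion hW,
    fun W hW => hW.exists_isotopicThrough_pleasant_stable, existsUnique_weavingConjClass n,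
    fun W hW hgen => hW.exists_isotopicThrough_generic_pleasant_stable hgen,
    existsUnique_weavingBraid n⟩
  rw [← holonomy_mk hx hy γ hγ hγs, ← holonomy_mk hx hy δ hδ hδs,
    Path.Homotopic.Quotient.eq.mpr h]
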